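/- Setting. Let $A,B$ be $C^*$-algebras (not necessarily unital), $\rho:A\to B$ an injective $*$-homomorphism, $\mathscr A\subseteq A$ a dense $*$-subalgebra and $\delta:\mathscr A\to B$ a linear map with $\delta(ab)=\delta(a)\rho(b)+\rho(a)\delta(b)$ and $\delta(a^*)=-\delta(a)^*$ for all $a,b\in\mathscr A$, which is closed in the following sense: if $a_n\in\mathscr A$, $a_n\to 0$ and $\delta(a_n)\to b$, then $b=0$. Let $A_\delta\subseteq A$ be the completion of $\mathscr A$ in the norm $\|a\|_\delta=\|a\|+\|\delta(a)\|$, and write again $\delta:A_\delta\to B$ for the extended derivation. Let $X$ be a (right) Hilbert $C^*$-module over $A$ and suppose there is a sequence $(\xi_n)$ in $X$ with $\langle\xi_n,\xi_m\rangle\in\mathscr A$ for all $n,m$ whose $A$-span $\{\sum_n\xi_n a_n\}$ is dense in $X$. Let $H_A$ be the standard Hilbert module of square summable sequences in $A$ (similarly for other $C^*$-algebras), let $H_{A_\delta}=\{(a_n)\in H_A: a_n\in A_\delta,\ (\delta(a_n))\in H_B\}$, let $\mathscr K(H_A)$ be the compact operators on $H_A$, and let $\mathscr K(H_A)_\delta\subseteq\mathscr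 K(H_A)$ be the completion of the finite matrices over $\mathscr A$ in the norm $\|M\|+\|\delta(M)\|$, where $\delta$ is applied entrywise. Let $\Omega_\delta(A)\subseteq B$ be the smallest $C^*$-subalgebra containing $\rho(A_\delta)$ and $\delta(A_\delta)$, on which $A$ acts by left multiplication through $\rho$, and let $X\hat\otimes_A\Omega_\delta(A)$ be the interior tensor product. For $\xi\in X$ let $T_\xi:\Omega_\delta(A)\to X\hat\otimes_A\Omega_\delta(A)$, $T_\xi(\omega)=\xi\otimes\omega$, with adjoint $T_\xi^*(\eta\otimes\omega)=\rho(\langle\xi,\eta\rangle)\,\omega$. Call $(W,K,(\zeta_k))$ an absorption triple if $W:X\to H_A$ is an adjointable isometry, $K:H_A\to H_A$ is a positive selfadjoint bounded operator, and $\zeta_k\in X$ are such that, with $P=WW^*$: $KP=PK$; $W^*KW:X\to X$ has dense image; $PK\in\mathscr K(H_A)$; $PK^2\in\mathscr K(H_A)_\delta$; and $W(\eta)=(\langle\zeta_k,\eta\rangle)_k$ for all $\eta\in X$. Theorem. An absorption triple exists. Moreover, for every absorption triple $(W,K,(\zeta_k))$ the following hold for $\mathscr X:=\mathrm{Im}\big(W^*K^2:H_{A_\delta}\to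 X\big)$. (a) $\mathscr X$ is dense in $X$ and is an $A_\delta$-submodule of $X$; $W(\xi)\in H_{A_\delta}$ and $\langle\xi,\eta\rangle\in A_\delta$ for all $\xi,\eta\in\mathscr X$. (b) The operator $W\otimes 1:X\hat\otimes_A\Omega_\delta(A)\to H_{\Omega_\delta(A)}$, $\xi\otimes\omega\mapsto(\rho(W(\xi)_n)\,\omega)_n$, is well defined, bounded and adjointable, with adjoint denoted $W^*\otimes 1$. Hence the Graßmann connection $\nabla_\delta:=(W^*\otimes1)\,\delta\,W:\mathscr X\to X\hat\otimes_A\Omega_\delta(A)$, where $\delta:H_{A_\delta}\to H_{\Omega_\delta(A)}$ is applied entrywise, is a well-defined $\mathbb C$-linear map. (c) $\nabla_\delta$ is Hermitian: $\delta(\langle\xi,\eta\rangle)=T_\xi^*\nabla_\delta(\eta)-\big(T_\eta^*\nabla_\delta(\xi)\big)^*$ for all $\xi,\eta\in\mathscr X$. (d) $\nabla_\delta$ satisfies the Leibniz rule: $\nabla_\delta(\eta a)=\nabla_\delta(\eta)\,\rho(a)+\eta\otimes\delta(a)$ for all $\eta\in\mathscr X$ and $a\in A_\delta$. -/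

import Mathlib

open Filter Topology
open scoped TensorProduct RightActions

set_option linter.unusedSectionVars false

noncomputable section

/-- A *right* inner product module over a C⋆-algebra `A`, with `A`-valued inner product that is
linear in the second variable and the norm `‖x‖ = ‖⟪x, x⟫‖ ^ (1 / 2)`; it is a Hilbert C⋆-module
when `E` is complete. This is the mirror image of Mathlib's `CStarModule`, which has left actions.
The remaining laws of a right module follow from these axioms because the form is definite. -/
class HilbertCMod (A E : Type*) [NonUnitalCStarAlgebra A] [PartialOrder A]
    [NormedAddCommGroup E] [NormedSpace ℂ E] [SMul Aᵐᵒᵖ E] extends Inner A E where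
  inner_add_right (x y z : E) : inner x (y + z) = inner x y + inner x z
  inner_smul_complex (x y : E) (c : ℂ) : inner x (c • y) = c • inner x y
  inner_smul_right (x y : E) (a : A) : inner x (y <• a) = inner x y * a
  star_inner (x y : E) : star (inner x y) = inner y x
  inner_self_nonneg (x : E) : 0 ≤ inner x x
  inner_self_eq_zero (x : E) : inner x x = 0 → x = 0
  norm_eq (x : E) : ‖x‖ = √‖inner x x‖

/-- A positive semidefinite `A`-valued form on a complex vector space with an action of `A`. -/
structure PreHilbertForm (A E : Type*) [NonUnitalCStarAlgebra A] [PartialOrder A]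
    [AddCommGroup E] [Module ℂ E] [SMul Aᵐᵒᵖ E] where
  form : E →ₗ⋆[ℂ] E →ₗ[ℂ] A
  form_smul_right (x y : E) (a : A) : form x (y <• a) = form x y * a
  star_form (x y : E) : star (form x y) = form y x
  nonneg (x : E) : 0 ≤ form x x

namespace PreHilbertForm

variable {A E : Type*} [NonUnitalCStarAlgebra A] [PartialOrder A]
    [AddCommGroup E] [Module ℂ E] [SMul Aᵐᵒᵖ E] (F : PreHilbertForm A E)

theorem form_smul_left (x y : E) (a : A) : F.form (x <• a) y = star a * F.form x y := by
  rw [← F.star_form, F.form_smul_right, star_mul, F.star_form]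

variable [StarOrderedRing A]

/-- The Cauchy–Schwarz inequality. -/
theorem norm_form_sq_le (x y : E) : ‖F.form x y‖ ^ 2 ≤ ‖F.form x x‖ * ‖F.form y y‖ := by
  set a := F.form x y with ha
  have key : ∀ t : ℝ, 0 < t → (2 * t - t ^ 2 * ‖F.form x x‖) * ‖a‖ ^ 2 ≤ ‖F.form y y‖ := by
    intro t ht
    have hst : star a = F.form y x := F.star_form x y
    have h0 := F.nonneg ((x <• (t • a)) - y)
    have h1 : F.form ((x <• (t • a)) - y) ((x <• (t • a)) - y)
        = (t ^ 2) • (star a * F.form x x * a) - (2 * t) • (star a * a) + F.form y y := by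
      simp only [map_sub, LinearMap.sub_apply, F.form_smul_left, F.form_smul_right, ← ha, ← hst,
        star_smul, smul_mul_assoc, mul_smul_comm, star_trivial, mul_assoc]
      module
    have h2 : star a * F.form x x * a ≤ ‖F.form x x‖ • (star a * a) :=
      CStarAlgebra.star_left_conjugate_le_norm_smul (hb := F.star_form x x)
    rw [h1] at h0
    have h3 : (2 * t - t ^ 2 * ‖F.form x x‖) • (star a * a) ≤ F.form y y := by
      have h4 : (t ^ 2) • (star a * F.form x x * a)
          ≤ (t ^ 2) • (‖F.form x x‖ • (star a * a)) :=
        smul_le_smul_of_nonneg_left h2 (by positivity)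
      rw [← sub_nonneg] at h4 ⊢
      have := add_nonneg h0 h4
      convert this using 1
      module
    by_cases hs : 0 ≤ 2 * t - t ^ 2 * ‖F.form x x‖
    · have := CStarAlgebra.norm_le_norm_of_nonneg_of_le
        (smul_nonneg hs (star_mul_self_nonneg a)) h3
      rwa [norm_smul, Real.norm_of_nonneg hs, CStarRing.norm_star_mul_self, ← pow_two] at this
    · have : (2 * t - t ^ 2 * ‖F.form x x‖) * ‖a‖ ^ 2 ≤ 0 :=
        mul_nonpos_of_nonpos_of_nonneg (le_of_not_ge hs) (by positivity)
      exact this.trans (norm_nonneg _)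
  rcases (norm_nonneg (F.form x x)).eq_or_lt with h | h
  · rw [← h, zero_mul]
    by_contra! hc
    have hc0 : ‖a‖ ≠ 0 := by rintro h0; simp [h0] at hc
    have := key ((‖F.form y y‖ + 1) / (2 * ‖a‖ ^ 2)) (by positivity)
    rw [← h, mul_zero, sub_zero, show 2 * ((‖F.form y y‖ + 1) / (2 * ‖a‖ ^ 2)) * ‖a‖ ^ 2
      = ‖F.form y y‖ + 1 by field_simp] at this
    linarith
  · have := key (1 / ‖F.form x x‖) (by positivity)
    field_simp at this
    linarith

/-- The seminorm of a positive semidefinite form. -/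
def seminorm : Seminorm ℂ E :=
  Seminorm.of (fun x => √‖F.form x x‖)
    (fun x y => by
      apply Real.sqrt_le_iff.2 ⟨by positivity, ?_⟩
      have h1 : ‖F.form x y‖ ≤ √‖F.form x x‖ * √‖F.form y y‖ := by
        rw [← Real.sqrt_mul (norm_nonneg _)]
        exact Real.le_sqrt_of_sq_le (F.norm_form_sq_le x y)
      have h2 : ‖F.form y x‖ = ‖F.form x y‖ := by rw [← F.star_form x y, norm_star]
      have h3 : ‖F.form (x + y) (x + y)‖
          ≤ ‖F.form x x‖ + ‖F.form x y‖ + (‖F.form y x‖ + ‖F.form y y‖) := by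
        simp only [map_add, LinearMap.add_apply]
        refine (norm_add_le _ _).trans ?_
        have := norm_add_le (F.form x x) (F.form y x)
        have := norm_add_le (F.form x y) (F.form y y)
        linarith
      have h4 := Real.sq_sqrt (norm_nonneg (F.form x x))
      have h5 := Real.sq_sqrt (norm_nonneg (F.form y y))
      nlinarith)
    (fun c x => by
      simp only [LinearMap.map_smulₛₗ, LinearMap.smul_apply, norm_smul, RingHom.id_apply,
        RCLike.norm_conj]
      rw [← mul_assoc, Real.sqrt_mul (by positivity), Real.sqrt_mul_self (norm_nonneg _)])

theorem seminorm_apply (x : E) : F.seminorm x = √‖F.form x x‖ := rfl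

theorem norm_form_le (x y : E) : ‖F.form x y‖ ≤ F.seminorm x * F.seminorm y := by
  rw [seminorm_apply, seminorm_apply, ← Real.sqrt_mul (norm_nonneg _)]
  exact Real.le_sqrt_of_sq_le (F.norm_form_sq_le x y)

theorem seminorm_smul_le (x : E) (a : A) : F.seminorm (x <• a) ≤ ‖a‖ * F.seminorm x := by
  rw [seminorm_apply, seminorm_apply, F.form_smul_left, F.form_smul_right]
  apply Real.sqrt_le_iff.2 ⟨by positivity, ?_⟩
  rw [mul_pow, Real.sq_sqrt (norm_nonneg _)]
  calc ‖star a * (F.form x x * a)‖ ≤ ‖star a‖ * (‖F.form x x‖ * ‖a‖) :=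
        (norm_mul_le _ _).trans (by gcongr; exact norm_mul_le _ _)
    _ = ‖a‖ ^ 2 * ‖F.form x x‖ := by rw [norm_star]; ring

end PreHilbertForm

namespace HilbertCMod

variable {A E : Type*} [NonUnitalCStarAlgebra A] [PartialOrder A]
    [NormedAddCommGroup E] [NormedSpace ℂ E] [SMul Aᵐᵒᵖ E] [HilbertCMod A E]

variable (A E) in
/-- The inner product of a Hilbert C⋆-module as a positive form. -/
def toForm : PreHilbertForm A E where
  form := LinearMap.mk₂'ₛₗ (starRingEnd ℂ) (RingHom.id ℂ) (fun x y : E => inner A x y)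
    (fun x y z => by
      rw [← star_inner, inner_add_right, star_add, star_inner, star_inner])
    (fun c x y => by
      rw [← star_inner, inner_smul_complex, star_smul, star_inner]; rfl)
    (fun x y z => inner_add_right x y z)
    (fun c x y => inner_smul_complex x y c)
  form_smul_right := inner_smul_right
  star_form := star_inner
  nonneg := inner_self_nonneg

theorem toForm_apply (x y : E) : (toForm A E).form x y = inner A x y := rfl

theorem ext_inner {x y : E} (h : ∀ z : E, inner A z x = inner A z y) : x = y := by
  rw [← sub_eq_zero]
  apply inner_self_eq_zero (A := A)
  rw [← toForm_apply, map_sub, toForm_apply, toForm_apply, h, sub_self]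

variable [StarOrderedRing A]

theorem norm_inner_le (x y : E) : ‖(inner A x y : A)‖ ≤ ‖x‖ * ‖y‖ := by
  rw [norm_eq (A := A) x, norm_eq (A := A) y]
  exact (toForm A E).norm_form_le x y

theorem norm_smul_le' (x : E) (a : A) : ‖x <• a‖ ≤ ‖a‖ * ‖x‖ := by
  rw [norm_eq (A := A) x, norm_eq (A := A) (x <• a)]
  exact (toForm A E).seminorm_smul_le x a

end HilbertCMod

/-- A C⋆-algebra as a Hilbert C⋆-module over itself, with `⟪a, b⟫ = a⋆ b`. -/
instance HilbertCMod.self (A : Type*) [NonUnitalCStarAlgebra A] [PartialOrder A]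
    [StarOrderedRing A] : HilbertCMod A A where
  inner a b := star a * b
  inner_add_right a b c := mul_add _ _ _
  inner_smul_complex a b c := mul_smul_comm _ _ _
  inner_smul_right a b c := (mul_assoc _ _ _).symm
  star_inner a b := by simp
  inner_self_nonneg a := star_mul_self_nonneg a
  inner_self_eq_zero a h := CStarRing.star_mul_self_eq_zero_iff a |>.1 h
  norm_eq a := by rw [CStarRing.norm_star_mul_self, Real.sqrt_mul_self (norm_nonneg _)]

/-! ### The standard module -/

theorem summable_of_nonneg_of_le_cstar {ι A : Type*} [NonUnitalCStarAlgebra A] [PartialOrder A]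
    [StarOrderedRing A] {f g : ι → A} (h0 : ∀ n, 0 ≤ f n) (h : ∀ n, f n ≤ g n)
    (hg : Summable g) : Summable f := by
  rw [summable_iff_vanishing_norm] at hg ⊢
  intro ε hε
  obtain ⟨s, hs⟩ := hg ε hε
  refine ⟨s, fun t ht => lt_of_le_of_lt ?_ (hs t ht)⟩
  exact CStarAlgebra.norm_le_norm_of_nonneg_of_le (Finset.sum_nonneg fun i _ => h0 i)
    (Finset.sum_le_sum fun i _ => h i)

section Std

variable (A : Type*) [NonUnitalCStarAlgebra A] [PartialOrder A] [StarOrderedRing A]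

/-- The sequences `(aₙ)` in `A` for which `∑ aₙ⋆ aₙ` converges in norm. (For a series with positive
terms in a C⋆-algebra, convergence of the partial sums is the same as unconditional
convergence.) -/
def stdSubmodule : Submodule ℂ (ℕ → A) where
  carrier := {a | Summable fun n => star (a n) * a n}
  zero_mem' := by simp
  add_mem' {a b} ha hb := by
    refine summable_of_nonneg_of_le_cstar (fun n => star_mul_self_nonneg _) (fun n => ?_)
      ((Summable.add ha hb).const_smul (2 : ℝ))
    rw [← sub_nonneg]
    refine (star_mul_self_nonneg (a n - b n)).trans_eq ?_
    simp only [Pi.add_apply, star_add, star_sub, add_mul, mul_add, sub_mul, mul_sub]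
    module
  smul_mem' c a ha := by
    refine (Summable.const_smul (c * star c) ha).congr fun n => ?_
    simp only [Pi.smul_apply, star_smul, smul_mul_assoc, mul_smul_comm, smul_smul]

variable {A} in
theorem mem_stdSubmodule {a : ℕ → A} :
    a ∈ stdSubmodule A ↔ Summable fun n => star (a n) * a n := Iff.rfl

variable {A} in
theorem summable_star_mul {a b : ℕ → A} (ha : a ∈ stdSubmodule A) (hb : b ∈ stdSubmodule A) :
    Summable fun n => star (a n) * b n := by
  have h (c : ℂ) : Summable fun n => star ((a + c • b) n) * (a + c • b) n :=
    mem_stdSubmodule.1 (add_mem ha (Submodule.smul_mem _ c hb))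
  refine (((((h 1).sub (h (-1))).add ((h Complex.I).const_smul (-Complex.I))).add
    ((h (-Complex.I)).const_smul Complex.I)).const_smul (1 / 4 : ℂ)).congr fun n => ?_
  simp only [Pi.add_apply, Pi.smul_apply, star_add, star_smul, add_mul, mul_add, smul_mul_assoc,
    mul_smul_comm, smul_add, smul_sub, smul_smul, RCLike.star_def, map_one, map_neg,
    Complex.conj_I]
  have hI : Complex.I * Complex.I = -1 := Complex.I_mul_I
  match_scalars <;>
    first | ring1 | linear_combination (1 / 2 : ℂ) * hI | linear_combination (-1 / 2 : ℂ) * hI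

/-- The standard module `H_A` of square summable sequences in `A`. -/
def StdModule : Type _ := stdSubmodule A

namespace StdModule

variable {A}

instance : AddCommGroup (StdModule A) := inferInstanceAs (AddCommGroup (stdSubmodule A))
instance : Module ℂ (StdModule A) := inferInstanceAs (Module ℂ (stdSubmodule A))

instance : CoeFun (StdModule A) (fun _ => ℕ → A) := ⟨fun x => x.1⟩

@[ext] theorem ext {x y : StdModule A} (h : ∀ n, x n = y n) : x = y := Subtype.ext (funext h)

theorem add_apply (x y : StdModule A) (n : ℕ) : (x + y) n = x n + y n := rfl
theorem smul_apply (c : ℂ) (x : StdModule A) (n : ℕ) : (c • x) n = c • x n := rfl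

theorem summable (x y : StdModule A) : Summable fun n => star (x n) * y n :=
  summable_star_mul x.2 y.2

instance : SMul Aᵐᵒᵖ (StdModule A) where
  smul a x := ⟨fun n => x n * a.unop, by
    refine (((summable x x).mul_left (star a.unop)).mul_right a.unop).congr fun n => ?_
    simp only [star_mul, mul_assoc]⟩

theorem op_smul_apply (x : StdModule A) (a : A) (n : ℕ) : (x <• a) n = x n * a := rfl

variable (A) in
/-- The form `⟪x, y⟫ = ∑ xₙ⋆ yₙ` on the standard module. -/
def preForm : PreHilbertForm A (StdModule A) where
  form := LinearMap.mk₂'ₛₗ (starRingEnd ℂ) (RingHom.id ℂ)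
    (fun x y => ∑' n, star (x n) * y n)
    (fun x y z => by
      rw [← (summable x z).tsum_add (summable y z)]
      simp only [add_apply, star_add, add_mul])
    (fun c x y => by
      rw [← (summable x y).tsum_const_smul]
      simp only [smul_apply, star_smul, smul_mul_assoc]; rfl)
    (fun x y z => by
      rw [← (summable x y).tsum_add (summable x z)]
      simp only [add_apply, mul_add])
    (fun c x y => by
      rw [← (summable x y).tsum_const_smul]
      simp only [smul_apply, mul_smul_comm]; rfl)
  form_smul_right x y a := by
    simp only [LinearMap.mk₂'ₛₗ_apply, op_smul_apply, ← mul_assoc]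
    exact (summable x y).tsum_mul_right a
  star_form x y := by
    simp only [LinearMap.mk₂'ₛₗ_apply, tsum_star, star_mul, star_star]
  nonneg x := tsum_nonneg fun n => star_mul_self_nonneg _

theorem preForm_apply (x y : StdModule A) :
    (preForm A).form x y = ∑' n, star (x n) * y n := rfl

instance : Norm (StdModule A) := ⟨fun x => (preForm A).seminorm x⟩

theorem norm_def (x : StdModule A) : ‖x‖ = (preForm A).seminorm x := rfl

theorem norm_apply_le (x : StdModule A) (n : ℕ) : ‖x n‖ ≤ ‖x‖ := by
  rw [norm_def, PreHilbertForm.seminorm_apply]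
  apply Real.le_sqrt_of_sq_le
  rw [pow_two, ← CStarRing.norm_star_mul_self, preForm_apply]
  exact CStarAlgebra.norm_le_norm_of_nonneg_of_le (star_mul_self_nonneg _)
    ((summable x x).le_tsum n fun _ _ => star_mul_self_nonneg _)

theorem normCore : NormedSpace.Core ℂ (StdModule A) where
  norm_nonneg x := apply_nonneg (preForm A).seminorm x
  norm_smul c x := map_smul_eq_mul (preForm A).seminorm c x
  norm_triangle x y := map_add_le_add (preForm A).seminorm x y
  norm_eq_zero_iff x := by
    refine ⟨fun h => ?_, fun h => by rw [h]; exact map_zero (preForm A).seminorm⟩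
    ext n
    have := norm_apply_le x n
    rw [h, norm_le_zero_iff] at this
    exact this

instance : NormedAddCommGroup (StdModule A) := NormedAddCommGroup.ofCore normCore
instance : NormedSpace ℂ (StdModule A) := NormedSpace.ofCore normCore

instance : HilbertCMod A (StdModule A) where
  inner x y := ∑' n, star (x n) * y n
  inner_add_right x y z := map_add ((preForm A).form x) y z
  inner_smul_complex x y c := map_smul ((preForm A).form x) c y
  inner_smul_right := (preForm A).form_smul_right
  star_inner := (preForm A).star_form
  inner_self_nonneg := (preForm A).nonneg
  inner_self_eq_zero x h := by
    have h1 : ‖x‖ = 0 := by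
      rw [norm_def, PreHilbertForm.seminorm_apply, preForm_apply]
      rw [h, norm_zero, Real.sqrt_zero]
    exact norm_eq_zero.1 h1
  norm_eq x := rfl

end StdModule

end Std

/-! ### Adjointable operators -/

section Operators

/-- An adjointable operator between Hilbert C⋆-modules, together with its (unique) adjoint. -/
structure Adjointable (A E F : Type*) [NonUnitalCStarAlgebra A] [PartialOrder A]
    [NormedAddCommGroup E] [NormedSpace ℂ E] [SMul Aᵐᵒᵖ E] [HilbertCMod A E]
    [NormedAddCommGroup F] [NormedSpace ℂ F] [SMul Aᵐᵒᵖ F] [HilbertCMod A F] where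
  toCLM : E →L[ℂ] F
  adj : F →L[ℂ] E
  inner_adj (x : E) (y : F) : inner A (toCLM x) y = inner A x (adj y)

variable (A : Type*) {E F : Type*} [NonUnitalCStarAlgebra A] [PartialOrder A] [StarOrderedRing A]
    [NormedAddCommGroup E] [NormedSpace ℂ E] [SMul Aᵐᵒᵖ E] [HilbertCMod A E]
    [NormedAddCommGroup F] [NormedSpace ℂ F] [SMul Aᵐᵒᵖ F] [HilbertCMod A F]

/-- The operator `z ↦ x ⟪y, z⟫`. -/
def rankOne (x : F) (y : E) : E →L[ℂ] F :=
  LinearMap.mkContinuous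
    { toFun := fun z => x <• (inner A y z : A)
      map_add' := fun z w => HilbertCMod.ext_inner (A := A) fun v => by
        simp only [HilbertCMod.inner_smul_right, HilbertCMod.inner_add_right, mul_add]
      map_smul' := fun c z => HilbertCMod.ext_inner (A := A) fun v => by
        simp only [HilbertCMod.inner_smul_right, HilbertCMod.inner_smul_complex,
          mul_smul_comm, RingHom.id_apply] }
    (‖x‖ * ‖y‖) fun z => by
      calc ‖x <• (inner A y z : A)‖ ≤ ‖(inner A y z : A)‖ * ‖x‖ :=
            HilbertCMod.norm_smul_le' x _
        _ ≤ (‖y‖ * ‖z‖) * ‖x‖ := by gcongr; exact HilbertCMod.norm_inner_le y z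
        _ = ‖x‖ * ‖y‖ * ‖z‖ := by ring

/-- The compact operators `𝒦(E, F)`: the closed linear span of the operators `z ↦ x ⟪y, z⟫`. -/
def compactOperators (E F : Type*)
    [NormedAddCommGroup E] [NormedSpace ℂ E] [SMul Aᵐᵒᵖ E] [HilbertCMod A E]
    [NormedAddCommGroup F] [NormedSpace ℂ F] [SMul Aᵐᵒᵖ F] [HilbertCMod A F] :
    Submodule ℂ (E →L[ℂ] F) :=
  (Submodule.span ℂ {T | ∃ (x : F) (y : E), T = rankOne A x y}).topologicalClosure

variable {A}

/-- The sequence with `a` in position `i` and zeroes elsewhere. -/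
def StdModule.single (i : ℕ) (a : A) : StdModule A :=
  ⟨Pi.single i a, summable_of_ne_finset_zero (s := {i}) fun n hn => by
    have hn : n ≠ i := by simpa using hn
    simp [hn]⟩

theorem StdModule.single_apply (i : ℕ) (a : A) (n : ℕ) :
    StdModule.single i a n = if n = i then a else 0 := by
  simp [StdModule.single, Pi.single_apply]

theorem StdModule.norm_single (i : ℕ) (a : A) : ‖StdModule.single i a‖ = ‖a‖ := by
  rw [StdModule.norm_def, PreHilbertForm.seminorm_apply, StdModule.preForm_apply,
    tsum_eq_single i (fun n hn => by simp [StdModule.single_apply, hn])]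
  simp only [StdModule.single_apply, if_true]
  rw [CStarRing.norm_star_mul_self, Real.sqrt_mul_self (norm_nonneg _)]

/-- The operator on the standard module given by the matrix with the single entry `a` in position
`(i, j)`, that is `x ↦ eᵢ (a xⱼ)`. -/
def matrixUnit (i j : ℕ) (a : A) : StdModule A →L[ℂ] StdModule A :=
  LinearMap.mkContinuous
    { toFun := fun x => StdModule.single i (a * x j)
      map_add' := fun x y => by
        ext n
        simp only [StdModule.add_apply, StdModule.single_apply, mul_add]
        split_ifs <;> simp
      map_smul' := fun c x => by
        ext n
        simp only [StdModule.smul_apply, StdModule.single_apply, mul_smul_comm, RingHom.id_apply]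
        split_ifs <;> simp }
    ‖a‖ fun x => by
      refine (StdModule.norm_single i _).trans_le ((norm_mul_le _ _).trans ?_)
      gcongr
      exact StdModule.norm_apply_le x j

end Operators

/-! ### Interior tensor products -/

section Tensor

variable {A C : Type*} [NonUnitalCStarAlgebra A] [PartialOrder A] [StarOrderedRing A]
    [NonUnitalCStarAlgebra C] [PartialOrder C] [StarOrderedRing C]

theorem exists_sub_nonneg {D : Type*} [NonUnitalCStarAlgebra D] [PartialOrder D]
    [StarOrderedRing D] (m : D) (hm : IsSelfAdjoint m) :
    ∃ p n : D, 0 ≤ p ∧ 0 ≤ n ∧ n * p = 0 ∧ p - n = m :=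
  ⟨m⁺, m⁻, CFC.posPart_nonneg m, CFC.negPart_nonneg m, CFC.negPart_mul_posPart m,
    CFC.posPart_sub_negPart m hm⟩

theorem exists_eq_star_mul_self {D : Type*} [NonUnitalCStarAlgebra D] [PartialOrder D]
    [StarOrderedRing D] (d : D) (hd : 0 ≤ d) : ∃ s, d = star s * s :=
  CStarAlgebra.nonneg_iff_eq_star_mul_self.1 hd

/-- A Gram matrix in a Hilbert C⋆-module is positive. -/
theorem gram_nonneg {ι X : Type*} [Fintype ι] [DecidableEq ι]
    [NormedAddCommGroup X] [NormedSpace ℂ X] [SMul Aᵐᵒᵖ X] [HilbertCMod A X] (ξ : ι → X) :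
    0 ≤ (CStarMatrix.ofMatrix (Matrix.of fun i j => (inner A (ξ i) (ξ j) : A)) :
      CStarMatrix ι ι A) := by
  set M : CStarMatrix ι ι A := CStarMatrix.ofMatrix (Matrix.of fun i j => inner A (ξ i) (ξ j))
    with hM
  have hsa : IsSelfAdjoint M := by
    ext i j
    exact HilbertCMod.star_inner (ξ j) (ξ i)
  obtain ⟨R, T, hR0, hT0, hTR, hRT⟩ := exists_sub_nonneg M hsa
  have hTsa : star T = T := (IsSelfAdjoint.of_nonneg hT0).star_eq
  have hM' : T * M * T = -(T * T * T) := by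
    rw [← hRT, mul_sub, hTR, zero_sub, neg_mul]
  have hT3 : 0 ≤ T * T * T := by
    have := star_left_conjugate_nonneg hT0 T
    rwa [hTsa] at this
  obtain ⟨S, hS⟩ := exists_eq_star_mul_self _ hT3
  have hdiag (k : ι) : (T * M * T) k k
      = inner A (∑ i, ξ i <• (T i k)) (∑ i, ξ i <• (T i k)) := by
    rw [← HilbertCMod.toForm_apply]
    simp only [map_sum, LinearMap.sum_apply, PreHilbertForm.form_smul_left,
      PreHilbertForm.form_smul_right, HilbertCMod.toForm_apply]
    rw [CStarMatrix.mul_apply]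
    simp only [CStarMatrix.mul_apply, Finset.sum_mul]
    refine Finset.sum_congr rfl fun i _ => Finset.sum_congr rfl fun j _ => ?_
    have h1 : T k j = star (T j k) := by
      conv_lhs => rw [← hTsa]
      rfl
    rw [h1]
    rfl
  have hS0 : S = 0 := by
    ext i k
    have h1 : 0 ≤ (T * M * T) k k := by
      rw [hdiag]; exact HilbertCMod.inner_self_nonneg _
    rw [hM', hS] at h1
    have h2 : ∑ i, star (S i k) * S i k = (star S * S) k k := by
      rw [CStarMatrix.mul_apply]; rfl
    have h3 : ∑ i, star (S i k) * S i k = 0 := by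
      refine le_antisymm ?_ (Finset.sum_nonneg fun i _ => star_mul_self_nonneg _)
      rw [h2]
      exact neg_nonneg.1 h1
    have h4 := (Finset.sum_eq_zero_iff_of_nonneg fun i _ => star_mul_self_nonneg (S i k)).1 h3 i
      (Finset.mem_univ i)
    exact (CStarRing.star_mul_self_eq_zero_iff _).1 h4
  rw [hS0, mul_zero] at hS
  have hT2 : T * T = 0 := by
    rw [← CStarRing.star_mul_self_eq_zero_iff, star_mul, hTsa, ← mul_assoc, hS, zero_mul]
  have hT : T = 0 := by
    rw [← CStarRing.star_mul_self_eq_zero_iff, hTsa, hT2]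
  rw [hT, sub_zero] at hRT
  rwa [← hRT]


theorem gram_form_nonneg {ι X : Type*} [Fintype ι] [DecidableEq ι]
    [NormedAddCommGroup X] [NormedSpace ℂ X] [SMul Aᵐᵒᵖ X] [HilbertCMod A X]
    (φ : A →⋆ₙₐ[ℂ] C) (ξ : ι → X) (ω : ι → C) :
    0 ≤ ∑ i, ∑ j, star (ω i) * φ (inner A (ξ i) (ξ j)) * ω j := by
  obtain ⟨S, hS⟩ := exists_eq_star_mul_self _ (gram_nonneg (A := A) ξ)
  have h1 (i j : ι) : (inner A (ξ i) (ξ j) : A) = ∑ k, star (S k i) * S k j := by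
    have := congrFun (congrFun hS i) j
    rw [CStarMatrix.mul_apply] at this
    exact this
  have h2 : ∑ i, ∑ j, star (ω i) * φ (inner A (ξ i) (ξ j)) * ω j
      = ∑ k, star (∑ i, φ (S k i) * ω i) * ∑ j, φ (S k j) * ω j := by
    simp only [h1, map_sum, map_mul, map_star, Finset.mul_sum, Finset.sum_mul, star_sum, star_mul]
    rw [Finset.sum_comm' (t' := Finset.univ) (s' := fun _ => Finset.univ) (by simp)]
    conv_rhs => rw [Finset.sum_comm]
    refine Finset.sum_congr rfl fun y _ => ?_
    conv_rhs => rw [Finset.sum_comm]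
    simp only [mul_assoc]
  rw [h2]
  exact Finset.sum_nonneg fun k _ => star_mul_self_nonneg _

variable (X : Type*) [NormedAddCommGroup X] [NormedSpace ℂ X] [SMul Aᵐᵒᵖ X] [HilbertCMod A X]

/-- The algebraic tensor product of `X` and `C`, to be equipped with the form
`⟪ξ ⊗ ω, η ⊗ θ⟫ = ω⋆ φ(⟪ξ, η⟫) θ`. -/
def PreTensor (_φ : A →⋆ₙₐ[ℂ] C) : Type _ := X ⊗[ℂ] C

namespace PreTensor

variable {X} (φ : A →⋆ₙₐ[ℂ] C)

instance : AddCommGroup (PreTensor X φ) := inferInstanceAs (AddCommGroup (X ⊗[ℂ] C))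
instance : Module ℂ (PreTensor X φ) := inferInstanceAs (Module ℂ (X ⊗[ℂ] C))

/-- The elementary tensor `ξ ⊗ ω`. -/
def tmul (ξ : X) (ω : C) : PreTensor X φ := TensorProduct.tmul ℂ ξ ω

/-- The right action `(ξ ⊗ ω) c = ξ ⊗ (ω c)`. -/
instance : SMul Cᵐᵒᵖ (PreTensor X φ) where
  smul c := TensorProduct.map (LinearMap.id : X →ₗ[ℂ] X) (LinearMap.mulRight ℂ c.unop)

theorem tmul_smul (ξ : X) (ω c : C) : tmul φ ξ ω <• c = tmul φ ξ (ω * c) := rfl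

theorem add_op_smul (x y : PreTensor X φ) (c : C) : (x + y) <• c = x <• c + y <• c :=
  map_add (TensorProduct.map (LinearMap.id : X →ₗ[ℂ] X) (LinearMap.mulRight ℂ c)) x y

theorem zero_op_smul (c : C) : (0 : PreTensor X φ) <• c = 0 :=
  map_zero (TensorProduct.map (LinearMap.id : X →ₗ[ℂ] X) (LinearMap.mulRight ℂ c))

/-- The map `T_ξ⋆ : η ⊗ θ ↦ φ(⟪ξ, η⟫) θ`. -/
def contract (ξ : X) : PreTensor X φ →ₗ[ℂ] C :=
  TensorProduct.lift (LinearMap.mk₂ ℂ (fun η θ => φ (inner A ξ η) * θ)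
    (fun η η' θ => by rw [HilbertCMod.inner_add_right, map_add, add_mul])
    (fun c η θ => by rw [HilbertCMod.inner_smul_complex, map_smul, smul_mul_assoc])
    (fun η θ θ' => mul_add _ _ _)
    (fun c η θ => mul_smul_comm _ _ _))

theorem contract_tmul (ξ η : X) (θ : C) :
    contract φ ξ (tmul φ η θ) = φ (inner A ξ η) * θ := rfl

theorem contract_add (ξ ξ' : X) : contract φ (ξ + ξ') = contract φ ξ + contract φ ξ' := by
  refine TensorProduct.ext' fun η θ => ?_
  change contract φ (ξ + ξ') (tmul φ η θ) = contract φ ξ (tmul φ η θ) + contract φ ξ' (tmul φ η θ)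
  simp only [contract_tmul, ← add_mul, ← map_add]
  rw [← HilbertCMod.star_inner, HilbertCMod.inner_add_right, star_add, HilbertCMod.star_inner,
    HilbertCMod.star_inner]

theorem contract_smul (c : ℂ) (ξ : X) :
    contract φ (c • ξ) = (starRingEnd ℂ c) • contract φ ξ := by
  refine TensorProduct.ext' fun η θ => ?_
  change contract φ (c • ξ) (tmul φ η θ) = (starRingEnd ℂ c) • contract φ ξ (tmul φ η θ)
  simp only [contract_tmul]
  rw [← HilbertCMod.star_inner, HilbertCMod.inner_smul_complex, star_smul, HilbertCMod.star_inner,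
    map_smul, smul_mul_assoc]
  rfl

/-- The sesquilinear map determined by `(ξ ⊗ ω, η ⊗ θ) ↦ ω⋆ φ(⟪ξ, η⟫) θ`. -/
def sesq : PreTensor X φ →ₗ⋆[ℂ] PreTensor X φ →ₗ[ℂ] C :=
  TensorProduct.lift (LinearMap.mk₂'ₛₗ (starRingEnd ℂ) (starRingEnd ℂ)
    (fun (ξ : X) (ω : C) => LinearMap.mulLeft ℂ (star ω) ∘ₗ contract φ ξ)
    (fun ξ ξ' ω => by rw [contract_add, LinearMap.comp_add])
    (fun c ξ ω => by rw [contract_smul, LinearMap.comp_smul])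
    (fun ξ ω ω' => by ext z; simp [add_mul])
    (fun c ξ ω => by ext z; simp [smul_mul_assoc]))

theorem sesq_tmul_left (ξ : X) (ω : C) (z : PreTensor X φ) :
    sesq φ (tmul φ ξ ω) z = star ω * contract φ ξ z := rfl

theorem sesq_tmul (ξ η : X) (ω θ : C) :
    sesq φ (tmul φ ξ ω) (tmul φ η θ) = star ω * (φ (inner A ξ η) * θ) := rfl

theorem induction_on {p : PreTensor X φ → Prop} (z : PreTensor X φ) (zero : p 0)
    (tmul : ∀ ξ ω, p (tmul φ ξ ω)) (add : ∀ x y, p x → p y → p (x + y)) : p z :=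
  TensorProduct.induction_on z zero tmul add

theorem exists_sum (z : PreTensor X φ) :
    ∃ (n : ℕ) (ξ : Fin n → X) (ω : Fin n → C), z = ∑ i, tmul φ (ξ i) (ω i) := by
  induction z using induction_on with
  | zero => exact ⟨0, Fin.elim0, Fin.elim0, by simp⟩
  | tmul ξ ω => exact ⟨1, fun _ => ξ, fun _ => ω, by simp⟩
  | add x y hx hy =>
    obtain ⟨n, ξ, ω, rfl⟩ := hx
    obtain ⟨m, η, θ, rfl⟩ := hy
    exact ⟨n + m, Fin.append ξ η, Fin.append ω θ, by simp [Fin.sum_univ_add]⟩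

/-- The positive form on the algebraic tensor product. -/
def preForm : PreHilbertForm C (PreTensor X φ) where
  form := sesq φ
  form_smul_right x y c := by
    induction x using induction_on with
    | zero => simp
    | add x x' hx hx' => simp only [map_add, LinearMap.add_apply, hx, hx', add_mul]
    | tmul ξ ω =>
      induction y using induction_on with
      | zero => simp [zero_op_smul]
      | add y y' hy hy' => simp only [add_op_smul, map_add, hy, hy', add_mul]
      | tmul η θ => simp only [tmul_smul, sesq_tmul, mul_assoc]
  star_form x y := by
    induction x using induction_on with
    | zero => simp
    | add x x' hx hx' => simp only [map_add, LinearMap.add_apply, star_add, hx, hx']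
    | tmul ξ ω =>
      induction y using induction_on with
      | zero => simp
      | add y y' hy hy' => simp only [LinearMap.add_apply, map_add, star_add, hy, hy']
      | tmul η θ =>
        simp only [sesq_tmul, star_mul, star_star, ← map_star, HilbertCMod.star_inner, mul_assoc]
  nonneg x := by
    obtain ⟨n, ξ, ω, rfl⟩ := exists_sum φ x
    refine (gram_form_nonneg φ ξ ω).trans_eq ?_
    simp only [map_sum, LinearMap.sum_apply, sesq_tmul, mul_assoc]
    rw [Finset.sum_comm]

instance : SeminormedAddCommGroup (PreTensor X φ) :=
  (preForm φ).seminorm.toSeminormedAddCommGroup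

theorem norm_def (z : PreTensor X φ) : ‖z‖ = (preForm φ).seminorm z := rfl

instance : NormedSpace ℂ (PreTensor X φ) where
  norm_smul_le c z := (map_smul_eq_mul (preForm φ).seminorm c z).le

theorem norm_sesq_le (x y : PreTensor X φ) : ‖sesq φ x y‖ ≤ ‖x‖ * ‖y‖ :=
  (preForm φ).norm_form_le x y

theorem norm_op_smul_le (x : PreTensor X φ) (c : C) : ‖x <• c‖ ≤ ‖c‖ * ‖x‖ :=
  (preForm φ).seminorm_smul_le x c

theorem norm_tmul_le (ξ : X) (ω : C) : ‖tmul φ ξ ω‖ ≤ ‖ξ‖ * ‖ω‖ := by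
  have h : (preForm φ).form (tmul φ ξ ω) (tmul φ ξ ω) = star ω * (φ (inner A ξ ξ) * ω) := rfl
  rw [norm_def, PreHilbertForm.seminorm_apply, h]
  refine Real.sqrt_le_iff.2 ⟨by positivity, ?_⟩
  calc ‖star ω * (φ (inner A ξ ξ) * ω)‖ ≤ ‖star ω‖ * (‖φ (inner A ξ ξ)‖ * ‖ω‖) :=
        (norm_mul_le _ _).trans (by gcongr; exact norm_mul_le _ _)
    _ ≤ ‖ω‖ * ((‖ξ‖ * ‖ξ‖) * ‖ω‖) := by
        rw [norm_star]
        gcongr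
        exact (NonUnitalStarAlgHom.norm_apply_le φ _).trans (HilbertCMod.norm_inner_le ξ ξ)
    _ = (‖ξ‖ * ‖ω‖) ^ 2 := by ring

theorem norm_contract_le (ξ : X) (z : PreTensor X φ) : ‖contract φ ξ z‖ ≤ ‖ξ‖ * ‖z‖ := by
  set b := contract φ ξ z with hb
  have h1 : ‖b‖ * ‖b‖ ≤ (‖ξ‖ * ‖b‖) * ‖z‖ := by
    rw [← CStarRing.norm_star_mul_self, hb, ← sesq_tmul_left, ← hb]
    exact (norm_sesq_le φ _ _).trans (by gcongr; exact norm_tmul_le φ ξ b)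
  rcases (norm_nonneg b).eq_or_lt with h | h
  · rw [← h]; positivity
  · refine le_of_mul_le_mul_right ?_ h
    linarith

end PreTensor

/-- The interior tensor product `X ⊗̂_A C` of the Hilbert `A`-module `X` with the C⋆-algebra `C`,
on which `A` acts from the left through `φ`: the Hausdorff completion of the algebraic tensor
product with respect to the form `⟪ξ ⊗ ω, η ⊗ θ⟫ = ω⋆ φ(⟪ξ, η⟫) θ`. -/
def InteriorTensor (φ : A →⋆ₙₐ[ℂ] C) : Type _ := UniformSpace.Completion (PreTensor X φ)

namespace InteriorTensor

open UniformSpace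

variable {X} (φ : A →⋆ₙₐ[ℂ] C)

instance : NormedAddCommGroup (InteriorTensor X φ) :=
  inferInstanceAs (NormedAddCommGroup (Completion (PreTensor X φ)))
instance : NormedSpace ℂ (InteriorTensor X φ) :=
  inferInstanceAs (NormedSpace ℂ (Completion (PreTensor X φ)))
instance : CompleteSpace (InteriorTensor X φ) :=
  inferInstanceAs (CompleteSpace (Completion (PreTensor X φ)))

/-- The canonical map from the algebraic tensor product. -/
def ι : PreTensor X φ →L[ℂ] InteriorTensor X φ := Completion.toComplL

theorem denseRange_ι : DenseRange (ι (X := X) φ) := Completion.denseRange_coe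

theorem norm_ι (z : PreTensor X φ) : ‖ι φ z‖ = ‖z‖ := Completion.norm_coe z

theorem isUniformInducing_ι : IsUniformInducing (ι (X := X) φ) :=
  Completion.isUniformInducing_coe _

/-- The elementary tensor `ξ ⊗ ω`. -/
def tmul (ξ : X) (ω : C) : InteriorTensor X φ := ι φ (PreTensor.tmul φ ξ ω)

/-- The operator `z ↦ z c` on the algebraic tensor product. -/
def actPre (c : C) : PreTensor X φ →L[ℂ] PreTensor X φ :=
  LinearMap.mkContinuous
    (TensorProduct.map (LinearMap.id : X →ₗ[ℂ] X) (LinearMap.mulRight ℂ c)) ‖c‖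
    (fun z => PreTensor.norm_op_smul_le φ z c)

/-- The right action of `C`, the continuous extension of `(ξ ⊗ ω) c = ξ ⊗ (ω c)`. -/
instance : SMul Cᵐᵒᵖ (InteriorTensor X φ) where
  smul c := ((ι φ).comp (actPre φ c.unop)).extend (ι φ)

theorem ι_op_smul (z : PreTensor X φ) (c : C) : ι φ z <• c = ι φ (z <• c) :=
  ((ι φ).comp (actPre φ c)).extend_eq (denseRange_ι φ) (isUniformInducing_ι φ) z

theorem continuous_op_smul (c : C) : Continuous fun z : InteriorTensor X φ => z <• c :=
  (((ι φ).comp (actPre φ c)).extend (ι φ)).continuous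

/-- The form on the algebraic tensor product as a bounded sesquilinear map. -/
def sesqPre : PreTensor X φ →L⋆[ℂ] PreTensor X φ →L[ℂ] C :=
  LinearMap.mkContinuous₂ (PreTensor.sesq φ) 1 fun x y => by
    rw [one_mul]; exact PreTensor.norm_sesq_le φ x y

/-- The continuous extension of the form to the completion, one variable at a time. -/
def sesqL : InteriorTensor X φ →L⋆[ℂ] InteriorTensor X φ →L[ℂ] C :=
  ((((sesqPre φ).extend (ι φ)).flip).extend (ι φ)).flip

/-- The inner product, the continuous extension of the form on the algebraic tensor product. -/
instance : Inner C (InteriorTensor X φ) where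
  inner x y := sesqL φ x y

theorem inner_def (x y : InteriorTensor X φ) : (inner C x y : C) = sesqL φ x y := rfl

theorem inner_ι (x y : PreTensor X φ) : (inner C (ι φ x) (ι φ y) : C) = PreTensor.sesq φ x y := by
  rw [inner_def, sesqL, ContinuousLinearMap.flip_apply,
    ContinuousLinearMap.extend_eq _ (denseRange_ι φ) (isUniformInducing_ι φ),
    ContinuousLinearMap.flip_apply,
    ContinuousLinearMap.extend_eq _ (denseRange_ι φ) (isUniformInducing_ι φ)]
  rfl

theorem continuous_inner :
    Continuous fun p : InteriorTensor X φ × InteriorTensor X φ => (inner C p.1 p.2 : C) := by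
  simp only [inner_def]
  exact ((sesqL φ).continuous.comp continuous_fst).clm_apply continuous_snd

@[elab_as_elim]
theorem induction_ι {p : InteriorTensor X φ → Prop} (z : InteriorTensor X φ)
    (hc : IsClosed {z | p z}) (h : ∀ z, p (ι φ z)) : p z :=
  Completion.induction_on z hc h

theorem norm_eq' (z : InteriorTensor X φ) : ‖z‖ = √‖(inner C z z : C)‖ := by
  induction z using induction_ι with
  | hc =>
    have := continuous_inner (X := X) φ
    exact isClosed_eq continuous_norm
      ((this.comp (continuous_id.prodMk continuous_id)).norm.sqrt)
  | h z => rw [norm_ι, inner_ι]; rfl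

instance : HilbertCMod C (InteriorTensor X φ) where
  inner_add_right x y z := by simp only [inner_def, map_add]
  inner_smul_complex x y c := by simp only [inner_def, map_smul]
  inner_smul_right x y c := by
    have hc := continuous_inner (X := X) φ
    have hs := continuous_op_smul (X := X) φ c
    induction x using induction_ι with
    | hc =>
      exact isClosed_eq (hc.comp (continuous_id.prodMk continuous_const))
        ((hc.comp (continuous_id.prodMk continuous_const)).mul continuous_const)
    | h x =>
      induction y using induction_ι with
      | hc =>
        exact isClosed_eq (hc.comp (continuous_const.prodMk hs))
          ((hc.comp (continuous_const.prodMk continuous_id)).mul continuous_const)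
      | h y =>
        rw [ι_op_smul, inner_ι, inner_ι]
        exact (PreTensor.preForm φ).form_smul_right x y c
  star_inner x y := by
    have hc := continuous_inner (X := X) φ
    induction x using induction_ι with
    | hc =>
      exact isClosed_eq (hc.comp (continuous_id.prodMk continuous_const)).star
        (hc.comp (continuous_const.prodMk continuous_id))
    | h x =>
      induction y using induction_ι with
      | hc =>
        exact isClosed_eq (hc.comp (continuous_const.prodMk continuous_id)).star
          (hc.comp (continuous_id.prodMk continuous_const))
      | h y =>
        rw [inner_ι, inner_ι]
        exact (PreTensor.preForm φ).star_form x y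
  inner_self_nonneg x := by
    have hc := continuous_inner (X := X) φ
    induction x using induction_ι with
    | hc =>
      exact CStarAlgebra.isClosed_nonneg.preimage (hc.comp (continuous_id.prodMk continuous_id))
    | h x =>
      rw [inner_ι]
      exact (PreTensor.preForm φ).nonneg x
  inner_self_eq_zero x h := by
    have := norm_eq' φ x
    rw [h, norm_zero, Real.sqrt_zero] at this
    exact norm_eq_zero.1 this
  norm_eq := norm_eq' φ

/-- The adjointable operator `T_ξ : C → X ⊗̂_A C`, `ω ↦ ξ ⊗ ω`, whose adjoint is the continuous
extension of `η ⊗ ω ↦ φ(⟪ξ, η⟫) ω`. -/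
def creation (ξ : X) : Adjointable C C (InteriorTensor X φ) where
  toCLM := (ι φ).comp (LinearMap.mkContinuous (TensorProduct.mk ℂ X C ξ) ‖ξ‖
    fun ω => PreTensor.norm_tmul_le φ ξ ω)
  adj := ((PreTensor.contract φ ξ).mkContinuous ‖ξ‖ (PreTensor.norm_contract_le φ ξ)).extend (ι φ)
  inner_adj ω z := by
    have hc := continuous_inner (X := X) φ
    induction z using induction_ι with
    | hc =>
      exact isClosed_eq (hc.comp (continuous_const.prodMk continuous_id))
        (continuous_const.mul (ContinuousLinearMap.continuous _))
    | h z =>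
      rw [ContinuousLinearMap.extend_eq _ (denseRange_ι φ) (isUniformInducing_ι φ)]
      exact inner_ι φ (PreTensor.tmul φ ξ ω) z

theorem creation_apply (ξ : X) (ω : C) : (creation φ ξ).toCLM ω = tmul φ ξ ω := rfl

theorem creation_adj_tmul (ξ η : X) (ω : C) :
    (creation φ ξ).adj (tmul φ η ω) = φ (inner A ξ η) * ω :=
  ContinuousLinearMap.extend_eq _ (denseRange_ι φ) (isUniformInducing_ι φ) _

end InteriorTensor

end Tensor

/-! ### Closed derivations and differentiable structure -/

/-- A densely defined closed derivation `δ : 𝒜 → B` relative to `ρ : A → B`, compatible with the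
adjoint, on a dense ⋆-subalgebra `𝒜 = dom` of `A`. -/
structure ClosedStarDerivation {A B : Type*} [NonUnitalCStarAlgebra A] [NonUnitalCStarAlgebra B]
    (ρ : A →⋆ₙₐ[ℂ] B) where
  dom : NonUnitalStarSubalgebra ℂ A
  dense_dom : Dense (dom : Set A)
  δ : dom →ₗ[ℂ] B
  map_mul (a b : dom) : δ (a * b) = δ a * ρ b + ρ a * δ b
  map_star (a : dom) : δ (star a) = -star (δ a)
  closed (u : ℕ → dom) (b : B) : Tendsto (fun n => (u n : A)) atTop (𝓝 0) →
    Tendsto (fun n => δ (u n)) atTop (𝓝 b) → b = 0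

namespace ClosedStarDerivation

variable {A B : Type*} [NonUnitalCStarAlgebra A] [PartialOrder A] [StarOrderedRing A]
    [NonUnitalCStarAlgebra B] [PartialOrder B] [StarOrderedRing B]
    {ρ : A →⋆ₙₐ[ℂ] B} (D : ClosedStarDerivation ρ)

/-- The derivation as a partially defined operator from `A` to `B`. -/
def pmap : A →ₗ.[ℂ] B where
  domain := D.dom.toNonUnitalSubalgebra.toSubmodule
  toFun := D.δ

theorem isClosable_pmap : D.pmap.IsClosable := by
  refine ⟨D.pmap.graph.topologicalClosure.toLinearPMap, ?_⟩
  rw [Submodule.toLinearPMap_graph_eq]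
  rintro ⟨a, b⟩ hx (h0 : a = 0)
  subst h0
  obtain ⟨u, hu, hlim⟩ := mem_closure_iff_seq_limit.1 hx
  have h (n : ℕ) : ∃ v : D.dom, ((v : A), D.δ v) = u n := by
    obtain ⟨v, hv⟩ := (LinearPMap.mem_graph_iff' _).1 (hu n)
    exact ⟨v, hv⟩
  choose v hv using h
  have h1 : u = fun n => ((v n : A), D.δ (v n)) := funext fun n => (hv n).symm
  rw [h1] at hlim
  exact D.closed v b ((continuous_fst.tendsto _).comp hlim) ((continuous_snd.tendsto _).comp hlim)

/-- The extension of `δ` to the completion `A_δ` of `𝒜` in the norm `‖a‖ + ‖δ(a)‖`. Since `δ` is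
closed this completion is a subspace of `A`, namely the domain of the closure of `δ`. -/
def ext : A →ₗ.[ℂ] B := D.pmap.closure

/-- The subspace `A_δ` of `A`. -/
def diffAlg : Submodule ℂ A := D.ext.domain

/-- The extended derivation `δ : A_δ → B`. -/
def dExt : D.diffAlg →ₗ[ℂ] B := D.ext.toFun

theorem dom_le : ∀ a ∈ D.dom, a ∈ D.diffAlg := fun _ ha => D.pmap.le_closure.1 ha

/-- The smallest C⋆-subalgebra of `B` that contains `ρ(a₀)` and `δ(a₁)` for all `a₀, a₁ ∈ A_δ`. -/
def formAlg : NonUnitalStarSubalgebra ℂ B :=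
  (NonUnitalStarAlgebra.adjoin ℂ
    ({b | ∃ a ∈ D.diffAlg, b = ρ a} ∪ Set.range D.dExt)).topologicalClosure

theorem isClosed_formAlg : IsClosed (D.formAlg : Set B) :=
  NonUnitalStarSubalgebra.isClosed_topologicalClosure _

/-- The C⋆-algebra `Ω_δ(A)` of continuous forms. -/
def Forms : Type _ := D.formAlg

instance : NonUnitalCStarAlgebra D.Forms :=
  NonUnitalStarSubalgebra.nonUnitalCStarAlgebra D.formAlg (h_closed := D.isClosed_formAlg)
instance : PartialOrder D.Forms := CStarAlgebra.spectralOrder D.Forms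
instance : StarOrderedRing D.Forms := CStarAlgebra.spectralOrderedRing D.Forms

/-- The inclusion of `Ω_δ(A)` in `B`. -/
def incl : D.Forms →⋆ₙₐ[ℂ] B := NonUnitalStarSubalgebraClass.subtype D.formAlg

theorem norm_incl (ω : D.Forms) : ‖D.incl ω‖ = ‖ω‖ := rfl

theorem rho_mem (a : A) : ρ a ∈ D.formAlg := by
  have h1 : IsClosed {a : A | ρ a ∈ D.formAlg} :=
    D.isClosed_formAlg.preimage (map_continuous ρ)
  have h2 : (D.dom : Set A) ⊆ {a : A | ρ a ∈ D.formAlg} := fun a ha =>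
    NonUnitalStarSubalgebra.le_topologicalClosure _
      (NonUnitalStarAlgebra.subset_adjoin ℂ _ (Or.inl ⟨a, D.dom_le a ha, rfl⟩))
  have h3 := h1.closure_subset_iff.2 h2
  rw [D.dense_dom.closure_eq] at h3
  exact h3 (Set.mem_univ a)

theorem dExt_mem (a : D.diffAlg) : D.dExt a ∈ D.formAlg :=
  NonUnitalStarSubalgebra.le_topologicalClosure _
    (NonUnitalStarAlgebra.subset_adjoin ℂ _ (Or.inr ⟨a, rfl⟩))

/-- The ⋆-homomorphism `ρ` with values in `Ω_δ(A)`; `A` acts on `Ω_δ(A)` by `ω ↦ ρ(a) ω`. -/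
def rho : A →⋆ₙₐ[ℂ] D.Forms := NonUnitalStarAlgHom.codRestrict ρ D.formAlg D.rho_mem

/-- The derivation `δ : A_δ → Ω_δ(A)`. -/
def d : D.diffAlg →ₗ[ℂ] D.Forms :=
  LinearMap.codRestrict D.formAlg.toNonUnitalSubalgebra.toSubmodule D.dExt D.dExt_mem

/-- The standard module `H_{A_δ}`: the sequences `(aₙ) ∈ H_A` in `A_δ` with `(δ(aₙ)) ∈ H_B`. -/
def diffStd : Submodule ℂ (StdModule A) where
  carrier := {x | ∃ h : ∀ n, x n ∈ D.diffAlg, (fun n => D.dExt ⟨x n, h n⟩) ∈ stdSubmodule B}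
  zero_mem' := by
    refine ⟨fun n => zero_mem _, ?_⟩
    have : (fun n => D.dExt ⟨(0 : StdModule A) n, zero_mem _⟩) = 0 :=
      funext fun n => map_zero D.dExt
    rw [this]
    exact zero_mem _
  add_mem' {x y} := by
    rintro ⟨hx, hx'⟩ ⟨hy, hy'⟩
    refine ⟨fun n => add_mem (hx n) (hy n), ?_⟩
    convert add_mem hx' hy' using 1
    exact funext fun n => map_add D.dExt ⟨x n, hx n⟩ ⟨y n, hy n⟩
  smul_mem' c x := by
    rintro ⟨hx, hx'⟩
    refine ⟨fun n => Submodule.smul_mem _ c (hx n), ?_⟩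
    convert Submodule.smul_mem _ c hx' using 1
    exact funext fun n => map_smul D.dExt c ⟨x n, hx n⟩

theorem mem_stdSubmodule_of_incl {w : ℕ → D.Forms}
    (h : (fun n => D.incl (w n)) ∈ stdSubmodule B) : w ∈ stdSubmodule D.Forms := by
  rw [mem_stdSubmodule, summable_iff_vanishing_norm] at h ⊢
  intro ε hε
  obtain ⟨s, hs⟩ := h ε hε
  refine ⟨s, fun t ht => ?_⟩
  rw [← D.norm_incl, map_sum]
  exact hs t ht

/-- The map `δ : H_{A_δ} → H_{Ω_δ(A)}`, `(aₙ) ↦ (δ(aₙ))`. -/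
def dStd : D.diffStd →ₗ[ℂ] StdModule D.Forms where
  toFun x := ⟨fun n => D.d ⟨x.1 n, x.2.choose n⟩, D.mem_stdSubmodule_of_incl x.2.choose_spec⟩
  map_add' x y := StdModule.ext fun n =>
    map_add D.d ⟨x.1 n, x.2.choose n⟩ ⟨y.1 n, y.2.choose n⟩
  map_smul' c x := StdModule.ext fun n => map_smul D.d c ⟨x.1 n, x.2.choose n⟩

/-- The operator on `H_A` of a finite matrix over `𝒜`. -/
def matOp (M : (ℕ × ℕ) →₀ D.dom) : StdModule A →L[ℂ] StdModule A :=
  M.sum fun p a => matrixUnit p.1 p.2 (a : A)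

/-- The operator on `H_B` of the matrix `δ(M)` obtained by applying `δ` to the entries of `M`. -/
def matOpD (M : (ℕ × ℕ) →₀ D.dom) : StdModule B →L[ℂ] StdModule B :=
  M.sum fun p a => matrixUnit p.1 p.2 (D.δ a)

/-- `T ∈ 𝒦(H_A)_δ`: the operator `T` is the limit of a sequence of finite matrices over `𝒜` that
is Cauchy for the norm `‖M‖ + ‖δ(M)‖`. -/
def IsDiffCompact (T : StdModule A →L[ℂ] StdModule A) : Prop :=
  ∃ M : ℕ → ((ℕ × ℕ) →₀ D.dom),
    Tendsto (fun k => D.matOp (M k)) atTop (𝓝 T) ∧ CauchySeq (fun k => D.matOpD (M k))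

variable {X : Type*} [NormedAddCommGroup X] [NormedSpace ℂ X] [SMul Aᵐᵒᵖ X] [HilbertCMod A X]

/-- The conclusions of differentiable absorption for `W : X → H_A` and `K : H_A → H_A`, together
with a sequence `(ζₖ)` in `X` that implements `W`, in the sense that `W(η) = (⟪ζₖ, η⟫)ₖ`. The
projection `W W⋆` is denoted by `P`. -/
structure IsAbsorption (W : Adjointable A X (StdModule A))
    (K : Adjointable A (StdModule A) (StdModule A)) (ζ : ℕ → X) : Prop where
  isometry : W.adj ∘L W.toCLM = ContinuousLinearMap.id ℂ X
  selfAdjoint : K.adj = K.toCLM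
  positive (x : StdModule A) : 0 ≤ (inner A x (K.toCLM x) : A)
  /-- `K P = P K` -/
  commute : K.toCLM ∘L (W.toCLM ∘L W.adj) = (W.toCLM ∘L W.adj) ∘L K.toCLM
  /-- `W⋆ K W` has dense image -/
  dense : DenseRange (W.adj ∘L K.toCLM ∘L W.toCLM)
  /-- `P K` is compact -/
  compact : (W.toCLM ∘L W.adj) ∘L K.toCLM ∈ compactOperators A (StdModule A) (StdModule A)
  /-- `P K² ∈ 𝒦(H_A)_δ` -/
  diffCompact : D.IsDiffCompact ((W.toCLM ∘L W.adj) ∘L K.toCLM ∘L K.toCLM)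
  frame (η : X) (n : ℕ) : W.toCLM η n = inner A (ζ n) η

/-- The subspace `𝒳 = Im(W⋆ K² : H_{A_δ} → X)` of `X`. -/
def grassmannDomain (W : Adjointable A X (StdModule A))
    (K : Adjointable A (StdModule A) (StdModule A)) : Submodule ℂ X :=
  D.diffStd.map (W.adj ∘L K.toCLM ∘L K.toCLM).toLinearMap

end ClosedStarDerivation

end

/-! Existence. Rescale the generators to a sequence `ξ` so that the Gram matrix `G = (⟪ξᵢ, ξⱼ⟫)` and
its entrywise derivative `δ(G)` converge absolutely. The operator `Φ η = (⟪ξₙ, η⟫)ₙ` is then a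
contraction whose adjoint has dense range, `G = Φ Φ⋆`, and `T = Φ⋆ Φ` is a compact positive
contraction on `X`. An inverse square root of `T` is avoided by spreading `Φ` over infinitely many
blocks: `W η = (Φ (1 - T)ᵐ R η)ₘ` with `R² = 2 - T`. This is an isometry because `∑ₘ R (1 - T)ᵐ T (1
- T)ᵐ R = (1 - (1 - T)²) ∑ₘ (1 - T)²ᵐ` telescopes to `1`, in the strong sense, as `(1 - T)ᴺ → 0`
strongly (`tendsto_one_sub_gram_pow`, `exists_isom`).

Put `K = W T⁵ W⋆`. Then `P K² = W T¹⁰ W⋆`, and its block in position `(m, k)` is `G⁵ (1 - G)ᵐ⁺ᵏ G⁵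
(2G - G²)`: the square roots have merged into `R²`, and what is left is a polynomial in `G` without
constant term, to which the Leibniz rule applies. With `Q = ρ(G)`, the derivative of `(1 - G)ᴺ` is a
sum of `N` terms `(1 - Q)ⁱ δ(G) (1 - Q)ʲ`, with `i + j = N - 1`. The outer factors `Q⁵` tame it,
since `‖Q⁵ (1 - Q)ᴺ‖ = O(N⁻⁵)` by functional calculus (`norm_pow_mul_le`,
`norm_mul_powDeriv_mul_le`). The derivative of a block is therefore `O((m + k + 1)⁻⁴)`, which is
summable over `m` and `k` (`exists_triple_bound`, `isDiffCompact_of_tendsto_block`).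

The connection. On `H_{A_δ}` the map `δ` satisfies the Leibniz and Hermitian rules, coordinate by
coordinate, because the graph of `δ` is closed (`StdGraph.op_smul`, `StdGraph.inner`). Operators in
`𝒦(H_A)_δ` preserve `H_{A_δ}` (`stdGraph_of_mem_triples`); applied to `P K²`, this shows that `W`
maps `𝒳` into `H_{A_δ}`. The operator `W ⊗ 1` is an isometry whose `n`-th coordinate is the adjoint
of `ω ↦ ζₙ ⊗ ω`, hence adjointable (`Adjointable.ofCoords`), and both rules are compressed from
`H_{A_δ}` to `X`. -/

noncomputable section

/-! ### Hilbert modules -/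

namespace HilbertCMod

variable {A E F : Type*} [NonUnitalCStarAlgebra A] [PartialOrder A]
    [NormedAddCommGroup E] [NormedSpace ℂ E] [SMul Aᵐᵒᵖ E] [HilbertCMod A E]
    [NormedAddCommGroup F] [NormedSpace ℂ F] [SMul Aᵐᵒᵖ F] [HilbertCMod A F]

theorem inner_add_left (x y z : E) : (inner A (x + y) z : A) = inner A x z + inner A y z := by
  simp only [← toForm_apply, map_add, LinearMap.add_apply]

theorem inner_sub_left (x y z : E) : (inner A (x - y) z : A) = inner A x z - inner A y z := by
  simp only [← toForm_apply, map_sub, LinearMap.sub_apply]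

theorem inner_sub_right (x y z : E) : (inner A x (y - z) : A) = inner A x y - inner A x z := by
  simp only [← toForm_apply, map_sub]

theorem inner_neg_right (x y : E) : (inner A x (-y) : A) = -inner A x y := by
  simp only [← toForm_apply, map_neg]

theorem inner_zero_left (x : E) : (inner A 0 x : A) = 0 := by
  simp only [← toForm_apply, map_zero, LinearMap.zero_apply]

theorem inner_zero_right (x : E) : (inner A x 0 : A) = 0 := by
  simp only [← toForm_apply, map_zero]

theorem inner_sum_left {ι : Type*} (s : Finset ι) (f : ι → E) (x : E) :
    (inner A (∑ i ∈ s, f i) x : A) = ∑ i ∈ s, inner A (f i) x := by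
  simp only [← toForm_apply, map_sum, LinearMap.sum_apply]

theorem inner_sum_right {ι : Type*} (s : Finset ι) (f : ι → E) (x : E) :
    (inner A x (∑ i ∈ s, f i) : A) = ∑ i ∈ s, inner A x (f i) := by
  simp only [← toForm_apply, map_sum]

theorem inner_smul_complex_left (c : ℂ) (x y : E) :
    (inner A (c • x) y : A) = star c • inner A x y := by
  rw [← star_inner, inner_smul_complex, star_smul, star_inner]

theorem inner_smul_left (x y : E) (a : A) : (inner A (x <• a) y : A) = star a * inner A x y :=
  (toForm A E).form_smul_left x y a

theorem add_op_smul (x y : E) (a : A) : (x + y) <• a = x <• a + y <• a :=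
  ext_inner (A := A) fun z => by
    simp only [inner_smul_right, inner_add_right, add_mul]

theorem op_smul_add (x : E) (a b : A) : x <• (a + b) = x <• a + x <• b :=
  ext_inner (A := A) fun z => by
    simp only [inner_smul_right, inner_add_right, mul_add]

theorem op_smul_smul (x : E) (c : ℂ) (a : A) : x <• (c • a) = c • (x <• a) :=
  ext_inner (A := A) fun z => by
    simp only [inner_smul_right, inner_smul_complex, mul_smul_comm]

theorem smul_op_smul (x : E) (c : ℂ) (a : A) : (c • x) <• a = c • (x <• a) :=
  ext_inner (A := A) fun z => by
    simp only [inner_smul_right, inner_smul_complex, smul_mul_assoc]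

theorem norm_sq_eq (x : E) : ‖x‖ ^ 2 = ‖(inner A x x : A)‖ := by
  rw [norm_eq (A := A) x, Real.sq_sqrt (norm_nonneg _)]

variable [StarOrderedRing A]

variable (A) in
/-- The functional `⟪x, ·⟫`. -/
def innerCLM (x : E) : E →L[ℂ] A :=
  ((toForm A E).form x).mkContinuous ‖x‖ fun y => norm_inner_le x y

theorem innerCLM_apply (x y : E) : innerCLM A x y = inner A x y := rfl

/-- The operator `a ↦ x a`. -/
def opSMulCLM (x : E) : A →L[ℂ] E :=
  LinearMap.mkContinuous
    { toFun := fun a => x <• a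
      map_add' := op_smul_add x
      map_smul' := fun c a => op_smul_smul x c a } ‖x‖
    fun a => (norm_smul_le' x a).trans_eq (mul_comm _ _)

theorem continuous_inner_right (x : E) : Continuous fun y : E => (inner A x y : A) :=
  (innerCLM A x).continuous

theorem continuous_inner_left (y : E) : Continuous fun x : E => (inner A x y : A) := by
  simp only [← star_inner (A := A) y]
  exact (continuous_inner_right y).star

theorem tendsto_inner {ι : Type*} {l : Filter ι} {f g : ι → E} {x y : E}
    (hf : Tendsto f l (𝓝 x)) (hg : Tendsto g l (𝓝 y)) :
    Tendsto (fun i => (inner A (f i) (g i) : A)) l (𝓝 (inner A x y)) := by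
  have h1 : Tendsto (fun i => ‖f i - x‖ * ‖g i‖) l (𝓝 (‖x - x‖ * ‖y‖)) :=
    (hf.sub_const x).norm.mul hg.norm
  rw [sub_self, norm_zero, zero_mul] at h1
  have h2 : Tendsto (fun i => (inner A (f i - x) (g i) : A)) l (𝓝 0) :=
    squeeze_zero_norm (fun i => norm_inner_le _ _) h1
  have h3 := h2.add (((continuous_inner_right (A := A) x).tendsto y).comp hg)
  rw [zero_add] at h3
  refine h3.congr fun i => ?_
  rw [Function.comp_apply, inner_sub_left, sub_add_cancel]

end HilbertCMod

/-! ### The standard module -/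

namespace StdModule

open HilbertCMod

variable {A : Type*} [NonUnitalCStarAlgebra A] [PartialOrder A] [StarOrderedRing A]

theorem inner_def (x y : StdModule A) : (inner A x y : A) = ∑' n, star (x n) * y n := rfl

theorem hasSum_inner (x y : StdModule A) :
    HasSum (fun n => star (x n) * y n) (inner A x y : A) := (summable x y).hasSum

variable (A) in
/-- The `n`-th coordinate. -/
def evalCLM (n : ℕ) : StdModule A →L[ℂ] A :=
  LinearMap.mkContinuous
    { toFun := fun x => x n
      map_add' := fun x y => add_apply x y n
      map_smul' := fun c x => smul_apply c x n } 1
    fun x => by rw [one_mul]; exact norm_apply_le x n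

theorem evalCLM_apply (n : ℕ) (x : StdModule A) : evalCLM A n x = x n := rfl

theorem continuous_eval (n : ℕ) : Continuous fun x : StdModule A => x n := (evalCLM A n).continuous

theorem zero_apply (n : ℕ) : (0 : StdModule A) n = 0 := map_zero (evalCLM A n)

theorem sum_apply {ι : Type*} (s : Finset ι) (f : ι → StdModule A) (n : ℕ) :
    (∑ i ∈ s, f i) n = ∑ i ∈ s, f i n := map_sum (evalCLM A n) f s

variable (A) in
/-- The embedding of `A` as the `n`-th coordinate. -/
def singleCLM (n : ℕ) : A →L[ℂ] StdModule A :=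
  LinearMap.mkContinuous
    { toFun := single n
      map_add' := fun a b => by ext k; simp only [add_apply, single_apply]; split_ifs <;> simp
      map_smul' := fun c a => by
        ext k; simp only [smul_apply, single_apply, RingHom.id_apply]; split_ifs <;> simp } 1
    fun a => by rw [one_mul]; exact (norm_single n a).le

theorem singleCLM_apply (n : ℕ) (a : A) : singleCLM A n a = single n a := rfl

theorem inner_single_right (x : StdModule A) (n : ℕ) (a : A) :
    (inner A x (single n a) : A) = star (x n) * a := by
  rw [inner_def, tsum_eq_single n fun k hk => by rw [single_apply, if_neg hk, mul_zero],
    single_apply, if_pos rfl]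

theorem inner_single_left (x : StdModule A) (n : ℕ) (a : A) :
    (inner A (single n a) x : A) = star a * x n := by
  rw [← star_inner, inner_single_right, star_mul, star_star]

/-- The truncation of a sequence to a finite set. -/
def trunc (s : Finset ℕ) (y : ℕ → A) : StdModule A := ∑ n ∈ s, single n (y n)

theorem trunc_apply (s : Finset ℕ) (y : ℕ → A) (n : ℕ) :
    trunc s y n = if n ∈ s then y n else 0 := by
  simp only [trunc, sum_apply, single_apply, Finset.sum_ite_eq]

theorem inner_trunc_left (s : Finset ℕ) (y : ℕ → A) (z : StdModule A) :
    (inner A (trunc s y) z : A) = ∑ n ∈ s, star (y n) * z n := by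
  simp only [trunc, inner_sum_left, inner_single_left]

theorem norm_trunc_sq (s : Finset ℕ) (y : ℕ → A) :
    ‖trunc s y‖ ^ 2 = ‖∑ n ∈ s, star (y n) * y n‖ := by
  rw [norm_sq_eq (A := A), inner_trunc_left]
  congr 1
  refine Finset.sum_congr rfl fun n hn => ?_
  rw [trunc_apply, if_pos hn]

theorem norm_trunc_le (s : Finset ℕ) (y : StdModule A) : ‖trunc s y‖ ≤ ‖y‖ := by
  refine le_of_sq_le_sq ?_ (norm_nonneg _)
  rw [norm_trunc_sq, norm_sq_eq (A := A)]
  exact CStarAlgebra.norm_le_norm_of_nonneg_of_le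
    (Finset.sum_nonneg fun i _ => star_mul_self_nonneg _)
    ((summable y y).sum_le_tsum s fun _ _ => star_mul_self_nonneg _)

theorem trunc_sub (s : Finset ℕ) (y z : ℕ → A) : trunc s (y - z) = trunc s y - trunc s z := by
  simp only [trunc, ← singleCLM_apply, Pi.sub_apply, map_sub, Finset.sum_sub_distrib]

theorem continuous_trunc (s : Finset ℕ) : Continuous (trunc s : (ℕ → A) → StdModule A) :=
  continuous_finsetSum _ fun n _ => (singleCLM A n).continuous.comp (continuous_apply n)

/-- The Cauchy criterion, with the tails of the series of squares read as norms of vectors, so that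
the triangle inequality becomes available. -/
theorem mem_stdSubmodule_iff_trunc {y : ℕ → A} : y ∈ stdSubmodule A ↔
    ∀ ε > 0, ∃ s : Finset ℕ, ∀ t : Finset ℕ, Disjoint t s → ‖trunc t y‖ < ε := by
  rw [mem_stdSubmodule, summable_iff_vanishing_norm]
  constructor
  · intro h ε hε
    obtain ⟨s, hs⟩ := h (ε ^ 2) (by positivity)
    refine ⟨s, fun t ht => lt_of_pow_lt_pow_left₀ 2 hε.le ?_⟩
    rw [norm_trunc_sq]
    exact hs t ht
  · intro h ε hε
    obtain ⟨s, hs⟩ := h (√ε) (by positivity)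
    refine ⟨s, fun t ht => ?_⟩
    rw [← norm_trunc_sq, ← Real.sq_sqrt hε.le]
    exact pow_lt_pow_left₀ (hs t ht) (norm_nonneg _) two_ne_zero

/-- Bounds on truncations involve finitely many coordinates and so survive coordinatewise limits;
this transfers them to the whole sequence. -/
theorem norm_le_of_trunc {y : StdModule A} {c : ℝ} (hc : 0 ≤ c) (h : ∀ s, ‖trunc s y‖ ≤ c) :
    ‖y‖ ≤ c := by
  refine le_of_sq_le_sq ?_ hc
  rw [norm_sq_eq (A := A)]
  refine le_of_tendsto (hasSum_inner y y).norm (Eventually.of_forall fun s => ?_)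
  rw [← norm_trunc_sq]
  exact pow_le_pow_left₀ (norm_nonneg _) (h s) 2

instance : CompleteSpace (StdModule A) := by
  refine Metric.complete_of_cauchySeq_tendsto fun u hu => ?_
  have h1 (n : ℕ) : ∃ a, Tendsto (fun k => u k n) atTop (𝓝 a) :=
    cauchySeq_tendsto_of_complete (hu.map (evalCLM A n).uniformContinuous)
  choose y hy using h1
  -- Letting `l → ∞` in the Cauchy estimate for a fixed finite `s` gives a bound uniform in `s`. It
  -- yields both that the coordinatewise limit `y` is square summable and that `u` converges to it.
  have h2 : ∀ ε > 0, ∃ N, ∀ k ≥ N, ∀ s, ‖trunc s ((u k).1 - y)‖ ≤ ε := by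
    intro ε hε
    obtain ⟨N, hN⟩ := Metric.cauchySeq_iff.1 hu ε hε
    refine ⟨N, fun k hk s => ?_⟩
    have h3 : Tendsto (fun l => ‖trunc s ((u k).1 - (u l).1)‖) atTop
        (𝓝 ‖trunc s ((u k).1 - y)‖) :=
      (((continuous_trunc s).tendsto _).comp
        (tendsto_const_nhds.sub (tendsto_pi_nhds.2 hy))).norm
    refine le_of_tendsto h3 ((eventually_ge_atTop N).mono fun l hl => ?_)
    refine (norm_trunc_le s (u k - u l)).trans ?_
    rw [← dist_eq_norm]
    exact (hN k hk l hl).le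
  have h4 : y ∈ stdSubmodule A := by
    rw [mem_stdSubmodule_iff_trunc]
    intro ε hε
    obtain ⟨N, hN⟩ := h2 (ε / 2) (by positivity)
    obtain ⟨s, hs⟩ := mem_stdSubmodule_iff_trunc.1 (u N).2 (ε / 2) (by positivity)
    refine ⟨s, fun t ht => ?_⟩
    have h5 := hN N le_rfl t
    have h6 := hs t ht
    rw [trunc_sub, norm_sub_rev] at h5
    have := norm_sub_norm_le (trunc t y) (trunc t (u N).1)
    linarith
  obtain ⟨z, rfl⟩ : ∃ z : StdModule A, z.1 = y := ⟨⟨y, h4⟩, rfl⟩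
  refine ⟨z, Metric.tendsto_atTop.2 fun ε hε => ?_⟩
  obtain ⟨N, hN⟩ := h2 (ε / 2) (by positivity)
  refine ⟨N, fun k hk => ?_⟩
  rw [dist_eq_norm]
  refine lt_of_le_of_lt (norm_le_of_trunc (half_pos hε).le fun s => ?_) (half_lt_self hε)
  exact hN k hk s

theorem hasSum_single (x : StdModule A) : HasSum (fun n => single n (x n)) x := by
  have h : Summable fun n => single n (x n) := by
    rw [summable_iff_vanishing_norm]
    exact mem_stdSubmodule_iff_trunc.1 x.2
  convert h.hasSum using 1
  ext n
  rw [← evalCLM_apply, ← evalCLM_apply, (evalCLM A n).map_tsum h,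
    tsum_eq_single n fun k hk => by rw [evalCLM_apply, single_apply, if_neg hk.symm],
    evalCLM_apply, evalCLM_apply, single_apply, if_pos rfl]

end StdModule

/-! ### Adjointable operators -/

namespace Adjointable

open HilbertCMod

variable {A E F : Type*} [NonUnitalCStarAlgebra A] [PartialOrder A]
    [NormedAddCommGroup E] [NormedSpace ℂ E] [SMul Aᵐᵒᵖ E] [HilbertCMod A E]
    [NormedAddCommGroup F] [NormedSpace ℂ F] [SMul Aᵐᵒᵖ F] [HilbertCMod A F]

theorem inner_adj_left (T : Adjointable A E F) (x : E) (y : F) :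
    (inner A (T.adj y) x : A) = inner A y (T.toCLM x) := by
  rw [← star_inner, ← T.inner_adj, star_inner]

theorem map_op_smul (T : Adjointable A E F) (x : E) (a : A) :
    T.toCLM (x <• a) = T.toCLM x <• a :=
  ext_inner (A := A) fun z => by
    simp only [HilbertCMod.inner_smul_right, ← T.inner_adj_left]

theorem adj_op_smul (T : Adjointable A E F) (x : F) (a : A) :
    T.adj (x <• a) = T.adj x <• a :=
  ext_inner (A := A) fun z => by
    simp only [HilbertCMod.inner_smul_right, ← T.inner_adj]

variable [StarOrderedRing A]

/-! ### Adjointability from adjoints of the coordinates. -/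

section OfCoords

variable [CompleteSpace E] (V : E →L[ℂ] StdModule A) (k : ℕ → A →ₗ[ℂ] E)
    (h : ∀ n a z, (inner A (k n a) z : A) = star a * V z n)

include h

/-- The vector `v` on the left satisfies `⟪v, v⟫ = ⟪trunc s y, V v⟫`, because `k n` is adjoint to
the `n`-th coordinate of `V`. Cauchy–Schwarz and division by `‖v‖` give the bound. -/
theorem norm_sum_coords_le (y : ℕ → A) (s : Finset ℕ) :
    ‖∑ n ∈ s, k n (y n)‖ ≤ ‖V‖ * ‖StdModule.trunc s y‖ := by
  set v := ∑ n ∈ s, k n (y n) with hv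
  have h1 : (inner A v v : A) = inner A (StdModule.trunc s y) (V v) := by
    rw [StdModule.inner_trunc_left]
    conv_lhs => rw [hv, inner_sum_left]
    simp only [h]
    rfl
  have h2 : ‖v‖ ^ 2 ≤ ‖StdModule.trunc s y‖ * (‖V‖ * ‖v‖) := by
    rw [norm_sq_eq (A := A), h1]
    exact (norm_inner_le _ _).trans (by gcongr; exact V.le_opNorm v)
  rcases (norm_nonneg v).eq_or_lt with h3 | h3
  · rw [← h3]; positivity
  · refine le_of_mul_le_mul_right ?_ h3
    linarith

theorem summable_coords (y : StdModule A) : Summable fun n => k n (y n) := by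
  rw [summable_iff_vanishing_norm]
  intro ε hε
  -- The summand `1` covers the case `V = 0`.
  obtain ⟨s, hs⟩ := StdModule.mem_stdSubmodule_iff_trunc.1 y.2 (ε / (‖V‖ + 1)) (by positivity)
  refine ⟨s, fun t ht => (norm_sum_coords_le V k h y t).trans_lt ?_⟩
  have h1 := hs t ht
  rw [lt_div_iff₀ (by positivity)] at h1
  nlinarith [norm_nonneg (StdModule.trunc t y)]

omit h in
/-- A bounded operator to the standard module is adjointable if its coordinates are. -/
def ofCoords (h : ∀ n a z, (inner A (k n a) z : A) = star a * V z n) :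
    Adjointable A E (StdModule A) where
  toCLM := V
  adj := LinearMap.mkContinuous
    { toFun := fun y => ∑' n, k n (y n)
      map_add' := fun y z => by
        rw [← (summable_coords V k h y).tsum_add (summable_coords V k h z)]
        simp only [StdModule.add_apply, map_add]
      map_smul' := fun c y => by
        rw [RingHom.id_apply, ← (summable_coords V k h y).tsum_const_smul]
        simp only [StdModule.smul_apply, map_smul] } ‖V‖
    fun y => le_of_tendsto (summable_coords V k h y).hasSum.norm (Eventually.of_forall fun s =>
      (norm_sum_coords_le V k h y s).trans (by gcongr; exact StdModule.norm_trunc_le s y))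
  inner_adj x y := by
    have h1 := (summable_coords V k h y).hasSum.map (innerCLM A x) (innerCLM A x).continuous
    refine (StdModule.hasSum_inner (V x) y).unique (h1.congr_fun fun n => ?_)
    rw [Function.comp_apply, innerCLM_apply, ← star_inner, h, star_mul, star_star]

end OfCoords

end Adjointable

end

noncomputable section

/-! ### The C⋆-algebra of adjointable operators -/

section AdjPair

open HilbertCMod

variable (A : Type*) {E F H : Type*} [NonUnitalCStarAlgebra A] [PartialOrder A]
    [NormedAddCommGroup E] [NormedSpace ℂ E] [SMul Aᵐᵒᵖ E] [HilbertCMod A E]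
    [NormedAddCommGroup F] [NormedSpace ℂ F] [SMul Aᵐᵒᵖ F] [HilbertCMod A F]
    [NormedAddCommGroup H] [NormedSpace ℂ H] [SMul Aᵐᵒᵖ H] [HilbertCMod A H]

/-- The operators `S` and `S'` are adjoint to each other. -/
def IsAdjPair (S : E →L[ℂ] F) (S' : F →L[ℂ] E) : Prop :=
  ∀ x y, (inner A (S x) y : A) = inner A x (S' y)

namespace IsAdjPair

variable {A} {S T : E →L[ℂ] F} {S' T' : F →L[ℂ] E}

theorem symm (h : IsAdjPair A S S') : IsAdjPair A S' S := fun x y => by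
  rw [← star_inner, ← h, star_inner]

theorem add (h : IsAdjPair A S S') (k : IsAdjPair A T T') : IsAdjPair A (S + T) (S' + T') :=
  fun x y => by
    rw [_root_.add_apply, _root_.add_apply, HilbertCMod.inner_add_left,
      HilbertCMod.inner_add_right, h, k]

theorem sub (h : IsAdjPair A S S') (k : IsAdjPair A T T') : IsAdjPair A (S - T) (S' - T') :=
  fun x y => by
    rw [_root_.sub_apply, _root_.sub_apply, HilbertCMod.inner_sub_left,
      HilbertCMod.inner_sub_right, h, k]

theorem smul (h : IsAdjPair A S S') (c : ℂ) : IsAdjPair A (c • S) (star c • S') :=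
  fun x y => by
    rw [_root_.smul_apply, _root_.smul_apply, inner_smul_complex_left,
      inner_smul_complex, h]

theorem sum {ι : Type*} (s : Finset ι) {U : ι → E →L[ℂ] F} {U' : ι → F →L[ℂ] E}
    (h : ∀ i ∈ s, IsAdjPair A (U i) (U' i)) : IsAdjPair A (∑ i ∈ s, U i) (∑ i ∈ s, U' i) :=
  fun x y => by
    rw [_root_.sum_apply, _root_.sum_apply, HilbertCMod.inner_sum_left,
      HilbertCMod.inner_sum_right]
    exact Finset.sum_congr rfl fun i hi => h i hi x y

theorem comp {U : F →L[ℂ] H} {U' : H →L[ℂ] F} (h : IsAdjPair A U U') (k : IsAdjPair A S S') :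
    IsAdjPair A (U ∘L S) (S' ∘L U') := fun x y => by
  rw [ContinuousLinearMap.comp_apply, ContinuousLinearMap.comp_apply, h, k]

theorem unique (h : IsAdjPair A S S') (k : IsAdjPair A S T') : S' = T' :=
  ContinuousLinearMap.ext fun y => ext_inner (A := A) fun x => by rw [← h, ← k]

theorem of_adjointable (T : Adjointable A E F) : IsAdjPair A T.toCLM T.adj := T.inner_adj

variable [StarOrderedRing A]

theorem norm_apply_sq_le (h : IsAdjPair A S S') (x : E) : ‖S x‖ ^ 2 ≤ ‖x‖ * ‖S' (S x)‖ := by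
  rw [norm_sq_eq (A := A), h]
  exact norm_inner_le _ _

/-- From `‖S x‖² ≤ ‖x‖ ‖S' (S x)‖ ≤ ‖x‖ ‖S'‖ ‖S x‖`; by symmetry an adjoint has the same norm. -/
theorem norm_le (h : IsAdjPair A S S') : ‖S‖ ≤ ‖S'‖ := by
  refine S.opNorm_le_bound (norm_nonneg _) fun x => ?_
  have h1 := h.norm_apply_sq_le x
  have h2 := S'.le_opNorm (S x)
  rcases (norm_nonneg (S x)).eq_or_lt with h3 | h3
  · rw [← h3]; positivity
  · refine le_of_mul_le_mul_right ?_ h3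
    nlinarith [norm_nonneg x]

theorem norm_eq (h : IsAdjPair A S S') : ‖S‖ = ‖S'‖ := h.norm_le.antisymm h.symm.norm_le

theorem norm_sq_le (h : IsAdjPair A S S') : ‖S‖ ^ 2 ≤ ‖S' ∘L S‖ := by
  have h0 : ‖S‖ ≤ √‖S' ∘L S‖ := by
    refine S.opNorm_le_bound (Real.sqrt_nonneg _) fun x => ?_
    refine le_of_sq_le_sq ?_ (by positivity)
    rw [mul_pow, Real.sq_sqrt (norm_nonneg _)]
    have h1 := h.norm_apply_sq_le x
    have h2 := (S' ∘L S).le_opNorm x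
    rw [ContinuousLinearMap.comp_apply] at h2
    nlinarith [norm_nonneg x]
  rw [← Real.sq_sqrt (norm_nonneg (S' ∘L S))]
  exact pow_le_pow_left₀ (norm_nonneg _) h0 2

/-- Pointwise convergence is enough, provided that the adjoints converge as well. -/
theorem tendsto {ι : Type*} {l : Filter ι} [l.NeBot] {U : ι → E →L[ℂ] F} {U' : ι → F →L[ℂ] E}
    (h : ∀ i, IsAdjPair A (U i) (U' i)) (hU : ∀ x, Tendsto (fun i => U i x) l (𝓝 (S x)))
    (hU' : ∀ x, Tendsto (fun i => U' i x) l (𝓝 (S' x))) : IsAdjPair A S S' := fun x y =>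
  tendsto_nhds_unique (tendsto_inner (hU x) tendsto_const_nhds)
    ((tendsto_inner tendsto_const_nhds (hU' y)).congr fun i => (h i x y).symm)

end IsAdjPair

variable [StarOrderedRing A]

variable (E) in
/-- The algebra of adjointable operators. -/
def adjSubalgebra : Subalgebra ℂ (E →L[ℂ] E) where
  carrier := {S | ∃ S', IsAdjPair A S S'}
  mul_mem' := by
    rintro S T ⟨S', hS⟩ ⟨T', hT⟩
    exact ⟨_, hS.comp hT⟩
  add_mem' := by
    rintro S T ⟨S', hS⟩ ⟨T', hT⟩
    exact ⟨_, hS.add hT⟩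
  algebraMap_mem' c := ⟨star c • 1, by
    rw [Algebra.algebraMap_eq_smul_one]
    exact IsAdjPair.smul (fun x y => rfl) c⟩

variable (E) in
/-- The C⋆-algebra of adjointable operators. -/
abbrev AdjOp : Type _ := adjSubalgebra A E

namespace AdjOp

variable {A}

instance : Star (AdjOp A E) := ⟨fun S => ⟨S.2.choose, S.1, S.2.choose_spec.symm⟩⟩

theorem isAdjPair (S : AdjOp A E) : IsAdjPair A (S : E →L[ℂ] E) (star S : AdjOp A E) :=
  S.2.choose_spec

/-- Adjoints are unique, so the choice made in defining `star` is harmless and every ⋆-identity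
reduces to exhibiting an adjoint pair. -/
theorem star_eq_of_isAdjPair {S S' : AdjOp A E}
    (h : IsAdjPair A (S : E →L[ℂ] E) (S' : E →L[ℂ] E)) : star S = S' :=
  Subtype.ext (S.isAdjPair.unique h)

instance : StarRing (AdjOp A E) where
  star_involutive S := star_eq_of_isAdjPair S.isAdjPair.symm
  star_mul S T := star_eq_of_isAdjPair (S.isAdjPair.comp T.isAdjPair)
  star_add S T := star_eq_of_isAdjPair (S.isAdjPair.add T.isAdjPair)

instance : StarModule ℂ (AdjOp A E) where
  star_smul c S := star_eq_of_isAdjPair (S.isAdjPair.smul c)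

instance : CStarRing (AdjOp A E) where
  norm_mul_self_le S := by
    rw [← pow_two]
    exact S.isAdjPair.norm_sq_le

variable [CompleteSpace E]

instance : CompleteSpace (AdjOp A E) := by
  refine Metric.complete_of_cauchySeq_tendsto fun u hu => ?_
  obtain ⟨S, hS⟩ := cauchySeq_tendsto_of_complete
    (uniformContinuous_subtype_val.comp_cauchySeq hu)
  -- The involution is isometric, so the adjoints converge too and their limit is an adjoint of `S`.
  have hu' : CauchySeq fun n => star (u n) := by
    rw [Metric.cauchySeq_iff] at hu ⊢
    refine fun ε hε => (hu ε hε).imp fun N hN m hm n hn => ?_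
    have h1 : ‖star (u m) - star (u n)‖ = ‖u m - u n‖ :=
      (congrArg norm (star_sub (u m) (u n)).symm).trans (norm_star (u m - u n))
    exact ((dist_eq_norm _ _).trans h1).trans_lt ((dist_eq_norm _ _).symm.trans_lt (hN m hm n hn))
  obtain ⟨S', hS'⟩ := cauchySeq_tendsto_of_complete
    (uniformContinuous_subtype_val.comp_cauchySeq hu')
  have h : IsAdjPair A S S' := IsAdjPair.tendsto (fun n => (u n).isAdjPair)
    (fun x => ((ContinuousLinearMap.apply ℂ E x).continuous.tendsto _).comp hS)
    (fun x => ((ContinuousLinearMap.apply ℂ E x).continuous.tendsto _).comp hS')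
  exact ⟨⟨S, S', h⟩, tendsto_subtype_rng.2 hS⟩

instance : CStarAlgebra (AdjOp A E) where

end AdjOp

end AdjPair

/-! ### Positive contractions and spectral estimates. -/

section Positive

open HilbertCMod

variable {A E : Type*} [NonUnitalCStarAlgebra A] [PartialOrder A] [StarOrderedRing A]
    [NormedAddCommGroup E] [NormedSpace ℂ E] [SMul Aᵐᵒᵖ E] [HilbertCMod A E] [CompleteSpace E]

namespace AdjOp

theorem isSelfAdjoint_iff {S : AdjOp A E} :
    IsSelfAdjoint S ↔ IsAdjPair A (S : E →L[ℂ] E) (S : E →L[ℂ] E) :=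
  ⟨fun h => by simpa only [h.star_eq] using S.isAdjPair, star_eq_of_isAdjPair⟩

/-- Let `m` be the negative part of `S` and `n` its square root. Then `n S n = -m²`, so positivity
of the form at `n x` reads `-⟪m x, m x⟫ ≥ 0`. Hence `m = 0`, and spectral mapping kills the negative
part of `t`. -/
theorem spectrum_nonneg {S : AdjOp A E} (hS : IsSelfAdjoint S)
    (h : ∀ x, 0 ≤ (inner A x (S.1 x) : A)) {t : ℝ} (ht : t ∈ spectrum ℝ S) : 0 ≤ t := by
  set f : ℝ → ℝ := fun t => max (-t) 0 with hf
  have hfc : Continuous f := by fun_prop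
  set m := cfc f S
  set n := cfc (fun t => √(f t)) S
  have hm : IsSelfAdjoint m := cfc_predicate f S
  have hn : IsSelfAdjoint n := cfc_predicate _ S
  have h1 : n * S * n = -(m * m) := by
    have hid : cfc (fun t : ℝ => t) S = S := cfc_id' ℝ S
    conv_lhs => rw [← hid]
    rw [← cfc_mul _ _ S, ← cfc_mul _ _ S, ← cfc_mul _ _ S, ← cfc_neg]
    refine cfc_congr fun t _ => ?_
    have h2 : √(f t) * √(f t) = f t := Real.mul_self_sqrt (le_max_right _ _)
    calc √(f t) * t * √(f t) = t * (√(f t) * √(f t)) := by ring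
      _ = -(f t * f t) := by
        rw [h2]
        rcases le_total 0 t with h3 | h3
        · rw [show f t = 0 from max_eq_right (neg_nonpos.2 h3)]; ring
        · rw [show f t = -t from max_eq_left (neg_nonneg.2 h3)]; ring
  have h2 : m = 0 := by
    refine Subtype.ext (ContinuousLinearMap.ext fun x => inner_self_eq_zero (A := A) _ ?_)
    refine le_antisymm ?_ (HilbertCMod.inner_self_nonneg _)
    have h3 := h (n.1 x)
    rw [(isSelfAdjoint_iff.1 hn) x (S.1 (n.1 x)),
      show n.1 (S.1 (n.1 x)) = (n * S * n).1 x from rfl, h1,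
      show (-(m * m)).1 x = -(m.1 (m.1 x)) from rfl, HilbertCMod.inner_neg_right,
      ← (isSelfAdjoint_iff.1 hm) x] at h3
    exact neg_nonneg.1 h3
  have h4 : f t = 0 := by
    -- A nonzero scalar is invertible, hence not in the spectrum of `0`; this form of the argument
    -- also covers `E = 0`.
    have h5 : f t ∈ spectrum ℝ (0 : AdjOp A E) := by
      rw [← h2, cfc_map_spectrum f S]
      exact ⟨t, ht, rfl⟩
    by_contra h6
    refine h5 ?_
    rw [spectrum.mem_resolventSet_iff, sub_zero]
    exact (IsUnit.mk0 _ h6).map (algebraMap ℝ (AdjOp A E))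
  have := le_max_left (-t) 0
  rw [show max (-t) 0 = f t from rfl, h4] at this
  linarith

theorem spectrum_le_one {S : AdjOp A E} (h : ‖S‖ ≤ 1) {t : ℝ} (ht : t ∈ spectrum ℝ S) : t ≤ 1 := by
  have h1 := spectrum.subset_closedBall_norm_mul S ht
  rw [mem_closedBall_zero_iff] at h1
  -- Equality would fail for `E = 0`.
  have h2 : ‖(1 : AdjOp A E)‖ ≤ 1 := ContinuousLinearMap.norm_id_le
  have h3 := le_abs_self t
  rw [← Real.norm_eq_abs] at h3
  nlinarith [norm_nonneg S, norm_nonneg (1 : AdjOp A E)]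

/-- The operators `0 ≤ S ≤ 1`. -/
structure IsPosContraction (S : AdjOp A E) : Prop where
  isSelfAdjoint : IsSelfAdjoint S
  nonneg (x : E) : 0 ≤ (inner A x (S.1 x) : A)
  norm_le : ‖S‖ ≤ 1

/-- Combine `1 - t ≤ exp (-t)` with `xˢ / s! ≤ exp x` at `x = (N + 1) t`. The factor `exp 1` pays
for replacing `N` by `N + 1`, as `t ≤ 1`. -/
theorem _root_.Real.pow_mul_one_sub_pow_le {t : ℝ} (h0 : 0 ≤ t) (h1 : t ≤ 1) (s N : ℕ) :
    t ^ s * (1 - t) ^ N ≤ Real.exp 1 * s.factorial / (N + 1) ^ s := by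
  have h2 : (1 - t) ^ N ≤ Real.exp 1 * Real.exp (-((N + 1) * t)) := by
    have h3 : (1 - t) ^ N ≤ Real.exp (-t) ^ N :=
      pow_le_pow_left₀ (by linarith) (Real.one_sub_le_exp_neg t) N
    refine h3.trans ?_
    rw [← Real.exp_nat_mul, ← Real.exp_add]
    exact Real.exp_le_exp.2 (by nlinarith)
  have h4 : ((N + 1) * t) ^ s / s.factorial ≤ Real.exp ((N + 1) * t) :=
    Real.pow_div_factorial_le_exp _ (by positivity) s
  rw [le_div_iff₀ (by positivity)]
  rw [div_le_iff₀ (by positivity)] at h4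
  calc t ^ s * (1 - t) ^ N * (N + 1) ^ s = ((N + 1) * t) ^ s * (1 - t) ^ N := by rw [mul_pow]; ring
    _ ≤ (Real.exp ((N + 1) * t) * s.factorial) * (Real.exp 1 * Real.exp (-((N + 1) * t))) :=
        mul_le_mul h4 h2 (pow_nonneg (by linarith) _) (by positivity)
    _ = Real.exp 1 * s.factorial * (Real.exp ((N + 1) * t) * Real.exp (-((N + 1) * t))) := by ring
    _ = Real.exp 1 * s.factorial := by rw [← Real.exp_add]; simp

namespace IsPosContraction

variable {S : AdjOp A E}

theorem mem_Icc (h : IsPosContraction S) {t : ℝ} (ht : t ∈ spectrum ℝ S) : t ∈ Set.Icc 0 1 :=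
  ⟨spectrum_nonneg h.isSelfAdjoint h.nonneg ht, spectrum_le_one h.norm_le ht⟩

theorem pow_mul_eq_cfc (h : IsPosContraction S) (s N : ℕ) :
    S ^ s * (1 - S) ^ N = cfc (fun t : ℝ => t ^ s * (1 - t) ^ N) S := by
  have hS := h.isSelfAdjoint
  rw [cfc_mul _ _ S, cfc_pow _ _ S, cfc_pow _ _ S, cfc_sub _ _ S, cfc_id' ℝ S,
    cfc_const_one ℝ S]

theorem norm_pow_mul_le (h : IsPosContraction S) (s N : ℕ) :
    ‖S ^ s * (1 - S) ^ N‖ ≤ Real.exp 1 * s.factorial / (N + 1) ^ s := by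
  rw [h.pow_mul_eq_cfc]
  refine norm_cfc_le (by positivity) fun t ht => ?_
  obtain ⟨h0, h1⟩ := h.mem_Icc ht
  rw [Real.norm_of_nonneg (mul_nonneg (pow_nonneg h0 _) (pow_nonneg (by linarith) _))]
  exact Real.pow_mul_one_sub_pow_le h0 h1 s N

theorem norm_one_sub_pow_le (h : IsPosContraction S) (N : ℕ) : ‖(1 - S) ^ N‖ ≤ 1 := by
  have h2 := h.pow_mul_eq_cfc 0 N
  rw [pow_zero, one_mul] at h2
  rw [h2]
  refine norm_cfc_le zero_le_one fun t ht => ?_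
  obtain ⟨h0, h1⟩ := h.mem_Icc ht
  rw [pow_zero, one_mul, Real.norm_of_nonneg (pow_nonneg (by linarith) _)]
  exact pow_le_one₀ (by linarith) (by linarith)

/-- The operator `R` normalises the blocks of the isometry: `S (2 - S) = 1 - (1 - S)²` turns their
sum into a telescoping geometric series. -/
theorem exists_sqrt (h : IsPosContraction S) :
    ∃ R : AdjOp A E, IsSelfAdjoint R ∧ R * R = 2 - S ∧ Commute R S := by
  have hS := h.isSelfAdjoint
  refine ⟨cfc (fun t : ℝ => √(2 - t)) S, cfc_predicate _ S, ?_, ?_⟩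
  · rw [← cfc_mul _ _ S]
    have h1 : cfc (fun t : ℝ => 2 - t) S = 2 - S := by
      rw [cfc_sub _ _ S, cfc_id' ℝ S, cfc_const _ S]
      congr 1
      exact map_ofNat (algebraMap ℝ (AdjOp A E)) 2
    rw [← h1]
    refine cfc_congr fun t ht => ?_
    exact Real.mul_self_sqrt (by linarith [(h.mem_Icc ht).2])
  · have h1 := cfc_commute_cfc (fun t : ℝ => √(2 - t)) (fun t => t) S
    rwa [cfc_id' ℝ S] at h1

end IsPosContraction

end AdjOp

end Positive

end

noncomputable section

/-! ### Matrices as operators on the standard module -/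

section MatrixUnit

variable {A C : Type*} [NonUnitalCStarAlgebra A] [PartialOrder A] [StarOrderedRing A]
    [NonUnitalCStarAlgebra C] [PartialOrder C] [StarOrderedRing C]

theorem matrixUnit_apply (i j : ℕ) (a : A) (x : StdModule A) :
    matrixUnit i j a x = StdModule.single i (a * x j) := rfl

theorem matrixUnit_apply_apply (i j : ℕ) (a : A) (x : StdModule A) (n : ℕ) :
    matrixUnit i j a x n = if n = i then a * x j else 0 := StdModule.single_apply _ _ _

theorem norm_matrixUnit_le (i j : ℕ) (a : A) : ‖matrixUnit i j a‖ ≤ ‖a‖ :=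
  LinearMap.mkContinuous_norm_le _ (norm_nonneg _) _

variable (A) in
/-- The linear map `a ↦ E_{ij}(a)`. -/
def matrixUnitCLM (i j : ℕ) : A →L[ℂ] StdModule A →L[ℂ] StdModule A :=
  LinearMap.mkContinuous
    { toFun := matrixUnit i j
      map_add' := fun a b => by
        ext x n
        rw [_root_.add_apply, StdModule.add_apply]
        simp only [matrixUnit_apply_apply]
        split_ifs
        · exact add_mul _ _ _
        · exact (add_zero _).symm
      map_smul' := fun c a => by
        ext x n
        rw [_root_.smul_apply, StdModule.smul_apply]
        simp only [matrixUnit_apply_apply, RingHom.id_apply]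
        split_ifs
        · exact smul_mul_assoc _ _ _
        · exact (smul_zero _).symm } 1
    fun a => (norm_matrixUnit_le i j a).trans_eq (one_mul _).symm

theorem matrixUnitCLM_apply (i j : ℕ) (a : A) : matrixUnitCLM A i j a = matrixUnit i j a := rfl

theorem matrixUnit_zero (i j : ℕ) : matrixUnit i j (0 : A) = 0 := map_zero (matrixUnitCLM A i j)

theorem matrixUnit_add (i j : ℕ) (a b : A) :
    matrixUnit i j (a + b) = matrixUnit i j a + matrixUnit i j b := map_add (matrixUnitCLM A i j) a b

theorem matrixUnit_smul (i j : ℕ) (c : ℂ) (a : A) :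
    matrixUnit i j (c • a) = c • matrixUnit i j a := map_smul (matrixUnitCLM A i j) c a

theorem matrixUnit_mul (i j k l : ℕ) (a b : A) :
    matrixUnit i j a * matrixUnit k l b = if j = k then matrixUnit i l (a * b) else 0 := by
  ext x n
  rw [mul_apply_eq_comp, matrixUnit_apply_apply, matrixUnit_apply_apply]
  by_cases h : j = k
  · rw [if_pos h, if_pos h, matrixUnit_apply_apply, mul_assoc]
  · rw [if_neg h, if_neg h, mul_zero, ite_self]
    exact (StdModule.zero_apply n).symm

theorem isAdjPair_matrixUnit (i j : ℕ) (a : A) :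
    IsAdjPair A (matrixUnit i j a) (matrixUnit j i (star a)) := fun x y => by
  rw [matrixUnit_apply, matrixUnit_apply, StdModule.inner_single_left,
    StdModule.inner_single_right, star_mul, mul_assoc]

open HilbertCMod in
/-- The representation of finite matrices on the standard module. -/
def matrixHom (m : ℕ) : CStarMatrix (Fin m) (Fin m) A →⋆ₙₐ[ℂ] AdjOp A (StdModule A) where
  toFun N := ⟨∑ i : Fin m, ∑ j : Fin m, matrixUnit (i : ℕ) (j : ℕ) (N i j),
    ∑ i : Fin m, ∑ j : Fin m, matrixUnit (j : ℕ) (i : ℕ) (star (N i j)),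
    IsAdjPair.sum _ fun i _ => IsAdjPair.sum _ fun j _ => isAdjPair_matrixUnit _ _ _⟩
  map_smul' c N := Subtype.ext <| by
    change _ = c • ∑ i : Fin m, ∑ j : Fin m, matrixUnit (i : ℕ) (j : ℕ) (N i j)
    simp only [CStarMatrix.smul_apply, matrixUnit_smul, Finset.smul_sum]
  map_zero' := Subtype.ext <| by
    change ∑ i : Fin m, ∑ j : Fin m, matrixUnit (i : ℕ) (j : ℕ) (0 : A) = 0
    simp only [matrixUnit_zero, Finset.sum_const_zero]
  map_add' N M := Subtype.ext <| by
    change _ = (∑ i : Fin m, ∑ j : Fin m, matrixUnit (i : ℕ) (j : ℕ) (N i j)) +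
      ∑ i : Fin m, ∑ j : Fin m, matrixUnit (i : ℕ) (j : ℕ) (M i j)
    simp only [CStarMatrix.add_apply, matrixUnit_add, Finset.sum_add_distrib]
  map_mul' N M := Subtype.ext <| by
    change _ = (∑ i : Fin m, ∑ j : Fin m, matrixUnit (i : ℕ) (j : ℕ) (N i j)) *
      ∑ i : Fin m, ∑ j : Fin m, matrixUnit (i : ℕ) (j : ℕ) (M i j)
    simp only [CStarMatrix.mul_apply, ← matrixUnitCLM_apply, map_sum]
    simp only [matrixUnitCLM_apply]
    rw [Finset.sum_mul]
    refine Finset.sum_congr rfl fun i _ => ?_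
    rw [Finset.sum_mul, Finset.sum_comm]
    refine Finset.sum_congr rfl fun j _ => ?_
    simp only [Finset.mul_sum, matrixUnit_mul, Fin.val_inj]
    symm
    rw [Finset.sum_eq_single j (fun k _ hk => by simp [hk.symm]) (by simp)]
    simp
  map_star' N := by
    symm
    refine AdjOp.star_eq_of_isAdjPair ?_
    change IsAdjPair A (∑ i : Fin m, ∑ j : Fin m, matrixUnit (i : ℕ) (j : ℕ) (N i j))
      (∑ i : Fin m, ∑ j : Fin m, matrixUnit (i : ℕ) (j : ℕ) (star (N j i)))
    rw [Finset.sum_comm (f := fun i j : Fin m => matrixUnit (i : ℕ) (j : ℕ) (star (N j i)))]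
    exact IsAdjPair.sum _ fun i _ => IsAdjPair.sum _ fun j _ => isAdjPair_matrixUnit _ _ _

theorem matrixHom_coe (m : ℕ) (N : CStarMatrix (Fin m) (Fin m) A) :
    (matrixHom m N : StdModule A →L[ℂ] StdModule A) =
      ∑ i : Fin m, ∑ j : Fin m, matrixUnit (i : ℕ) (j : ℕ) (N i j) := rfl

/-- In place of a unit, the adjoint of an entry serves as test vector: it produces `N k l * star (N
k l)`, and the C⋆-identity applies. -/
theorem matrixHom_injective (m : ℕ) : Function.Injective (matrixHom (A := A) m) := by
  rw [injective_iff_map_eq_zero]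
  intro N hN
  ext k l
  have h1 : ((matrixHom m N : StdModule A →L[ℂ] StdModule A)
      (StdModule.single (l : ℕ) (star (N k l)))) (k : ℕ) = 0 := by
    rw [hN]
    exact StdModule.zero_apply _
  have h2 : ((matrixHom m N : StdModule A →L[ℂ] StdModule A)
      (StdModule.single (l : ℕ) (star (N k l)))) (k : ℕ) = N k l * star (N k l) := by
    rw [matrixHom_coe]
    simp only [_root_.sum_apply, StdModule.sum_apply, matrixUnit_apply_apply,
      StdModule.single_apply, Fin.val_inj]
    rw [Finset.sum_eq_single k (fun i _ hi => by simp [hi.symm]) (by simp)]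
    simp
  rw [h2] at h1
  exact (CStarRing.mul_star_self_eq_zero_iff _).1 h1

/-- An injective ⋆-homomorphism of C⋆-algebras is isometric, so operator norms of finite matrices
can be compared inside matrix C⋆-algebras. -/
theorem norm_matrixHom (m : ℕ) (N : CStarMatrix (Fin m) (Fin m) A) : ‖matrixHom m N‖ = ‖N‖ :=
  NonUnitalStarAlgHom.norm_map (matrixHom m) (matrixHom_injective m) N

theorem sum_fin_fin_ite {G : Type*} [AddCommMonoid G] {s : Finset (ℕ × ℕ)} {m : ℕ}
    (hm : ∀ p ∈ s, p.1 < m ∧ p.2 < m) (g : ℕ × ℕ → G) :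
    ∑ i : Fin m, ∑ j : Fin m, (if ((i : ℕ), (j : ℕ)) ∈ s then g (i, j) else 0) = ∑ p ∈ s, g p := by
  rw [Fin.sum_univ_eq_sum_range
    (fun i => ∑ j : Fin m, if (i, (j : ℕ)) ∈ s then g (i, j) else 0)]
  simp only [fun i : ℕ => Fin.sum_univ_eq_sum_range
    (fun j => if (i, j) ∈ s then g (i, j) else 0) m]
  rw [← Finset.sum_product' (Finset.range m) (Finset.range m)
    (fun i j => if (i, j) ∈ s then g (i, j) else 0), ← Finset.sum_filter]
  refine Finset.sum_congr ?_ fun _ _ => rfl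
  ext p
  simp only [Finset.mem_filter, Finset.mem_product, Finset.mem_range]
  exact ⟨fun h => h.2, fun h => ⟨hm p h, h⟩⟩

/-- A ⋆-homomorphism applied to the entries of a finite matrix does not increase the norm of the
operator on the standard module. -/
theorem norm_sum_matrixUnit_map_le (φ : A →⋆ₙₐ[ℂ] C) (s : Finset (ℕ × ℕ)) (f : ℕ × ℕ → A) :
    ‖∑ p ∈ s, matrixUnit p.1 p.2 (φ (f p))‖ ≤ ‖∑ p ∈ s, matrixUnit p.1 p.2 (f p)‖ := by
  obtain ⟨m, hm⟩ : ∃ m, ∀ p ∈ s, p.1 < m ∧ p.2 < m := by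
    refine ⟨s.sup (fun p => max p.1 p.2) + 1, fun p hp => ?_⟩
    have := Finset.le_sup (f := fun p : ℕ × ℕ => max p.1 p.2) hp
    constructor <;> grind
  obtain ⟨N, hN⟩ : ∃ N : CStarMatrix (Fin m) (Fin m) A,
      ∀ i j, N i j = if ((i : ℕ), (j : ℕ)) ∈ s then f (i, j) else 0 :=
    ⟨CStarMatrix.ofMatrix (Matrix.of fun i j => _), fun _ _ => rfl⟩
  have h1 : (matrixHom m N : StdModule A →L[ℂ] StdModule A) =
      ∑ p ∈ s, matrixUnit p.1 p.2 (f p) := by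
    rw [matrixHom_coe, ← sum_fin_fin_ite hm]
    refine Finset.sum_congr rfl fun i _ => Finset.sum_congr rfl fun j _ => ?_
    rw [hN]
    split_ifs
    · rfl
    · exact matrixUnit_zero _ _
  have h2 : (matrixHom m (CStarMatrix.mapₙₐ φ N) : StdModule C →L[ℂ] StdModule C) =
      ∑ p ∈ s, matrixUnit p.1 p.2 (φ (f p)) := by
    rw [matrixHom_coe, ← sum_fin_fin_ite hm]
    refine Finset.sum_congr rfl fun i _ => Finset.sum_congr rfl fun j _ => ?_
    rw [show CStarMatrix.mapₙₐ φ N i j = φ (N i j) from rfl, hN]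
    split_ifs
    · rfl
    · rw [map_zero]; exact matrixUnit_zero _ _
  rw [← h1, ← h2]
  -- Applying `φ` to entries is a ⋆-homomorphism of matrix C⋆-algebras, hence contractive.
  refine (norm_matrixHom m _).trans_le (le_trans ?_ (norm_matrixHom m N).ge)
  exact NonUnitalStarAlgHom.norm_apply_le (CStarMatrix.mapₙₐ φ) N

/-- A ⋆-homomorphism applied to the entries of a sequence. -/
def StdModule.map (φ : A →⋆ₙₐ[ℂ] C) : StdModule A →L[ℂ] StdModule C :=
  LinearMap.mkContinuous
    { toFun := fun x => ⟨fun n => φ (x n), by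
        refine ((StdModule.summable x x).map φ (map_continuous φ)).congr fun n => ?_
        rw [Function.comp_apply, map_mul, map_star]⟩
      map_add' := fun x y => StdModule.ext fun n => map_add φ (x n) (y n)
      map_smul' := fun c x => StdModule.ext fun n => map_smul φ c (x n) } 1
    fun x => by
      rw [one_mul]
      refine StdModule.norm_le_of_trunc (norm_nonneg _) fun s => le_of_sq_le_sq ?_ (norm_nonneg _)
      refine le_trans ?_ (pow_le_pow_left₀ (norm_nonneg _) (StdModule.norm_trunc_le s x) 2)
      rw [StdModule.norm_trunc_sq, StdModule.norm_trunc_sq]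
      refine le_trans (le_of_eq ?_) (NonUnitalStarAlgHom.norm_apply_le φ _)
      rw [map_sum]
      simp only [map_mul, map_star]
      rfl

theorem StdModule.map_apply (φ : A →⋆ₙₐ[ℂ] C) (x : StdModule A) (n : ℕ) :
    StdModule.map φ x n = φ (x n) := rfl

theorem StdModule.inner_map (φ : A →⋆ₙₐ[ℂ] C) (x y : StdModule A) :
    (inner C (StdModule.map φ x) (StdModule.map φ y) : C) = φ (inner A x y) := by
  have h := (StdModule.hasSum_inner x y).map φ (map_continuous φ)
  refine (StdModule.hasSum_inner _ _).unique (h.congr_fun fun n => ?_)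
  rw [Function.comp_apply, map_mul, map_star]
  rfl

end MatrixUnit

/-! ### The graph of the closed derivation -/

namespace ClosedStarDerivation

variable {A B : Type*} [NonUnitalCStarAlgebra A] [PartialOrder A] [StarOrderedRing A]
    [NonUnitalCStarAlgebra B] [PartialOrder B] [StarOrderedRing B]
    {ρ : A →⋆ₙₐ[ℂ] B} (D : ClosedStarDerivation ρ)

/-- The graph of the closed derivation `δ : A_δ → B`. -/
def graph : Submodule ℂ (A × B) := D.ext.graph

theorem graph_eq_closure : D.graph = D.pmap.graph.topologicalClosure :=
  D.isClosable_pmap.graph_closure_eq_closure_graph.symm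

theorem isClosed_graph : IsClosed (D.graph : Set (A × B)) := by
  rw [graph_eq_closure]
  exact Submodule.isClosed_topologicalClosure _

theorem mem_graph (a : D.diffAlg) : ((a : A), D.dExt a) ∈ D.graph := D.ext.mem_graph a

theorem exists_of_mem_graph {a : A} {b : B} (h : (a, b) ∈ D.graph) :
    ∃ h : a ∈ D.diffAlg, D.dExt ⟨a, h⟩ = b := by
  obtain ⟨⟨y, hy⟩, h1, h2⟩ := D.ext.mem_graph_iff.1 h
  change y = a at h1
  subst h1
  exact ⟨hy, h2⟩

theorem mem_diffAlg_of_mem_graph {a : A} {b : B} (h : (a, b) ∈ D.graph) : a ∈ D.diffAlg :=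
  (D.exists_of_mem_graph h).1

theorem dExt_eq_of_mem_graph {a : A} {b : B} (h : (a, b) ∈ D.graph) (ha : a ∈ D.diffAlg) :
    D.dExt ⟨a, ha⟩ = b := (D.exists_of_mem_graph h).2

theorem dom_mem_graph (a : D.dom) : ((a : A), D.δ a) ∈ D.graph := by
  rw [graph_eq_closure]
  exact Submodule.le_topologicalClosure _ (D.pmap.mem_graph a)

/-- Identities for `δ` on `A_δ` need only be checked on `𝒜`, as soon as both sides are continuous on
pairs `(a, δ(a))`. -/
theorem mem_closure_iff_mem_graph {p : A × B} :
    p ∈ closure (Set.range fun a : D.dom => ((a : A), D.δ a)) ↔ p ∈ D.graph := by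
  rw [graph_eq_closure, ← SetLike.mem_coe, Submodule.topologicalClosure_coe]
  suffices h : (Set.range fun a : D.dom => ((a : A), D.δ a)) = (D.pmap.graph : Set (A × B)) by
    rw [h]
  ext p
  exact (LinearPMap.mem_graph_iff' D.pmap).symm

theorem mul_mem_graph {p q : A × B} (hp : p ∈ D.graph) (hq : q ∈ D.graph) :
    (p.1 * q.1, p.2 * ρ q.1 + ρ p.1 * q.2) ∈ D.graph := by
  rw [← mem_closure_iff_mem_graph] at hp hq ⊢
  have hρ : Continuous ρ := map_continuous ρ
  refine map_mem_closure₂ (f := fun p q : A × B => (p.1 * q.1, p.2 * ρ q.1 + ρ p.1 * q.2))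
    (by fun_prop) hp hq ?_
  rintro _ ⟨a, rfl⟩ _ ⟨b, rfl⟩
  exact ⟨a * b, Prod.ext rfl (D.map_mul a b)⟩

theorem star_mem_graph {p : A × B} (hp : p ∈ D.graph) : (star p.1, -star p.2) ∈ D.graph := by
  rw [← mem_closure_iff_mem_graph] at hp ⊢
  refine map_mem_closure (f := fun p : A × B => (star p.1, -star p.2)) (by fun_prop) hp ?_
  rintro _ ⟨a, rfl⟩
  exact ⟨star a, Prod.ext rfl (D.map_star a)⟩

/-- The relation `δ(x) = y` between sequences `x ∈ H_A` and `y ∈ H_B`. -/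
def StdGraph (x : StdModule A) (y : StdModule B) : Prop := ∀ n, (x n, y n) ∈ D.graph

variable {D}

theorem StdGraph.mem {x : StdModule A} {y : StdModule B} (h : D.StdGraph x y) : x ∈ D.diffStd := by
  refine ⟨fun n => D.mem_diffAlg_of_mem_graph (h n), ?_⟩
  have : (fun n => D.dExt ⟨x n, D.mem_diffAlg_of_mem_graph (h n)⟩) = y :=
    funext fun n => D.dExt_eq_of_mem_graph (h n) _
  rw [this]
  exact y.2

theorem StdGraph.incl_dStd {x : StdModule A} {y : StdModule B} (h : D.StdGraph x y)
    (hx : x ∈ D.diffStd) (n : ℕ) : D.incl (D.dStd ⟨x, hx⟩ n) = y n :=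
  D.dExt_eq_of_mem_graph (h n) _

theorem exists_stdGraph {x : StdModule A} (hx : x ∈ D.diffStd) : ∃ y, D.StdGraph x y :=
  ⟨⟨_, hx.choose_spec⟩, fun n => D.mem_graph ⟨x n, hx.choose n⟩⟩

theorem StdGraph.add {x x' : StdModule A} {y y' : StdModule B} (h : D.StdGraph x y)
    (h' : D.StdGraph x' y') : D.StdGraph (x + x') (y + y') := fun n => add_mem (h n) (h' n)

theorem StdGraph.zero : D.StdGraph 0 0 := fun _ => zero_mem _

theorem StdGraph.op_smul {x : StdModule A} {y : StdModule B} (h : D.StdGraph x y) {a : A} {b : B}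
    (hab : (a, b) ∈ D.graph) :
    D.StdGraph (x <• a) (y <• ρ a + StdModule.map ρ x <• b) :=
  fun n => D.mul_mem_graph (h n) hab

theorem StdGraph.of_tendsto {ι : Type*} {l : Filter ι} [l.NeBot] {x : ι → StdModule A}
    {y : ι → StdModule B} {x' : StdModule A} {y' : StdModule B}
    (h : ∀ i, D.StdGraph (x i) (y i)) (hx : Tendsto x l (𝓝 x')) (hy : Tendsto y l (𝓝 y')) :
    D.StdGraph x' y' := fun n =>
  D.isClosed_graph.mem_of_tendsto
    ((((StdModule.continuous_eval n).tendsto _).comp hx).prodMk_nhds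
      (((StdModule.continuous_eval n).tendsto _).comp hy)) (Eventually.of_forall fun i => h i n)

/-- Termwise, `δ(xₙ⋆ x'ₙ) = ρ(xₙ)⋆ δ(x'ₙ) - δ(xₙ)⋆ ρ(x'ₙ)`, the sign coming from `δ(a⋆) = -δ(a)⋆`.
The series converge in `A` and in `B`, and the graph is closed. -/
theorem StdGraph.inner {x x' : StdModule A} {y y' : StdModule B} (h : D.StdGraph x y)
    (h' : D.StdGraph x' y') : ((inner A x x' : A),
      (inner B (StdModule.map ρ x) y' - inner B y (StdModule.map ρ x') : B)) ∈ D.graph := by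
  have h1 := (StdModule.hasSum_inner x x').prodMk ((StdModule.hasSum_inner (StdModule.map ρ x)
    y').sub (StdModule.hasSum_inner y (StdModule.map ρ x')))
  refine D.isClosed_graph.mem_of_tendsto h1 (Eventually.of_forall fun s => ?_)
  refine Submodule.sum_mem _ fun n _ => ?_
  have h2 := D.mul_mem_graph (D.star_mem_graph (h n)) (h' n)
  convert h2 using 2
  simp only [StdModule.map_apply]
  rw [neg_mul, neg_add_eq_sub, show ρ (star (x n)) = star (ρ (x n)) from StarHomClass.map_star ρ _]

/-! ### Finite matrices with their derivatives, and the closure of these triples. -/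

variable (D)

/-- The linear map `M ↦ (M, ρ(M), δ(M))` on finite matrices over `𝒜`. -/
def tripleMap : ((ℕ × ℕ) →₀ D.dom) →ₗ[ℂ]
    (StdModule A →L[ℂ] StdModule A) × (StdModule B →L[ℂ] StdModule B) ×
      (StdModule B →L[ℂ] StdModule B) :=
  Finsupp.lsum ℂ fun p =>
    { toFun := fun a => (matrixUnit p.1 p.2 (a : A), matrixUnit p.1 p.2 (ρ a),
        matrixUnit p.1 p.2 (D.δ a))
      map_add' := fun a b => by
        simp only [NonUnitalStarSubalgebra.coe_add, map_add, matrixUnit_add, Prod.mk_add_mk]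
      map_smul' := fun c a => by
        simp only [NonUnitalStarSubalgebra.coe_smul, map_smul, matrixUnit_smul, Prod.smul_mk,
          RingHom.id_apply] }

theorem tripleMap_single (p : ℕ × ℕ) (a : D.dom) : D.tripleMap (Finsupp.single p a) =
    (matrixUnit p.1 p.2 (a : A), matrixUnit p.1 p.2 (ρ a), matrixUnit p.1 p.2 (D.δ a)) :=
  Finsupp.lsum_single _ _ _ _

theorem tripleMap_apply (M : (ℕ × ℕ) →₀ D.dom) : D.tripleMap M =
    (D.matOp M, M.sum fun p a => matrixUnit p.1 p.2 (ρ a), D.matOpD M) := by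
  induction M using Finsupp.induction_linear with
  | zero => rw [map_zero]; rfl
  | add M N hM hN =>
    rw [map_add, hM, hN, matOp, matOp, matOp, matOpD, matOpD, matOpD,
      Finsupp.sum_add_index', Finsupp.sum_add_index', Finsupp.sum_add_index']
    · rfl
    all_goals simp [matrixUnit_zero, matrixUnit_add]
  | single p a =>
    rw [tripleMap_single, matOp, matOpD, Finsupp.sum_single_index, Finsupp.sum_single_index,
      Finsupp.sum_single_index]
    all_goals simp [matrixUnit_zero]

/-- Convergence of `M` forces that of `ρ(M)`. The middle entry of a triple is thus no extra
condition; it is carried along because the Leibniz rule needs it. -/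
theorem norm_tripleMap_le (M : (ℕ × ℕ) →₀ D.dom) :
    ‖(D.tripleMap M).2.1‖ ≤ ‖(D.tripleMap M).1‖ := by
  rw [tripleMap_apply]
  exact norm_sum_matrixUnit_map_le ρ M.support fun p => (M p : A)

/-- The closure of the set of the triples `(M, ρ(M), δ(M))`. -/
def triples : Submodule ℂ ((StdModule A →L[ℂ] StdModule A) ×
    (StdModule B →L[ℂ] StdModule B) × (StdModule B →L[ℂ] StdModule B)) :=
  (LinearMap.range D.tripleMap).topologicalClosure

theorem isClosed_triples : IsClosed (D.triples : Set ((StdModule A →L[ℂ] StdModule A) ×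
    (StdModule B →L[ℂ] StdModule B) × (StdModule B →L[ℂ] StdModule B))) :=
  Submodule.isClosed_topologicalClosure _

theorem tripleMap_mem (M : (ℕ × ℕ) →₀ D.dom) : D.tripleMap M ∈ D.triples :=
  Submodule.le_topologicalClosure _ ⟨M, rfl⟩

theorem isDiffCompact_of_mem_triples {t : (StdModule A →L[ℂ] StdModule A) ×
    (StdModule B →L[ℂ] StdModule B) × (StdModule B →L[ℂ] StdModule B)} (h : t ∈ D.triples) :
    D.IsDiffCompact t.1 := by
  obtain ⟨u, hu, hlim⟩ := mem_closure_iff_seq_limit.1 h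
  choose M hM using hu
  have h1 : u = fun k => D.tripleMap (M k) := funext fun k => (hM k).symm
  simp only [h1, tripleMap_apply] at hlim
  exact ⟨M, (continuous_fst.tendsto _).comp hlim,
    (((continuous_snd.comp continuous_snd).tendsto _).comp hlim).cauchySeq⟩

theorem exists_triple_of_isDiffCompact {T : StdModule A →L[ℂ] StdModule A}
    (h : D.IsDiffCompact T) : ∃ R S, (T, R, S) ∈ D.triples := by
  obtain ⟨M, hM, hM'⟩ := h
  obtain ⟨S, hS⟩ := cauchySeq_tendsto_of_complete hM'
  -- The contractivity of `M ↦ ρ(M)` is applied to differences `M m - M n`.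
  have h1 : CauchySeq fun k => (D.tripleMap (M k)).2.1 := by
    have h2 := hM.cauchySeq
    rw [Metric.cauchySeq_iff] at h2 ⊢
    refine fun ε hε => (h2 ε hε).imp fun N hN m hm n hn => lt_of_le_of_lt ?_ (hN m hm n hn)
    rw [dist_eq_norm, dist_eq_norm]
    have := D.norm_tripleMap_le (M m - M n)
    rw [map_sub, Prod.snd_sub, Prod.fst_sub, Prod.fst_sub] at this
    simp only [tripleMap_apply] at this ⊢
    exact this
  obtain ⟨R, hR⟩ := cauchySeq_tendsto_of_complete h1
  refine ⟨R, S, D.isClosed_triples.mem_of_tendsto (hM.prodMk_nhds (hR.prodMk_nhds hS))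
    (Eventually.of_forall fun k => ?_)⟩
  have h2 := D.tripleMap_mem (M k)
  rw [tripleMap_apply] at h2 ⊢
  exact h2

/-- Matrices in the domain of the closed derivation preserve `H_{A_δ}`. -/
theorem stdGraph_of_mem_triples {T : StdModule A →L[ℂ] StdModule A}
    {R S : StdModule B →L[ℂ] StdModule B} (h : (T, R, S) ∈ D.triples) {x : StdModule A}
    {y : StdModule B} (hx : D.StdGraph x y) :
    D.StdGraph (T x) (S (StdModule.map ρ x) + R y) := by
  -- The rule `δ(M x) = δ(M) ρ(x) + ρ(M) δ(x)` is additive in `M`, hence reduces to the Leibniz rule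
  -- for a single entry; the closed graph carries it to limits of matrices.
  have h1 (M) : D.StdGraph ((D.tripleMap M).1 x)
      ((D.tripleMap M).2.2 (StdModule.map ρ x) + (D.tripleMap M).2.1 y) := by
    induction M using Finsupp.induction_linear with
    | zero =>
      simp only [map_zero, Prod.fst_zero, Prod.snd_zero, _root_.zero_apply, add_zero]
      exact StdGraph.zero
    | add M N hM hN =>
      convert hM.add hN using 1
      · rw [map_add]; rfl
      · rw [map_add, Prod.snd_add, Prod.snd_add, Prod.fst_add, _root_.add_apply,
          _root_.add_apply]
        abel
    | single p a =>
      rw [tripleMap_single]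
      intro n
      rw [StdModule.add_apply]
      simp only [matrixUnit_apply_apply]
      split_ifs
      · exact D.mul_mem_graph (D.dom_mem_graph a) (hx p.2)
      · rw [add_zero]; exact zero_mem _
  obtain ⟨u, hu, hlim⟩ := mem_closure_iff_seq_limit.1 h
  choose M hM using hu
  have h2 : u = fun k => D.tripleMap (M k) := funext fun k => (hM k).symm
  rw [h2] at hlim
  have e (z : StdModule B) := (ContinuousLinearMap.apply ℂ (StdModule B) z).continuous
  have h3 := (continuous_fst.tendsto _).comp hlim
  have h4 := ((continuous_fst.comp continuous_snd).tendsto _).comp hlim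
  have h5 := ((continuous_snd.comp continuous_snd).tendsto _).comp hlim
  exact StdGraph.of_tendsto (fun k => h1 (M k))
    (((ContinuousLinearMap.apply ℂ (StdModule A) x).continuous.tendsto _).comp h3)
    ((((e _).tendsto _).comp h5).add (((e _).tendsto _).comp h4))

/-- The Leibniz rule makes `𝒦(H_A)_δ` an algebra. The product is bilinear and norm continuous, so
matrices with one entry suffice. -/
theorem mul_mem_triples {s t : (StdModule A →L[ℂ] StdModule A) ×
    (StdModule B →L[ℂ] StdModule B) × (StdModule B →L[ℂ] StdModule B)}
    (hs : s ∈ D.triples) (ht : t ∈ D.triples) :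
    (s.1 * t.1, s.2.1 * t.2.1, s.2.2 * t.2.1 + s.2.1 * t.2.2) ∈ D.triples := by
  refine map_mem_closure₂ (f := fun s t : (StdModule A →L[ℂ] StdModule A) ×
      (StdModule B →L[ℂ] StdModule B) × (StdModule B →L[ℂ] StdModule B) =>
      (s.1 * t.1, s.2.1 * t.2.1, s.2.2 * t.2.1 + s.2.1 * t.2.2))
    (by fun_prop) hs ht ?_
  rintro _ ⟨M, rfl⟩ _ ⟨N, rfl⟩
  rw [SetLike.mem_coe]
  induction M using Finsupp.induction_linear with
  | zero =>
    simp only [map_zero, Prod.fst_zero, Prod.snd_zero, zero_mul, add_zero]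
    exact zero_mem _
  | add M M' hM hM' =>
    convert add_mem hM hM' using 1
    simp only [map_add, Prod.fst_add, Prod.snd_add, add_mul, Prod.mk_add_mk]
    congr 2
    abel
  | single p a =>
    induction N using Finsupp.induction_linear with
    | zero =>
      simp only [map_zero, Prod.fst_zero, Prod.snd_zero, mul_zero, add_zero]
      exact zero_mem _
    | add N N' hN hN' =>
      convert add_mem hN hN' using 1
      simp only [map_add, Prod.fst_add, Prod.snd_add, mul_add, Prod.mk_add_mk]
      congr 2
      abel
    | single q b =>
      rw [tripleMap_single, tripleMap_single]
      simp only [matrixUnit_mul]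
      split_ifs with hpq
      · refine ⟨Finsupp.single (p.1, q.2) (a * b), ?_⟩
        rw [tripleMap_single, D.map_mul, matrixUnit_add]
        exact Prod.ext rfl (Prod.ext (congrArg (matrixUnit p.1 q.2) (_root_.map_mul ρ (a : A) b)) rfl)
      · rw [add_zero]
        exact zero_mem _

end ClosedStarDerivation

end

noncomputable section

/-! ### The operator `W ⊗ 1` -/

namespace InteriorTensor

open HilbertCMod

variable {A C X : Type*} [NonUnitalCStarAlgebra A] [PartialOrder A] [StarOrderedRing A]
    [NonUnitalCStarAlgebra C] [PartialOrder C] [StarOrderedRing C]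
    [NormedAddCommGroup X] [NormedSpace ℂ X] [SMul Aᵐᵒᵖ X] [HilbertCMod A X]
    (φ : A →⋆ₙₐ[ℂ] C) (W : Adjointable A X (StdModule A))

/-- The map `ξ ⊗ ω ↦ (φ(W(ξ)ₙ) ω)ₙ` on the algebraic tensor product. -/
def preAmp : PreTensor X φ →ₗ[ℂ] StdModule C :=
  TensorProduct.lift (LinearMap.mk₂ ℂ (fun ξ ω => StdModule.map φ (W.toCLM ξ) <• ω)
    (fun ξ η ω => by rw [map_add, map_add, HilbertCMod.add_op_smul])
    (fun c ξ ω => by rw [map_smul, map_smul, HilbertCMod.smul_op_smul])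
    (fun ξ ω θ => HilbertCMod.op_smul_add _ _ _)
    (fun c ξ ω => HilbertCMod.op_smul_smul _ _ _))

theorem preAmp_tmul (ξ : X) (ω : C) :
    preAmp φ W (PreTensor.tmul φ ξ ω) = StdModule.map φ (W.toCLM ξ) <• ω := rfl

variable {W}

/-- Because `W` is an isometry, so is `W ⊗ 1` for the form on the algebraic tensor product. This is
what lets it descend and extend to the completion. -/
theorem inner_preAmp (hW : ∀ ξ η, (inner A (W.toCLM ξ) (W.toCLM η) : A) = inner A ξ η)
    (x y : PreTensor X φ) :
    (inner C (preAmp φ W x) (preAmp φ W y) : C) = PreTensor.sesq φ x y := by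
  induction x using PreTensor.induction_on with
  | zero => rw [map_zero, map_zero, HilbertCMod.inner_zero_left, LinearMap.zero_apply]
  | add x x' hx hx' =>
    rw [map_add, map_add, HilbertCMod.inner_add_left, LinearMap.add_apply, hx, hx']
  | tmul ξ ω =>
    induction y using PreTensor.induction_on with
    | zero => rw [map_zero, map_zero, HilbertCMod.inner_zero_right]
    | add y y' hy hy' => rw [map_add, map_add, HilbertCMod.inner_add_right, hy, hy']
    | tmul η θ =>
      rw [preAmp_tmul, preAmp_tmul, HilbertCMod.inner_smul_left, HilbertCMod.inner_smul_right,
        StdModule.inner_map, hW]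
      rfl

/-- The continuous extension of `ξ ⊗ ω ↦ (φ(W(ξ)ₙ) ω)ₙ` for an isometry `W`. -/
def ampCLM (hW : ∀ ξ η, (inner A (W.toCLM ξ) (W.toCLM η) : A) = inner A ξ η) :
    InteriorTensor X φ →L[ℂ] StdModule C :=
  ((preAmp φ W).mkContinuous 1 fun z => by
    refine le_of_sq_le_sq ?_ (by positivity)
    rw [norm_sq_eq (A := C), inner_preAmp φ hW, one_mul, pow_two]
    exact PreTensor.norm_sesq_le φ z z).extend (ι φ)

variable (hW : ∀ ξ η, (inner A (W.toCLM ξ) (W.toCLM η) : A) = inner A ξ η)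

theorem ampCLM_ι (z : PreTensor X φ) : ampCLM φ hW (ι φ z) = preAmp φ W z :=
  ContinuousLinearMap.extend_eq _ (denseRange_ι φ) (isUniformInducing_ι φ) z

theorem ampCLM_tmul (ξ : X) (ω : C) :
    ampCLM φ hW (tmul φ ξ ω) = StdModule.map φ (W.toCLM ξ) <• ω := ampCLM_ι φ hW _

theorem inner_ampCLM (x y : InteriorTensor X φ) :
    (inner C (ampCLM φ hW x) (ampCLM φ hW y) : C) = inner C x y := by
  have hc (z : StdModule C) := continuous_inner_right (A := C) z
  have hc' (z : StdModule C) := continuous_inner_left (A := C) z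
  have hd := continuous_inner (X := X) φ
  have ha := (ampCLM φ hW).continuous
  induction x using induction_ι with
  | hc => exact isClosed_eq ((hc' _).comp ha) (hd.comp (continuous_id.prodMk continuous_const))
  | h x =>
    induction y using induction_ι with
    | hc => exact isClosed_eq ((hc _).comp ha) (hd.comp (continuous_const.prodMk continuous_id))
    | h y => rw [ampCLM_ι, ampCLM_ι, inner_preAmp φ hW, inner_ι]

variable {ζ : ℕ → X} (hζ : ∀ η n, W.toCLM η n = inner A (ζ n) η)

include hζ in
-- The `n`-th coordinate of `W ⊗ 1` is adjoint to the creation operator of `ζ n`; this is the input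
-- that `Adjointable.ofCoords` needs.
theorem inner_tmul_eq_star_mul_ampCLM (n : ℕ) (ω : C) (z : InteriorTensor X φ) :
    (inner C (tmul φ (ζ n) ω) z : C) = star ω * ampCLM φ hW z n := by
  induction z using induction_ι with
  | hc =>
    exact isClosed_eq (continuous_inner_right _)
      (continuous_const.mul ((StdModule.continuous_eval n).comp (ampCLM φ hW).continuous))
  | h z =>
    rw [ampCLM_ι, tmul, inner_ι, PreTensor.sesq_tmul_left]
    congr 1
    induction z using PreTensor.induction_on with
    | zero => rw [map_zero, map_zero, StdModule.zero_apply]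
    | add x y hx hy => rw [map_add, map_add, StdModule.add_apply, hx, hy]
    | tmul η θ =>
      rw [PreTensor.contract_tmul, preAmp_tmul, StdModule.op_smul_apply, StdModule.map_apply, hζ]

/-- The adjointable operator `W ⊗ 1` for an isometry `W` given by a frame. -/
def amp : Adjointable C (InteriorTensor X φ) (StdModule C) :=
  Adjointable.ofCoords (ampCLM φ hW) (fun n => (creation φ (ζ n)).toCLM.toLinearMap)
    (inner_tmul_eq_star_mul_ampCLM φ hW hζ)

theorem amp_tmul (ξ : X) (ω : C) :
    (amp φ hW hζ).toCLM (tmul φ ξ ω) = StdModule.map φ (W.toCLM ξ) <• ω := ampCLM_tmul φ hW ξ ω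

theorem amp_adj_amp (z : InteriorTensor X φ) :
    (amp φ hW hζ).adj ((amp φ hW hζ).toCLM z) = z :=
  ext_inner (A := C) fun w => by
    rw [← (amp φ hW hζ).inner_adj]
    exact inner_ampCLM φ hW w z

/-- The adjoint form of `(W ⊗ 1) T_ξ ω = W(ξ) ω`. It moves the contraction with `ξ` from the
interior tensor product to the standard module. -/
theorem creation_adj_amp_adj (ξ : X) (y : StdModule C) :
    (creation φ ξ).adj ((amp φ hW hζ).adj y) = inner C (StdModule.map φ (W.toCLM ξ)) y :=
  ext_inner (A := C) fun ω => by
    rw [← (creation φ ξ).inner_adj, ← (amp φ hW hζ).inner_adj, creation_apply, amp_tmul,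
      HilbertCMod.inner_smul_left]
    rfl

end InteriorTensor

/-! ### The Graßmann connection of an absorption triple -/

namespace ClosedStarDerivation

open HilbertCMod

variable {A B : Type*} [NonUnitalCStarAlgebra A] [PartialOrder A] [StarOrderedRing A]
    [NonUnitalCStarAlgebra B] [PartialOrder B] [StarOrderedRing B]
    {ρ : A →⋆ₙₐ[ℂ] B} (D : ClosedStarDerivation ρ)

theorem incl_injective : Function.Injective D.incl := Subtype.val_injective

theorem stdGraph_dStd (x : D.diffStd) :
    D.StdGraph (x : StdModule A) (StdModule.map D.incl (D.dStd x)) := fun n =>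
  D.mem_graph ⟨x.1 n, x.2.choose n⟩

theorem dStd_op_smul {x : StdModule A} (hx : x ∈ D.diffStd) (a : D.diffAlg)
    (hxa : x <• (a : A) ∈ D.diffStd) :
    D.dStd ⟨x <• (a : A), hxa⟩ = D.dStd ⟨x, hx⟩ <• D.rho a + StdModule.map D.rho x <• D.d a :=
  StdModule.ext fun n => D.incl_injective
    (((D.stdGraph_dStd ⟨x, hx⟩).op_smul (D.mem_graph a)).incl_dStd hxa n)

theorem op_smul_mem_diffStd {x : StdModule A} (hx : x ∈ D.diffStd) (a : D.diffAlg) :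
    x <• (a : A) ∈ D.diffStd := ((D.stdGraph_dStd ⟨x, hx⟩).op_smul (D.mem_graph a)).mem

theorem inner_mem_diffAlg {x y : StdModule A} (hx : x ∈ D.diffStd) (hy : y ∈ D.diffStd) :
    (inner A x y : A) ∈ D.diffAlg :=
  D.mem_diffAlg_of_mem_graph ((D.stdGraph_dStd ⟨x, hx⟩).inner (D.stdGraph_dStd ⟨y, hy⟩))

/-- The Hermitian identity for the connection `δ` on the standard module, from which that of the
Graßmann connection is inherited. -/
theorem d_inner {x y : StdModule A} (hx : x ∈ D.diffStd) (hy : y ∈ D.diffStd) :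
    D.d ⟨inner A x y, D.inner_mem_diffAlg hx hy⟩ =
      inner D.Forms (StdModule.map D.rho x) (D.dStd ⟨y, hy⟩) -
        star (inner D.Forms (StdModule.map D.rho y) (D.dStd ⟨x, hx⟩)) := by
  apply D.incl_injective
  rw [HilbertCMod.star_inner, _root_.map_sub, ← StdModule.inner_map, ← StdModule.inner_map]
  exact D.dExt_eq_of_mem_graph ((D.stdGraph_dStd ⟨x, hx⟩).inner (D.stdGraph_dStd ⟨y, hy⟩)) _

theorem single_mem_diffStd (n : ℕ) (a : D.dom) : StdModule.single n (a : A) ∈ D.diffStd := by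
  have h : D.StdGraph (StdModule.single n (a : A)) (StdModule.single n (D.δ a)) := fun k => by
    rw [StdModule.single_apply, StdModule.single_apply]
    split_ifs
    · exact D.dom_mem_graph a
    · exact zero_mem _
  exact h.mem

/-- Finite sequences with entries in `𝒜` are already dense. -/
theorem dense_diffStd : Dense (D.diffStd : Set (StdModule A)) := fun x => by
  rw [← Submodule.topologicalClosure_coe]
  have h (n : ℕ) (a : A) : StdModule.single n a ∈ D.diffStd.topologicalClosure :=
    map_mem_closure (StdModule.singleCLM A n).continuous (D.dense_dom a)
      fun b hb => D.single_mem_diffStd n ⟨b, hb⟩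
  exact D.diffStd.isClosed_topologicalClosure.mem_of_tendsto (StdModule.hasSum_single x)
    (Eventually.of_forall fun s => Submodule.sum_mem _ fun n _ => h n _)

variable {X : Type*} [NormedAddCommGroup X] [NormedSpace ℂ X] [SMul Aᵐᵒᵖ X] [HilbertCMod A X]
    {D}

namespace IsAbsorption

variable {W : Adjointable A X (StdModule A)} {K : Adjointable A (StdModule A) (StdModule A)}
    {ζ : ℕ → X} (h : D.IsAbsorption W K ζ)

include h

theorem adj_apply (ξ : X) : W.adj (W.toCLM ξ) = ξ := DFunLike.congr_fun h.isometry ξ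

theorem inner_apply (ξ η : X) : (inner A (W.toCLM ξ) (W.toCLM η) : A) = inner A ξ η := by
  rw [W.inner_adj, h.adj_apply]

theorem commute_apply (x : StdModule A) :
    K.toCLM (W.toCLM (W.adj x)) = W.toCLM (W.adj (K.toCLM x)) := DFunLike.congr_fun h.commute x

theorem dense_grassmannDomain : Dense (D.grassmannDomain W K : Set X) := by
  have h1 : DenseRange (W.adj ∘L K.toCLM ∘L K.toCLM) := by
    -- The square of `W⋆ K W` equals `W⋆ K² W`, by `K P = P K` and `W⋆ W = 1`, so its dense range
    -- lies in that of `W⋆ K²`.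
    have h2 : DenseRange ((W.adj ∘L K.toCLM ∘L W.toCLM) ∘ (W.adj ∘L K.toCLM ∘L W.toCLM)) :=
      h.dense.comp h.dense (ContinuousLinearMap.continuous _)
    refine h2.mono ?_
    rintro _ ⟨x, rfl⟩
    refine ⟨W.toCLM x, ?_⟩
    simp only [ContinuousLinearMap.comp_apply, Function.comp_apply]
    rw [h.commute_apply, h.adj_apply]
  have h3 := h1.dense_image (ContinuousLinearMap.continuous _) D.dense_diffStd
  exact h3

theorem op_smul_mem (η : D.grassmannDomain W K) (a : D.diffAlg) :
    (η : X) <• (a : A) ∈ D.grassmannDomain W K := by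
  obtain ⟨x, hx, h1⟩ := η.2
  refine ⟨x <• (a : A), D.op_smul_mem_diffStd hx a, ?_⟩
  rw [← h1]
  change W.adj (K.toCLM (K.toCLM (x <• (a : A)))) = W.adj (K.toCLM (K.toCLM x)) <• (a : A)
  rw [K.map_op_smul, K.map_op_smul, W.adj_op_smul]

/-- For `ξ = W⋆ K² x` one has `W ξ = P K² x`, and differentiable compact operators preserve
`H_{A_δ}`. This is why `𝒳` is built from `K²`. -/
theorem apply_mem_diffStd (ξ : D.grassmannDomain W K) : W.toCLM ξ ∈ D.diffStd := by
  obtain ⟨x, hx, h1⟩ := ξ.2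
  obtain ⟨R, S, h2⟩ := D.exists_triple_of_isDiffCompact h.diffCompact
  obtain ⟨y, hy⟩ := exists_stdGraph hx
  rw [← h1]
  exact (D.stdGraph_of_mem_triples h2 hy).mem

end IsAbsorption

end ClosedStarDerivation

theorem grassmann_connection {A B X : Type*}
    [NonUnitalCStarAlgebra A] [PartialOrder A] [StarOrderedRing A]
    [NonUnitalCStarAlgebra B] [PartialOrder B] [StarOrderedRing B]
    [NormedAddCommGroup X] [NormedSpace ℂ X] [SMul Aᵐᵒᵖ X] [HilbertCMod A X]
    {ρ : A →⋆ₙₐ[ℂ] B} (D : ClosedStarDerivation ρ) (W : Adjointable A X (StdModule A))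
    (K : Adjointable A (StdModule A) (StdModule A)) (ζ : ℕ → X) (h : D.IsAbsorption W K ζ) :
      Dense (D.grassmannDomain W K : Set X) ∧
      ∃ (hmod : ∀ (η : D.grassmannDomain W K) (a : D.diffAlg),
          (η : X) <• (a : A) ∈ D.grassmannDomain W K)
        (hW : ∀ ξ : D.grassmannDomain W K, W.toCLM ξ ∈ D.diffStd)
        (hin : ∀ ξ η : D.grassmannDomain W K, inner A (ξ : X) (η : X) ∈ D.diffAlg),
      ∃ W₁ : Adjointable D.Forms (InteriorTensor X D.rho) (StdModule D.Forms),
        (∀ (ξ : X) (ω : D.Forms) (n : ℕ),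
          W₁.toCLM (InteriorTensor.tmul D.rho ξ ω) n = D.rho (W.toCLM ξ n) * ω) ∧
      ∃ nabla : D.grassmannDomain W K →ₗ[ℂ] InteriorTensor X D.rho,
        (∀ ξ, nabla ξ = W₁.adj (D.dStd ⟨W.toCLM ξ, hW ξ⟩)) ∧
        (∀ ξ η : D.grassmannDomain W K,
          D.d ⟨inner A (ξ : X) (η : X), hin ξ η⟩ =
            (InteriorTensor.creation D.rho (ξ : X)).adj (nabla η) -
              star ((InteriorTensor.creation D.rho (η : X)).adj (nabla ξ))) ∧
        (∀ (η : D.grassmannDomain W K) (a : D.diffAlg),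
          nabla ⟨(η : X) <• (a : A), hmod η a⟩ =
            nabla η <• D.rho a + InteriorTensor.tmul D.rho (η : X) (D.d a)) := by
  have hW := h.apply_mem_diffStd
  refine ⟨h.dense_grassmannDomain, h.op_smul_mem, hW, fun ξ η => ?_,
    InteriorTensor.amp D.rho h.inner_apply h.frame, fun ξ ω n => ?_,
    (InteriorTensor.amp D.rho h.inner_apply h.frame).adj.toLinearMap ∘ₗ D.dStd ∘ₗ
      LinearMap.codRestrict D.diffStd (W.toCLM.toLinearMap ∘ₗ Submodule.subtype _) hW,
    fun ξ => rfl, fun ξ η => ?_, fun η a => ?_⟩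
  · rw [← h.inner_apply]
    exact D.inner_mem_diffAlg (hW ξ) (hW η)
  · rw [InteriorTensor.amp_tmul]
    rfl
  · have h1 := D.d_inner (hW ξ) (hW η)
    simp only [h.inner_apply] at h1
    rw [h1]
    exact congrArg₂ (fun u v => u - star v)
      (InteriorTensor.creation_adj_amp_adj D.rho h.inner_apply h.frame ξ _).symm
      (InteriorTensor.creation_adj_amp_adj D.rho h.inner_apply h.frame η _).symm
  · set W₁ := InteriorTensor.amp D.rho h.inner_apply h.frame
    have h1 : W.toCLM ((η : X) <• (a : A)) = W.toCLM η <• (a : A) := W.map_op_smul _ _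
    have h2 : W.toCLM η <• (a : A) ∈ D.diffStd := D.op_smul_mem_diffStd (hW η) a
    calc W₁.adj (D.dStd ⟨W.toCLM ((η : X) <• (a : A)), hW ⟨_, h.op_smul_mem η a⟩⟩)
        = W₁.adj (D.dStd ⟨W.toCLM η <• (a : A), h2⟩) := by simp only [h1]
      _ = W₁.adj (D.dStd ⟨W.toCLM η, hW η⟩) <• D.rho a +
          InteriorTensor.tmul D.rho (η : X) (D.d a) := by
        -- In `δ(W(η) a) = δ(W(η)) ρ(a) + W(η) δ(a)` the last term is `(W ⊗ 1)(η ⊗ δ(a))`, and `W⋆ ⊗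
        -- 1` is a left inverse of `W ⊗ 1`.
        rw [D.dStd_op_smul (hW η), map_add, W₁.adj_op_smul,
          ← InteriorTensor.amp_tmul D.rho h.inner_apply h.frame, InteriorTensor.amp_adj_amp]

end

noncomputable section

/-! ### Blocks of the standard module -/

theorem Adjointable.hasSum_ofCoords_adj {A E : Type*} [NonUnitalCStarAlgebra A] [PartialOrder A]
    [StarOrderedRing A] [NormedAddCommGroup E] [NormedSpace ℂ E] [SMul Aᵐᵒᵖ E] [HilbertCMod A E]
    [CompleteSpace E] (V : E →L[ℂ] StdModule A) (k : ℕ → A →ₗ[ℂ] E)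
    (h : ∀ n a z, (inner A (k n a) z : A) = star a * V z n) (y : StdModule A) :
    HasSum (fun n => k n (y n)) ((Adjointable.ofCoords V k h).adj y) :=
  (Adjointable.summable_coords V k h y).hasSum

namespace StdModule

open HilbertCMod

variable {A : Type*} [NonUnitalCStarAlgebra A] [PartialOrder A] [StarOrderedRing A]

/-- The operator `x ↦ (x_{e(n)})ₙ`. -/
def pull (e : ℕ → ℕ) (he : Function.Injective e) : StdModule A →L[ℂ] StdModule A :=
  LinearMap.mkContinuous
    { toFun := fun x => ⟨fun n => x (e n), (summable x x).comp_injective he⟩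
      map_add' := fun x y => rfl
      map_smul' := fun c x => rfl } 1
    fun x => by
      rw [one_mul]
      refine norm_le_of_trunc (norm_nonneg _) fun s => ?_
      refine le_trans (le_of_eq ?_) (norm_trunc_le (s.map ⟨e, he⟩) x)
      rw [← sq_eq_sq₀ (norm_nonneg _) (norm_nonneg _), norm_trunc_sq, norm_trunc_sq,
        Finset.sum_map]
      rfl

/-- The operator that cuts out the `m`-th block of a sequence indexed by pairs; its adjoint embeds
`H_A` as the `m`-th block. -/
def block (A : Type*) [NonUnitalCStarAlgebra A] [PartialOrder A] [StarOrderedRing A] (m : ℕ) :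
    Adjointable A (StdModule A) (StdModule A) :=
  Adjointable.ofCoords (pull (Nat.pair m) fun _ _ h => (Nat.pair_eq_pair.1 h).2)
    (fun n => (singleCLM A (Nat.pair m n)).toLinearMap)
    fun _ _ _ => inner_single_left _ _ _

theorem block_apply (m : ℕ) (x : StdModule A) (n : ℕ) :
    (block A m).toCLM x n = x (Nat.pair m n) := rfl

theorem block_adj_apply (m : ℕ) (y : StdModule A) (k n : ℕ) :
    (block A m).adj y (Nat.pair k n) = if k = m then y n else 0 := by
  have h1 : HasSum (fun l => single (Nat.pair m l) (y l)) ((block A m).adj y) :=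
    Adjointable.hasSum_ofCoords_adj _ _ _ y
  have h2 := h1.map (evalCLM A (Nat.pair k n)) (evalCLM A _).continuous
  refine h2.unique ?_
  have h3 : (evalCLM A (Nat.pair k n) ∘ fun l => single (Nat.pair m l) (y l)) =
      fun l => if l = n then (if k = m then y n else 0) else 0 := by
    funext l
    rw [Function.comp_apply, evalCLM_apply, single_apply]
    by_cases hl : l = n
    · subst hl; simp [Nat.pair_eq_pair]
    · simp [Nat.pair_eq_pair, hl, Ne.symm hl]
  rw [h3]
  exact hasSum_ite_eq n _

theorem ext_pair {x y : StdModule A} (h : ∀ m n, x (Nat.pair m n) = y (Nat.pair m n)) : x = y :=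
  ext fun p => by rw [← Nat.pair_unpair p]; exact h _ _

theorem block_mul_adj (m k : ℕ) :
    (block A m).toCLM * (block A k).adj = if m = k then 1 else 0 := by
  ext x n
  rw [mul_apply_eq_comp, block_apply, block_adj_apply]
  split_ifs
  · rfl
  · exact (zero_apply n).symm

/-- Placing a matrix in a block only relocates its entries, so it commutes with applying `ρ` or `δ`
to them. -/
theorem block_adj_mul_matrixUnit_mul (m k i j : ℕ) (a : A) :
    (block A m).adj * matrixUnit i j a * (block A k).toCLM =
      matrixUnit (Nat.pair m i) (Nat.pair k j) a := by
  refine ContinuousLinearMap.ext fun x => ext_pair fun p q => ?_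
  rw [mul_apply_eq_comp, mul_apply_eq_comp, block_adj_apply, matrixUnit_apply_apply,
    matrixUnit_apply_apply, block_apply]
  simp only [Nat.pair_eq_pair, ite_and]

/-- Operators on the standard module that agree on the sequences with one entry are equal. -/
theorem clm_ext_single {F : Type*} [NormedAddCommGroup F] [NormedSpace ℂ F]
    {S T : StdModule A →L[ℂ] F} (h : ∀ n a, S (single n a) = T (single n a)) : S = T := by
  refine ContinuousLinearMap.ext fun x => ?_
  have h1 := (hasSum_single x).map S S.continuous
  have h2 := (hasSum_single x).map T T.continuous
  refine h1.unique (h2.congr_fun fun n => ?_)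
  exact h n (x n)

theorem norm_pull_le (e : ℕ → ℕ) (he : Function.Injective e) : ‖pull (A := A) e he‖ ≤ 1 :=
  LinearMap.mkContinuous_norm_le _ zero_le_one _

theorem norm_block_le (m : ℕ) : ‖(block A m).toCLM‖ ≤ 1 :=
  norm_pull_le (Nat.pair m) fun _ _ h => (Nat.pair_eq_pair.1 h).2

theorem norm_block_adj_le (m : ℕ) : ‖(block A m).adj‖ ≤ 1 := by
  rw [← (IsAdjPair.of_adjointable (block A m)).norm_eq]
  exact norm_block_le m

end StdModule

namespace ClosedStarDerivation

variable {A B : Type*} [NonUnitalCStarAlgebra A] [PartialOrder A] [StarOrderedRing A]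
    [NonUnitalCStarAlgebra B] [PartialOrder B] [StarOrderedRing B]
    {ρ : A →⋆ₙₐ[ℂ] B} (D : ClosedStarDerivation ρ)

theorem block_mem_triples {t : (StdModule A →L[ℂ] StdModule A) ×
    (StdModule B →L[ℂ] StdModule B) × (StdModule B →L[ℂ] StdModule B)} (ht : t ∈ D.triples)
    (m k : ℕ) :
    ((StdModule.block A m).adj * t.1 * (StdModule.block A k).toCLM,
      (StdModule.block B m).adj * t.2.1 * (StdModule.block B k).toCLM,
      (StdModule.block B m).adj * t.2.2 * (StdModule.block B k).toCLM) ∈ D.triples := by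
  refine map_mem_closure (f := fun t : (StdModule A →L[ℂ] StdModule A) ×
    (StdModule B →L[ℂ] StdModule B) × (StdModule B →L[ℂ] StdModule B) =>
      ((StdModule.block A m).adj * t.1 * (StdModule.block A k).toCLM,
      (StdModule.block B m).adj * t.2.1 * (StdModule.block B k).toCLM,
      (StdModule.block B m).adj * t.2.2 * (StdModule.block B k).toCLM)) (by fun_prop) ht ?_
  rintro _ ⟨M, rfl⟩
  rw [SetLike.mem_coe]
  induction M using Finsupp.induction_linear with
  | zero =>
    simp only [map_zero, Prod.fst_zero, Prod.snd_zero, mul_zero, zero_mul]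
    exact zero_mem _
  | add M N hM hN =>
    convert add_mem hM hN using 1
    simp only [map_add, Prod.fst_add, Prod.snd_add, mul_add, add_mul, Prod.mk_add_mk]
  | single p a =>
    refine ⟨Finsupp.single (Nat.pair m p.1, Nat.pair k p.2) a, ?_⟩
    rw [tripleMap_single, tripleMap_single]
    simp only [StdModule.block_adj_mul_matrixUnit_mul]

end ClosedStarDerivation

/-! ### Powers in the algebra of triples -/

section Derivation

variable {R : Type*} [NormedRing R]

/-- The derivative of `(1 - P) ^ N` in the direction `-S`. -/
def powDeriv (P S : R) : ℕ → R
  | 0 => 0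
  | N + 1 => (1 - P) * powDeriv P S N - S * (1 - P) ^ N

/-- The identity operator need not belong to a triple. The power therefore occurs only as a factor
in front of `W`, with a recursion made of products and differences alone. -/
theorem one_sub_pow_succ_mul (P W : R) (N : ℕ) :
    (1 - P) ^ (N + 1) * W = (1 - P) ^ N * W - P * ((1 - P) ^ N * W) := by
  rw [pow_succ']
  noncomm_ring

/-- The derivative of the recursion `one_sub_pow_succ_mul`, where `S` and `d` are the derivatives of
`P` and `W`. -/
theorem powDeriv_succ_mul_add (P S W d : R) (N : ℕ) :
    powDeriv P S (N + 1) * W + (1 - P) ^ (N + 1) * d =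
      powDeriv P S N * W + (1 - P) ^ N * d -
        (S * ((1 - P) ^ N * W) + P * (powDeriv P S N * W + (1 - P) ^ N * d)) := by
  rw [powDeriv, pow_succ']
  noncomm_ring

theorem powDeriv_eq_sum (P S : R) (N : ℕ) : powDeriv P S N =
    -∑ i ∈ Finset.range N, (1 - P) ^ i * S * (1 - P) ^ (N - 1 - i) := by
  induction N with
  | zero => simp [powDeriv]
  | succ N ih =>
    rw [powDeriv, ih, Finset.sum_range_succ', pow_zero, one_mul, mul_neg, Finset.mul_sum,
      neg_add, ← sub_eq_add_neg]
    congr 1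
    congr 1
    refine Finset.sum_congr rfl fun i hi => ?_
    rw [pow_succ', show N + 1 - 1 - (i + 1) = N - 1 - i by omega]
    simp only [mul_assoc]

/-- In the Leibniz sum each term `(1 - P)ⁱ S (1 - P)ʲ`, with `i + j + 1 = N`, absorbs one factor
`P⁵` on either side and is at most `C² ‖S‖ / ((i + 1)(j + 1))⁵`. Since `N + 1 ≤ 2 (i + 1)(j + 1)`,
this costs `2⁵ = 32`, and summing `N` terms costs one power of `N + 1`. -/
theorem norm_mul_powDeriv_mul_le {P S : R} {C : ℝ}
    (hC : ∀ N : ℕ, ‖P ^ 5 * (1 - P) ^ N‖ ≤ C / (N + 1) ^ 5) (N : ℕ) :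
    ‖P ^ 5 * powDeriv P S N * P ^ 5‖ ≤ 32 * C ^ 2 * ‖S‖ / (N + 1) ^ 4 := by
  have hC0 : 0 ≤ C := by simpa using (norm_nonneg _).trans (hC 0)
  have hcomm (n : ℕ) : (1 - P) ^ n * P ^ 5 = P ^ 5 * (1 - P) ^ n :=
    (((Commute.one_left P).sub_left (Commute.refl P)).pow_pow n 5).eq
  have h1 (i : ℕ) (hi : i ∈ Finset.range N) :
      ‖P ^ 5 * ((1 - P) ^ i * S * (1 - P) ^ (N - 1 - i)) * P ^ 5‖
        ≤ 32 * C ^ 2 * ‖S‖ / (N + 1) ^ 5 := by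
    have hi' : i < N := Finset.mem_range.1 hi
    obtain ⟨j, rfl⟩ : ∃ j, N = i + j + 1 := ⟨N - 1 - i, by omega⟩
    rw [show i + j + 1 - 1 - i = j by omega]
    have e : P ^ 5 * ((1 - P) ^ i * S * (1 - P) ^ j) * P ^ 5 =
        (P ^ 5 * (1 - P) ^ i) * S * (P ^ 5 * (1 - P) ^ j) := by
      rw [← hcomm j]; simp only [mul_assoc]
    rw [e]
    calc _ ≤ (C / (i + 1) ^ 5) * ‖S‖ * (C / (j + 1) ^ 5) := by
          refine (norm_mul_le _ _).trans ?_
          refine mul_le_mul ((norm_mul_le _ _).trans ?_) (hC j) (norm_nonneg _) (by positivity)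
          exact mul_le_mul_of_nonneg_right (hC i) (norm_nonneg _)
      _ = C ^ 2 * ‖S‖ / (((i : ℝ) + 1) * (j + 1)) ^ 5 := by rw [mul_pow]; field_simp
      _ ≤ 32 * C ^ 2 * ‖S‖ / ((i + j + 1 : ℕ) + 1) ^ 5 := by
          rw [div_le_div_iff₀ (by positivity) (by positivity)]
          have h2 : (((i + j + 1 : ℕ) : ℝ) + 1) ≤ 2 * (((i : ℝ) + 1) * (j + 1)) := by
            push_cast
            have : (0 : ℝ) ≤ i * j := by positivity
            nlinarith
          have h3 := pow_le_pow_left₀ (by positivity) h2 5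
          rw [mul_pow] at h3
          calc _ ≤ C ^ 2 * ‖S‖ * (2 ^ 5 * (((i : ℝ) + 1) * (j + 1)) ^ 5) := by gcongr
            _ = _ := by ring
  rw [powDeriv_eq_sum, mul_neg, neg_mul, norm_neg, Finset.mul_sum, Finset.sum_mul]
  refine (norm_sum_le _ _).trans ((Finset.sum_le_sum h1).trans ?_)
  rw [Finset.sum_const, Finset.card_range, nsmul_eq_mul, ← mul_div_assoc,
    div_le_div_iff₀ (by positivity) (by positivity)]
  have h4 : (N : ℝ) ≤ N + 1 := by linarith
  calc (N : ℝ) * (32 * C ^ 2 * ‖S‖) * (N + 1) ^ 4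
      ≤ (N + 1) * (32 * C ^ 2 * ‖S‖) * (N + 1) ^ 4 := by gcongr
    _ = _ := by ring

theorem norm_pow_mul_pow_mul_le {P c : R} {C : ℝ}
    (hC : ∀ N : ℕ, ‖P ^ 5 * (1 - P) ^ N‖ ≤ C / (N + 1) ^ 5) (N : ℕ) :
    ‖P ^ 5 * ((1 - P) ^ N * P ^ 5) * c‖ ≤ C * ‖P ^ 5‖ * ‖c‖ / (N + 1) ^ 4 := by
  have hC0 : 0 ≤ C := by simpa using (norm_nonneg _).trans (hC 0)
  have hC' : ‖P ^ 5 * (1 - P) ^ N‖ ≤ C / (N + 1) ^ 4 := by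
    refine (hC N).trans ?_
    gcongr
    · linarith
    · norm_num
  rw [← mul_assoc]
  calc _ ≤ C / (N + 1) ^ 4 * ‖P ^ 5‖ * ‖c‖ :=
        (norm_mul_le _ _).trans (by gcongr; exact (norm_mul_le _ _).trans (by gcongr))
    _ = _ := by ring

/-- The element estimated is the derivative of `P⁵ (1 - P)ᴺ P⁵ c`, where `d` and `e` stand for the
derivatives of `P⁵` and `c`. If the middle power is not differentiated, one adjacent factor `P⁵`
gives the decay; otherwise `norm_mul_powDeriv_mul_le` does. -/
theorem norm_deriv_le {P S d c e : R} {C : ℝ}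
    (hC : ∀ N : ℕ, ‖P ^ 5 * (1 - P) ^ N‖ ≤ C / (N + 1) ^ 5) (N : ℕ) :
    ‖(d * ((1 - P) ^ N * P ^ 5) + P ^ 5 * (powDeriv P S N * P ^ 5 + (1 - P) ^ N * d)) * c
        + P ^ 5 * ((1 - P) ^ N * P ^ 5) * e‖
      ≤ ((‖d‖ * C + (32 * C ^ 2 * ‖S‖ + C * ‖d‖)) * ‖c‖ + C * ‖P ^ 5‖ * ‖e‖) / (N + 1) ^ 4 := by
  have hC0 : 0 ≤ C := by simpa using (norm_nonneg _).trans (hC 0)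
  have hcomm : (1 - P) ^ N * P ^ 5 = P ^ 5 * (1 - P) ^ N :=
    (((Commute.one_left P).sub_left (Commute.refl P)).pow_pow N 5).eq
  have hC' : ‖P ^ 5 * (1 - P) ^ N‖ ≤ C / (N + 1) ^ 4 := by
    refine (hC N).trans ?_
    gcongr
    · linarith
    · norm_num
  have h1 : ‖d * ((1 - P) ^ N * P ^ 5)‖ ≤ ‖d‖ * (C / (N + 1) ^ 4) := by
    rw [hcomm]
    exact (norm_mul_le _ _).trans (by gcongr)
  have h2 : ‖P ^ 5 * (powDeriv P S N * P ^ 5 + (1 - P) ^ N * d)‖ ≤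
      32 * C ^ 2 * ‖S‖ / (N + 1) ^ 4 + C / (N + 1) ^ 4 * ‖d‖ := by
    rw [mul_add, ← mul_assoc, ← mul_assoc]
    refine (norm_add_le _ _).trans (add_le_add (norm_mul_powDeriv_mul_le hC N) ?_)
    exact (norm_mul_le _ _).trans (by gcongr)
  have h3 := norm_pow_mul_pow_mul_le (c := e) hC N
  refine (norm_add_le _ _).trans ((add_le_add ((norm_mul_le _ _).trans
    (mul_le_mul_of_nonneg_right ((norm_add_le _ _).trans (add_le_add h1 h2)) (norm_nonneg c)))
    h3).trans (le_of_eq ?_))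
  ring

end Derivation

namespace ClosedStarDerivation

variable {A B : Type*} [NonUnitalCStarAlgebra A] [PartialOrder A] [StarOrderedRing A]
    [NonUnitalCStarAlgebra B] [PartialOrder B] [StarOrderedRing B]
    {ρ : A →⋆ₙₐ[ℂ] B} (D : ClosedStarDerivation ρ)

theorem mk_mul_mem_triples {T T' : StdModule A →L[ℂ] StdModule A}
    {R R' S S' : StdModule B →L[ℂ] StdModule B} (h : (T, R, S) ∈ D.triples)
    (h' : (T', R', S') ∈ D.triples) : (T * T', R * R', S * R' + R * S') ∈ D.triples := by
  have := D.mul_mem_triples h h'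
  simpa only using this

theorem mk_add_mem_triples {T T' : StdModule A →L[ℂ] StdModule A}
    {R R' S S' : StdModule B →L[ℂ] StdModule B} (h : (T, R, S) ∈ D.triples)
    (h' : (T', R', S') ∈ D.triples) : (T + T', R + R', S + S') ∈ D.triples := by
  have := add_mem h h'
  rwa [Prod.mk_add_mk, Prod.mk_add_mk] at this

theorem mk_sub_mem_triples {T T' : StdModule A →L[ℂ] StdModule A}
    {R R' S S' : StdModule B →L[ℂ] StdModule B} (h : (T, R, S) ∈ D.triples)
    (h' : (T', R', S') ∈ D.triples) : (T - T', R - R', S - S') ∈ D.triples := by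
  have := sub_mem h h'
  rwa [Prod.mk_sub_mk, Prod.mk_sub_mk] at this

theorem exists_triple_pow {G : StdModule A →L[ℂ] StdModule A} {P S : StdModule B →L[ℂ] StdModule B}
    (h : (G, P, S) ∈ D.triples) (k : ℕ) : ∃ d, (G ^ (k + 1), P ^ (k + 1), d) ∈ D.triples := by
  induction k with
  | zero => exact ⟨S, by rwa [zero_add, pow_one, pow_one]⟩
  | succ k ih =>
    obtain ⟨d, hd⟩ := ih
    refine ⟨d * P + P ^ (k + 1) * S, ?_⟩
    rw [pow_succ G, pow_succ P]
    exact D.mk_mul_mem_triples hd h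

theorem one_sub_pow_mem_triples {G W : StdModule A →L[ℂ] StdModule A}
    {P S Q d : StdModule B →L[ℂ] StdModule B} (h : (G, P, S) ∈ D.triples)
    (hd : (W, Q, d) ∈ D.triples) (N : ℕ) :
    ((1 - G) ^ N * W, (1 - P) ^ N * Q, powDeriv P S N * Q + (1 - P) ^ N * d) ∈ D.triples := by
  induction N with
  | zero =>
    rw [pow_zero, pow_zero, one_mul, one_mul, one_mul, powDeriv, zero_mul, zero_add]
    exact hd
  | succ N ih =>
    rw [one_sub_pow_succ_mul, one_sub_pow_succ_mul, powDeriv_succ_mul_add]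
    exact D.mk_sub_mem_triples ih (D.mk_mul_mem_triples h ih)

/-- The bounds for the derivative of `G⁵ (1 - G)ᴺ G⁵ G (2 - G)`. -/
theorem exists_triple_bound {G : StdModule A →L[ℂ] StdModule A}
    {P S : StdModule B →L[ℂ] StdModule B} (h : (G, P, S) ∈ D.triples) {C : ℝ}
    (hC : ∀ N : ℕ, ‖P ^ 5 * (1 - P) ^ N‖ ≤ C / (N + 1) ^ 5) :
    ∃ (U V : ℕ → StdModule B →L[ℂ] StdModule B) (c : ℝ), ∀ N : ℕ,
      (G ^ 5 * ((1 - G) ^ N * G ^ 5) * (G + G - G * G), U N, V N) ∈ D.triples ∧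
      ‖U N‖ ≤ c / (N + 1) ^ 4 ∧ ‖V N‖ ≤ c / (N + 1) ^ 4 := by
  have hC0 : 0 ≤ C := by simpa using (norm_nonneg _).trans (hC 0)
  -- Exponents are shifted by one, as powers start at `G`: the value `4` stands for `G⁵`.
  obtain ⟨d, hd⟩ := D.exists_triple_pow h 4
  obtain ⟨c, e, h2⟩ : ∃ c e, (G + G - G * G, c, e) ∈ D.triples :=
    ⟨_, _, D.mk_sub_mem_triples (D.mk_add_mem_triples h h) (D.mk_mul_mem_triples h h)⟩
  refine ⟨fun N => P ^ 5 * ((1 - P) ^ N * P ^ 5) * c, fun N =>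
    (d * ((1 - P) ^ N * P ^ 5) + P ^ 5 * (powDeriv P S N * P ^ 5 + (1 - P) ^ N * d)) * c
        + P ^ 5 * ((1 - P) ^ N * P ^ 5) * e, max (C * ‖P ^ 5‖ * ‖c‖)
      ((‖d‖ * C + (32 * C ^ 2 * ‖S‖ + C * ‖d‖)) * ‖c‖ + C * ‖P ^ 5‖ * ‖e‖), fun N =>
    ⟨?_, ?_, ?_⟩⟩
  · exact D.mk_mul_mem_triples (D.mk_mul_mem_triples hd (D.one_sub_pow_mem_triples h hd N)) h2
  · refine le_trans ?_ (div_le_div_of_nonneg_right (le_max_left _ _) (by positivity))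
    exact norm_pow_mul_pow_mul_le hC N
  · refine le_trans ?_ (div_le_div_of_nonneg_right (le_max_right _ _) (by positivity))
    exact norm_deriv_le hC N

end ClosedStarDerivation

end

noncomputable section

/-! ### The operators `Φ⋆ Φ` and `Φ Φ⋆` -/

section Gram

open HilbertCMod

variable {A E F : Type*} [NonUnitalCStarAlgebra A] [PartialOrder A] [StarOrderedRing A]
    [NormedAddCommGroup E] [NormedSpace ℂ E] [SMul Aᵐᵒᵖ E] [HilbertCMod A E]
    [NormedAddCommGroup F] [NormedSpace ℂ F] [SMul Aᵐᵒᵖ F] [HilbertCMod A F]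

namespace Adjointable

/-- The adjoint as an adjointable operator. -/
def flip (Φ : Adjointable A E F) : Adjointable A F E :=
  ⟨Φ.adj, Φ.toCLM, fun x y => Φ.inner_adj_left y x⟩

/-- The operator `Φ⋆ Φ`. -/
def gram (Φ : Adjointable A E F) : AdjOp A E :=
  ⟨Φ.adj ∘L Φ.toCLM, Φ.adj ∘L Φ.toCLM,
    (IsAdjPair.of_adjointable Φ).symm.comp (IsAdjPair.of_adjointable Φ)⟩

theorem gram_apply (Φ : Adjointable A E F) (x : E) : Φ.gram.1 x = Φ.adj (Φ.toCLM x) := rfl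

theorem isPosContraction_gram [CompleteSpace E] {Φ : Adjointable A E F} (h : ‖Φ.toCLM‖ ≤ 1) :
    AdjOp.IsPosContraction Φ.gram where
  isSelfAdjoint := AdjOp.isSelfAdjoint_iff.2
    ((IsAdjPair.of_adjointable Φ).symm.comp (IsAdjPair.of_adjointable Φ))
  nonneg x := by
    rw [gram_apply, ← Φ.inner_adj]
    exact HilbertCMod.inner_self_nonneg _
  norm_le := by
    refine (ContinuousLinearMap.opNorm_comp_le _ _).trans ?_
    rw [← (IsAdjPair.of_adjointable Φ).norm_eq]
    exact mul_le_one₀ h (norm_nonneg _) h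

/-- `Φ S = S' Φ`. -/
def Intertwines (Φ : Adjointable A E F) (S : AdjOp A E) (S' : AdjOp A F) : Prop :=
  ∀ x, Φ.toCLM (S.1 x) = S'.1 (Φ.toCLM x)

namespace Intertwines

variable {Φ : Adjointable A E F} {S T : AdjOp A E} {S' T' : AdjOp A F}

theorem one : Φ.Intertwines 1 1 := fun _ => rfl

theorem mul (h : Φ.Intertwines S S') (k : Φ.Intertwines T T') : Φ.Intertwines (S * T) (S' * T') :=
  fun x => (h (T.1 x)).trans (congrArg S'.1 (k x))

theorem add (h : Φ.Intertwines S S') (k : Φ.Intertwines T T') : Φ.Intertwines (S + T) (S' + T') :=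
  fun x => (map_add Φ.toCLM _ _).trans (congrArg₂ (· + ·) (h x) (k x))

theorem sub (h : Φ.Intertwines S S') (k : Φ.Intertwines T T') : Φ.Intertwines (S - T) (S' - T') :=
  fun x => (map_sub Φ.toCLM _ _).trans (congrArg₂ (· - ·) (h x) (k x))

theorem pow (h : Φ.Intertwines S S') (n : ℕ) : Φ.Intertwines (S ^ n) (S' ^ n) := by
  induction n with
  | zero => rw [pow_zero, pow_zero]; exact one
  | succ n ih => rw [pow_succ, pow_succ]; exact ih.mul h

/-- Polynomials in `Φ⋆ Φ` on the left of `X` become polynomials in the matrix `Φ Φ⋆`, the operator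
to which `δ` applies. -/
theorem gram (Φ : Adjointable A E F) : Φ.Intertwines Φ.gram Φ.flip.gram := fun _ => rfl

end Intertwines

variable [CompleteSpace E] [CompleteSpace F] {Φ : Adjointable A E F}

/-- With `T = Φ⋆ Φ` and `G = Φ Φ⋆`, on the range of `Φ⋆` one has `‖(1 - T)ᴺ Φ⋆ x‖² = ‖⟪x, G (1 -
G)²ᴺ x⟫‖`, which is `O(1 / N)` by the spectral estimate. Density and `‖(1 - T)ᴺ‖ ≤ 1` give all other
vectors. -/
theorem tendsto_one_sub_gram_pow (h : ‖Φ.toCLM‖ ≤ 1) (hd : DenseRange Φ.adj) (η : E) :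
    Tendsto (fun N : ℕ => ((1 - Φ.gram) ^ N).1 η) atTop (𝓝 0) := by
  have hT := isPosContraction_gram h
  have hG : AdjOp.IsPosContraction Φ.flip.gram := isPosContraction_gram (by
    change ‖Φ.adj‖ ≤ 1
    rwa [← (IsAdjPair.of_adjointable Φ).norm_eq])
  have hsa (N : ℕ) : IsSelfAdjoint ((1 - Φ.gram) ^ N) :=
    ((IsSelfAdjoint.one _).sub hT.isSelfAdjoint).pow N
  have h1 (x : F) (N : ℕ) : ‖((1 - Φ.gram) ^ N).1 (Φ.adj x)‖ ^ 2 ≤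
      ‖x‖ * (Real.exp 1 * Nat.factorial 1 / ((N + N : ℕ) + 1) ^ 1 * ‖x‖) := by
    have h2 : (inner A (((1 - Φ.gram) ^ N).1 (Φ.adj x)) (((1 - Φ.gram) ^ N).1 (Φ.adj x)) : A) =
        inner A x ((Φ.flip.gram ^ 1 * (1 - Φ.flip.gram) ^ (N + N)).1 x) := by
      rw [(AdjOp.isSelfAdjoint_iff.1 (hsa N)) (Φ.adj x), Φ.inner_adj_left]
      congr 1
      have h3 := (Intertwines.one.sub (Intertwines.gram Φ)).pow (N + N) (Φ.adj x)
      have h4 : Φ.flip.gram ^ 1 * (1 - Φ.flip.gram) ^ (N + N) =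
          (1 - Φ.flip.gram) ^ (N + N) * Φ.flip.gram := by
        rw [pow_one]
        exact (((Commute.one_left _).sub_left (Commute.refl _)).pow_left _).symm.eq
      rw [h4]
      rw [pow_add (1 - Φ.gram)] at h3
      exact h3
    rw [norm_sq_eq (A := A), h2]
    refine (norm_inner_le _ _).trans (mul_le_mul_of_nonneg_left ?_ (norm_nonneg _))
    exact (ContinuousLinearMap.le_opNorm _ _).trans
      (mul_le_mul_of_nonneg_right (hG.norm_pow_mul_le 1 (N + N)) (norm_nonneg _))
  have h2 (x : F) : Tendsto (fun N : ℕ => ((1 - Φ.gram) ^ N).1 (Φ.adj x)) atTop (𝓝 0) := by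
    have h3 : Tendsto (fun N : ℕ => ‖x‖ * (Real.exp 1 * ‖x‖) * (1 / ((N : ℝ) + 1))) atTop
        (𝓝 (‖x‖ * (Real.exp 1 * ‖x‖) * 0)) := tendsto_one_div_add_atTop_nhds_zero_nat.const_mul _
    rw [mul_zero] at h3
    have h4 : Tendsto (fun N : ℕ => ‖((1 - Φ.gram) ^ N).1 (Φ.adj x)‖ ^ 2) atTop (𝓝 0) := by
      refine squeeze_zero (fun _ => by positivity) (fun N => (h1 x N).trans ?_) h3
      rw [Nat.factorial_one, Nat.cast_one, mul_one, pow_one]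
      calc _ = ‖x‖ * (Real.exp 1 * ‖x‖) * (1 / (((N + N : ℕ) : ℝ) + 1)) := by ring
        _ ≤ _ := by gcongr; linarith
    have h5 := (Real.continuous_sqrt.tendsto _).comp h4
    rw [Real.sqrt_zero] at h5
    refine tendsto_zero_iff_norm_tendsto_zero.2 (h5.congr fun N => ?_)
    exact Real.sqrt_sq (norm_nonneg _)
  rw [Metric.tendsto_atTop]
  intro ε hε
  obtain ⟨x, hx⟩ := hd.exists_dist_lt η (half_pos hε)
  obtain ⟨N₀, hN₀⟩ := Metric.tendsto_atTop.1 (h2 x) (ε / 2) (half_pos hε)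
  refine ⟨N₀, fun N hN => ?_⟩
  have h3 := hN₀ N hN
  rw [dist_zero_right] at h3 ⊢
  have h4 : ((1 - Φ.gram) ^ N).1 η =
      ((1 - Φ.gram) ^ N).1 (η - Φ.adj x) + ((1 - Φ.gram) ^ N).1 (Φ.adj x) := by
    rw [map_sub, sub_add_cancel]
  have h5 : ‖((1 - Φ.gram) ^ N).1 (η - Φ.adj x)‖ ≤ 1 * ‖η - Φ.adj x‖ :=
    ContinuousLinearMap.le_of_opNorm_le _ (hT.norm_one_sub_pow_le N) _
  rw [dist_eq_norm] at hx
  rw [h4]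
  have := norm_add_le (((1 - Φ.gram) ^ N).1 (η - Φ.adj x)) (((1 - Φ.gram) ^ N).1 (Φ.adj x))
  linarith

/-- The geometric sum shows that `η - (1 - T)ᴺ η` lies in the range of `T = Φ⋆ Φ`, and it converges
to `η`. -/
theorem denseRange_gram_pow (h : ‖Φ.toCLM‖ ≤ 1) (hd : DenseRange Φ.adj) (n : ℕ) :
    DenseRange ((Φ.gram ^ n).1) := by
  have h1 : DenseRange (Φ.gram.1) := fun η => by
    have h2 : Tendsto (fun N : ℕ => η - ((1 - Φ.gram) ^ N).1 η) atTop (𝓝 η) := by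
      simpa using (tendsto_one_sub_gram_pow h hd η).const_sub η
    refine mem_closure_of_tendsto h2 (Eventually.of_forall fun N => ?_)
    have h3 := mul_neg_geom_sum (1 - Φ.gram) N
    rw [sub_sub_cancel] at h3
    refine ⟨(∑ i ∈ Finset.range N, (1 - Φ.gram) ^ i).1 η, ?_⟩
    exact congrArg (fun S : AdjOp A E => S.1 η) h3
  induction n with
  | zero =>
    rw [pow_zero]
    exact Function.surjective_id.denseRange
  | succ n ih =>
    rw [pow_succ]
    exact ih.comp h1 (ContinuousLinearMap.continuous _)

end Adjointable

theorem rankOne_apply (x : F) (y z : E) : rankOne A x y z = x <• (inner A y z : A) := rfl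

end Gram

end

noncomputable section

/-! ### The isometry into the standard module -/

namespace Adjointable

open HilbertCMod

variable {A X : Type*} [NonUnitalCStarAlgebra A] [PartialOrder A] [StarOrderedRing A]
    [NormedAddCommGroup X] [NormedSpace ℂ X] [SMul Aᵐᵒᵖ X] [HilbertCMod A X] [CompleteSpace X]
    (Φ : Adjointable A X (StdModule A)) (R : AdjOp A X)

/-- The operators `(1 - T)ᵐ R` for `T = Φ⋆ Φ`. -/
def coef (m : ℕ) : AdjOp A X := (1 - Φ.gram) ^ m * R

/-- The sum of the first `M` blocks of the isometry. -/
def partialIsom (M : ℕ) : X →L[ℂ] StdModule A :=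
  ∑ m ∈ Finset.range M, (StdModule.block A m).adj ∘L Φ.toCLM ∘L (Φ.coef R m).1

/-- The adjoint of `partialIsom`. -/
def partialIsomAdj (M : ℕ) : StdModule A →L[ℂ] X :=
  ∑ m ∈ Finset.range M, ((star (Φ.coef R m)).1 ∘L Φ.adj) ∘L (StdModule.block A m).toCLM

theorem isAdjPair_partialIsom (M : ℕ) :
    IsAdjPair A (Φ.partialIsom R M) (Φ.partialIsomAdj R M) :=
  IsAdjPair.sum _ fun m _ => (IsAdjPair.of_adjointable (StdModule.block A m)).symm.comp
    ((IsAdjPair.of_adjointable Φ).comp (Φ.coef R m).isAdjPair)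

theorem partialIsom_apply (M : ℕ) (η : X) : Φ.partialIsom R M η =
    ∑ m ∈ Finset.range M, (StdModule.block A m).adj (Φ.toCLM ((Φ.coef R m).1 η)) := by
  rw [partialIsom, _root_.sum_apply]
  rfl

theorem partialIsomAdj_apply (M : ℕ) (x : StdModule A) : Φ.partialIsomAdj R M x =
    ∑ m ∈ Finset.range M, (star (Φ.coef R m)).1 (Φ.adj ((StdModule.block A m).toCLM x)) := by
  rw [partialIsomAdj, _root_.sum_apply]
  rfl

theorem partialIsom_apply_pair (M : ℕ) (η : X) (m n : ℕ) (hm : m < M) :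
    Φ.partialIsom R M η (Nat.pair m n) = Φ.toCLM ((Φ.coef R m).1 η) n := by
  rw [partialIsom_apply, StdModule.sum_apply]
  simp only [StdModule.block_adj_apply]
  rw [Finset.sum_ite_eq, if_pos (Finset.mem_range.2 hm)]

variable {R} (hR : IsSelfAdjoint R) (hRR : R * R = 2 - Φ.gram) (hRc : Commute R Φ.gram)

theorem isSelfAdjoint_gram : IsSelfAdjoint Φ.gram := AdjOp.isSelfAdjoint_iff.2
    ((IsAdjPair.of_adjointable Φ).symm.comp (IsAdjPair.of_adjointable Φ))

include hR in
theorem star_coef (m : ℕ) : star (Φ.coef R m) = R * (1 - Φ.gram) ^ m := by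
  rw [coef, star_mul, hR.star_eq,
    (((IsSelfAdjoint.one _).sub Φ.isSelfAdjoint_gram).pow m).star_eq]

include hR hRR hRc in
-- As `R` commutes with `T = Φ⋆ Φ` and `R² = 2 - T`, each term is `(2 - T) T (1 - T)²ᵐ = (1 - (1 -
-- T)²) (1 - T)²ᵐ`, and the sum telescopes.
theorem sum_star_coef_mul (M : ℕ) :
    ∑ m ∈ Finset.range M, star (Φ.coef R m) * (Φ.gram * Φ.coef R m) =
      1 - (1 - Φ.gram) ^ (2 * M) := by
  have hT : Commute (1 - Φ.gram) Φ.gram := (Commute.one_left _).sub_left (Commute.refl _)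
  have hRT : Commute R (1 - Φ.gram) := (Commute.one_right R).sub_right hRc
  have h1 (m : ℕ) : star (Φ.coef R m) * (Φ.gram * Φ.coef R m) =
      (1 - (1 - Φ.gram) ^ 2) * ((1 - Φ.gram) ^ 2) ^ m := by
    have h2 : Φ.gram * ((1 - Φ.gram) ^ m * R) = R * (Φ.gram * (1 - Φ.gram) ^ m) := by
      rw [← mul_assoc, ((hRc.mul_right (hRT.pow_right m))).eq]
    have h3 : (1 - Φ.gram) ^ m * (R * (Φ.gram * (1 - Φ.gram) ^ m)) =
        R * ((Φ.gram * (1 - Φ.gram) ^ m) * (1 - Φ.gram) ^ m) := by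
      rw [← mul_assoc, ← (hRT.pow_right m).eq, mul_assoc]
      congr 1
      rw [← mul_assoc, (hT.pow_left m).eq]
    rw [Φ.star_coef hR, coef, h2, mul_assoc, h3, ← mul_assoc, hRR, mul_assoc, ← pow_add, ← pow_mul,
      two_mul, ← mul_assoc]
    congr 1
    rw [sq]
    noncomm_ring
  rw [Finset.sum_congr rfl fun m _ => h1 m, ← Finset.mul_sum, mul_neg_geom_sum, pow_mul]

include hR hRR hRc in
-- Distinct blocks are orthogonal, so only the blocks common to both sums contribute.
theorem inner_partialIsom (M L : ℕ) (η η' : X) :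
    (inner A (Φ.partialIsom R M η) (Φ.partialIsom R L η') : A) =
      inner A η ((1 - (1 - Φ.gram) ^ (2 * min M L) : AdjOp A X).1 η') := by
  rw [partialIsom_apply, partialIsom_apply, HilbertCMod.inner_sum_left]
  simp only [HilbertCMod.inner_sum_right]
  have h1 (m l : ℕ) : (inner A ((StdModule.block A m).adj (Φ.toCLM ((Φ.coef R m).1 η)))
      ((StdModule.block A l).adj (Φ.toCLM ((Φ.coef R l).1 η'))) : A) =
      if m = l then inner A η ((star (Φ.coef R m) * (Φ.gram * Φ.coef R m)).1 η') else 0 := by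
    rw [inner_adj_left]
    have h2 := DFunLike.congr_fun (StdModule.block_mul_adj (A := A) m l)
      (Φ.toCLM ((Φ.coef R l).1 η'))
    rw [mul_apply_eq_comp] at h2
    rw [h2]
    split_ifs with h
    · subst h
      change inner A (Φ.toCLM ((Φ.coef R m).1 η)) (Φ.toCLM ((Φ.coef R m).1 η')) = _
      rw [Φ.inner_adj, (Φ.coef R m).isAdjPair]
      rfl
    · exact HilbertCMod.inner_zero_right _
  simp only [h1, Finset.sum_ite_eq]
  rw [← Finset.sum_filter, ← Φ.sum_star_coef_mul hR hRR hRc]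
  have h3 : (Finset.range M).filter (· ∈ Finset.range L) = Finset.range (min M L) := by
    ext m; simp
  rw [h3, ← HilbertCMod.inner_sum_right]
  congr 1
  rw [AddSubmonoidClass.coe_finsetSum, _root_.sum_apply]

include hR hRR hRc in
/-- The isometry of a positive contraction with a dense image. -/
theorem exists_isom (h : ‖Φ.toCLM‖ ≤ 1) (hd : DenseRange Φ.adj) :
    ∃ W : X →L[ℂ] StdModule A, (∀ η, Tendsto (fun M => Φ.partialIsom R M η) atTop (𝓝 (W η))) ∧
      (∀ η η', (inner A (W η) (W η') : A) = inner A η η') ∧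
      ∀ η M, ‖W η - Φ.partialIsom R M η‖ ^ 2 =
        ‖(inner A η (((1 - Φ.gram) ^ (2 * M)).1 η) : A)‖ := by
  have h1 := tendsto_one_sub_gram_pow h hd
  have h2 (η : X) : Tendsto (fun M : ℕ => ((1 - Φ.gram) ^ (2 * M)).1 η) atTop (𝓝 0) :=
    (h1 η).comp (tendsto_id.const_mul_atTop' two_pos)
  have hinner := Φ.inner_partialIsom hR hRR hRc
  -- The defect of isometry of a partial sum is `(1 - T)²ᴸ` with `T = Φ⋆ Φ`, so differences of
  -- partial sums are controlled by a strongly convergent sequence.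
  have h3 (η : X) {L M : ℕ} (hLM : L ≤ M) :
      (inner A (Φ.partialIsom R M η - Φ.partialIsom R L η)
        (Φ.partialIsom R M η - Φ.partialIsom R L η) : A) =
      inner A η (((1 - Φ.gram) ^ (2 * L)).1 η) - inner A η (((1 - Φ.gram) ^ (2 * M)).1 η) := by
    have e (n : ℕ) : (1 - (1 - Φ.gram) ^ (2 * n) : AdjOp A X).1 η =
      η - ((1 - Φ.gram) ^ (2 * n)).1 η := rfl
    simp only [HilbertCMod.inner_sub_left, HilbertCMod.inner_sub_right, hinner, min_self,
      min_eq_left hLM, min_eq_right hLM, e]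
    abel
  have h4 (η : X) : CauchySeq fun M => Φ.partialIsom R M η := by
    have h5 := (continuous_inner_right (A := A) η).tendsto 0 |>.comp (h2 η)
    rw [Metric.cauchySeq_iff']
    intro ε hε
    obtain ⟨N, hN⟩ := Metric.cauchySeq_iff'.1 h5.cauchySeq (ε ^ 2) (by positivity)
    refine ⟨N, fun n hn => ?_⟩
    have h6 := hN n hn
    rw [dist_comm, dist_eq_norm] at h6
    rw [dist_eq_norm]
    refine lt_of_pow_lt_pow_left₀ 2 hε.le ?_
    rw [norm_sq_eq (A := A), h3 η hn]
    exact h6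
  choose w hw using fun η => cauchySeq_tendsto_of_complete (h4 η)
  have hw' : Tendsto (fun M η => Φ.partialIsom R M η) atTop (𝓝 w) := tendsto_pi_nhds.2 hw
  -- Boundedness of the pointwise limit is the Banach–Steinhaus theorem.
  refine ⟨continuousLinearMapOfTendsto (Φ.partialIsom R) hw', hw, fun η η' => ?_, fun η M => ?_⟩
  · have h5 := tendsto_inner (A := A) (hw η) (hw η')
    refine tendsto_nhds_unique h5 ?_
    have h6 : Tendsto (fun M : ℕ => (inner A η (η' - ((1 - Φ.gram) ^ (2 * M)).1 η') : A)) atTop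
        (𝓝 (inner A η (η' - 0))) :=
      tendsto_inner tendsto_const_nhds (tendsto_const_nhds.sub (h2 η'))
    rw [sub_zero] at h6
    refine h6.congr fun M => ?_
    rw [hinner, min_self]
    rfl
  · have h5 : Tendsto (fun L => ‖Φ.partialIsom R L η - Φ.partialIsom R M η‖ ^ 2) atTop
        (𝓝 (‖w η - Φ.partialIsom R M η‖ ^ 2)) := ((hw η).sub_const _).norm.pow 2
    refine tendsto_nhds_unique h5 ?_
    have h6 : Tendsto (fun L : ℕ => ‖(inner A η (((1 - Φ.gram) ^ (2 * M)).1 η) -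
        inner A η (((1 - Φ.gram) ^ (2 * L)).1 η) : A)‖) atTop
        (𝓝 ‖(inner A η (((1 - Φ.gram) ^ (2 * M)).1 η) - inner A η 0 : A)‖) :=
      (tendsto_const_nhds.sub (tendsto_inner tendsto_const_nhds (h2 η))).norm
    rw [HilbertCMod.inner_zero_right, sub_zero] at h6
    refine h6.congr' ((eventually_ge_atTop M).mono fun L hL => ?_)
    rw [← h3 η hL]
    exact (norm_sq_eq (A := A) _).symm

end Adjointable

end

noncomputable section

/-! ### The analysis operator of a summable sequence -/

/-- A double array is dominated by a product: if `s i` is the sum over the square of indices up to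
`i`, then `n i j ≤ s (max i j) ≤ (1 + s i)(1 + s j)`. So `c i = 2⁻ⁱ⁻¹ / (1 + s i)` works. -/
theorem exists_scaling (n : ℕ → ℕ → ℝ) (hn : ∀ i j, 0 ≤ n i j) : ∃ c : ℕ → ℝ, (∀ i, 0 < c i) ∧
    ∀ i j, c i * c j * n i j ≤ (1 : ℝ) / 2 / 2 ^ i * ((1 : ℝ) / 2 / 2 ^ j) := by
  set s : ℕ → ℝ := fun i => ∑ k ∈ Finset.range (i + 1), ∑ l ∈ Finset.range (i + 1), n k l with hs
  have hs0 (i : ℕ) : 0 ≤ s i :=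
    Finset.sum_nonneg fun k _ => Finset.sum_nonneg fun l _ => hn k l
  have hle (m i j : ℕ) (hi : i ≤ m) (hj : j ≤ m) : n i j ≤ s m :=
    (Finset.single_le_sum (f := fun l => n i l) (fun l _ => hn i l)
      (Finset.mem_range.2 (Nat.lt_succ_of_le hj))).trans
    (Finset.single_le_sum (f := fun k => ∑ l ∈ Finset.range (m + 1), n k l)
      (fun k _ => Finset.sum_nonneg fun l _ => hn k l) (Finset.mem_range.2 (Nat.lt_succ_of_le hi)))
  have h1 (i j : ℕ) : n i j ≤ (1 + s i) * (1 + s j) := by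
    rcases le_total i j with h | h
    · nlinarith [hle j i j h le_rfl, hs0 i, hs0 j, mul_nonneg (hs0 i) (hs0 j)]
    · nlinarith [hle i i j le_rfl h, hs0 i, hs0 j, mul_nonneg (hs0 i) (hs0 j)]
  have hp (i : ℕ) : 0 < 1 + s i := by linarith [hs0 i]
  refine ⟨fun i => (1 : ℝ) / 2 / 2 ^ i / (1 + s i), fun i => div_pos (by positivity) (hp i),
    fun i j => ?_⟩
  calc (1 : ℝ) / 2 / 2 ^ i / (1 + s i) * ((1 : ℝ) / 2 / 2 ^ j / (1 + s j)) * n i j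
      = (1 : ℝ) / 2 / 2 ^ i * ((1 : ℝ) / 2 / 2 ^ j) * (n i j / ((1 + s i) * (1 + s j))) := by
        have := (hp i).ne'
        have := (hp j).ne'
        field_simp
    _ ≤ (1 : ℝ) / 2 / 2 ^ i * ((1 : ℝ) / 2 / 2 ^ j) * 1 := by
        gcongr
        exact (div_le_one (mul_pos (hp i) (hp j))).2 (h1 i j)
    _ = _ := mul_one _

/-- That the total is exactly `1` makes the Gram matrix and its image under `ρ` contractions. -/
theorem hasSum_geometric_mul :
    HasSum (fun p : ℕ × ℕ => (1 : ℝ) / 2 / 2 ^ p.1 * ((1 : ℝ) / 2 / 2 ^ p.2)) 1 := by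
  have h := hasSum_geometric_two' 1
  have h1 := h.mul h (h.summable.mul_of_nonneg h.summable (fun _ => by positivity)
    (fun _ => by positivity))
  rwa [one_mul] at h1

theorem HasSum.tendsto_sum_range_range {G : Type*} [AddCommMonoid G] [TopologicalSpace G]
    {f : ℕ × ℕ → G} {a : G} (h : HasSum f a) :
    Tendsto (fun N => ∑ i ∈ Finset.range N, ∑ j ∈ Finset.range N, f (i, j)) atTop (𝓝 a) := by
  have h1 : Tendsto (fun N : ℕ => Finset.range N ×ˢ Finset.range N) atTop atTop := by
    refine tendsto_atTop_finset_of_monotone (fun M N h => Finset.product_subset_product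
      (Finset.range_mono h) (Finset.range_mono h)) fun p => ⟨max p.1 p.2 + 1, ?_⟩
    simp only [Finset.mem_product, Finset.mem_range]
    omega
  refine (Tendsto.comp h h1).congr fun N => ?_
  exact Finset.sum_product _ _ _

namespace Adjointable

open HilbertCMod

variable {A X : Type*} [NonUnitalCStarAlgebra A] [PartialOrder A] [StarOrderedRing A]
    [NormedAddCommGroup X] [NormedSpace ℂ X] [SMul Aᵐᵒᵖ X] [HilbertCMod A X] [CompleteSpace X]
    (ξ : ℕ → X)

theorem norm_single_comp_inner_le (n : ℕ) :
    ‖StdModule.singleCLM A n ∘L innerCLM A (ξ n)‖ ≤ ‖ξ n‖ := by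
  refine ContinuousLinearMap.opNorm_le_bound _ (norm_nonneg _) fun y => ?_
  rw [ContinuousLinearMap.comp_apply, StdModule.singleCLM_apply, StdModule.norm_single]
  exact norm_inner_le _ _

variable {ξ} (hξ : Summable fun n => ‖ξ n‖)

include hξ in
theorem summable_single_comp_inner :
    Summable fun n => StdModule.singleCLM A n ∘L innerCLM A (ξ n) :=
  hξ.of_norm_bounded (norm_single_comp_inner_le ξ)

include hξ in
theorem tsum_single_comp_inner_apply (η : X) (n : ℕ) :
    (∑' n, StdModule.singleCLM A n ∘L innerCLM A (ξ n)) η n = (inner A (ξ n) η : A) := by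
  have h1 := (summable_single_comp_inner (A := A) hξ).hasSum.map
    (StdModule.evalCLM A n ∘L ContinuousLinearMap.apply ℂ _ η)
    (ContinuousLinearMap.continuous _)
  refine h1.unique ((hasSum_ite_eq n (inner A (ξ n) η : A)).congr_fun fun k => ?_)
  change StdModule.single k (inner A (ξ k) η : A) n = _
  rw [StdModule.single_apply]
  by_cases h : n = k
  · subst h; simp
  · rw [if_neg h, if_neg (Ne.symm h)]

/-- The operator `η ↦ (⟪ξₙ, η⟫)ₙ`. -/
def analysis : Adjointable A X (StdModule A) :=
  ofCoords (∑' n, StdModule.singleCLM A n ∘L innerCLM A (ξ n))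
    (fun n => (opSMulCLM (ξ n)).toLinearMap) fun n a z => by
      rw [tsum_single_comp_inner_apply hξ]
      exact HilbertCMod.inner_smul_left _ _ _

theorem analysis_apply (η : X) (n : ℕ) : (analysis hξ).toCLM η n = (inner A (ξ n) η : A) :=
  tsum_single_comp_inner_apply hξ η n

theorem hasSum_analysis : HasSum (fun n => StdModule.singleCLM A n ∘L innerCLM A (ξ n))
    (analysis (A := A) hξ).toCLM := (summable_single_comp_inner hξ).hasSum

theorem analysis_adj_single (n : ℕ) (a : A) :
    (analysis hξ).adj (StdModule.single n a) = ξ n <• a :=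
  ext_inner (A := A) fun z => by
    rw [← inner_adj, StdModule.inner_single_right, analysis_apply, star_inner,
      HilbertCMod.inner_smul_right]

theorem norm_analysis_le {c : ℝ} (h : HasSum (fun n => ‖ξ n‖) c) :
    ‖(analysis (A := A) h.summable).toCLM‖ ≤ c :=
  tsum_of_norm_bounded h (norm_single_comp_inner_le ξ)

theorem denseRange_analysis_adj
    (h : Dense (Submodule.span ℂ {x : X | ∃ (n : ℕ) (a : A), x = ξ n <• a} : Set X)) :
    DenseRange (analysis (A := A) hξ).adj := by
  refine h.mono ?_
  have h1 : Submodule.span ℂ {x : X | ∃ (n : ℕ) (a : A), x = ξ n <• a} ≤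
      LinearMap.range (analysis (A := A) hξ).adj.toLinearMap := by
    refine Submodule.span_le.2 ?_
    rintro _ ⟨n, a, rfl⟩
    exact ⟨StdModule.single n a, analysis_adj_single hξ n a⟩
  exact h1

/-- This identifies `Φ Φ⋆` with the matrix of inner products of the generators. -/
theorem analysis_comp_adj_single (j : ℕ) (a : A) (i : ℕ) :
    (analysis hξ).flip.gram.1 (StdModule.single j a) i = (inner A (ξ i) (ξ j) : A) * a := by
  change (analysis hξ).toCLM ((analysis hξ).adj (StdModule.single j a)) i = _
  rw [analysis_adj_single, analysis_apply, HilbertCMod.inner_smul_right]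

/-- The operator is the sum of `z ↦ ξₙ ⟪ξₙ, z⟫`, convergent in norm because the series for
`analysis` is. -/
theorem gram_analysis_mem_compactOperators :
    (analysis (A := A) hξ).gram.1 ∈ compactOperators A X X := by
  have h1 := (hasSum_analysis (A := A) hξ).map
    (ContinuousLinearMap.compL ℂ X (StdModule A) X (analysis (A := A) hξ).adj)
    (ContinuousLinearMap.continuous _)
  refine (Submodule.isClosed_topologicalClosure _).mem_of_tendsto h1 (Eventually.of_forall
    fun s => Submodule.sum_mem _ fun n _ => Submodule.le_topologicalClosure _
      (Submodule.subset_span ⟨ξ n, ξ n, ?_⟩))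
  refine ContinuousLinearMap.ext fun z => ?_
  exact analysis_adj_single hξ n _

end Adjointable

/-! ### The Gram matrix as a differentiable compact operator -/

theorem hasSum_matrixUnit_single_apply {A : Type*} [NonUnitalCStarAlgebra A] [PartialOrder A]
    [StarOrderedRing A] {f : ℕ × ℕ → A} {T : StdModule A →L[ℂ] StdModule A}
    (h : HasSum (fun p : ℕ × ℕ => matrixUnit p.1 p.2 (f p)) T) (j : ℕ) (a : A) (i : ℕ) :
    T (StdModule.single j a) i = f (i, j) * a := by
  have h1 := h.map (StdModule.evalCLM A i ∘L ContinuousLinearMap.apply ℂ _ (StdModule.single j a))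
    (ContinuousLinearMap.continuous _)
  refine h1.unique ((hasSum_ite_eq (i, j) (f (i, j) * a)).congr_fun fun p => ?_)
  change matrixUnit p.1 p.2 (f p) (StdModule.single j a) i = _
  rw [matrixUnit_apply_apply, StdModule.single_apply]
  obtain ⟨k, l⟩ := p
  by_cases hk : i = k
  · by_cases hl : l = j
    · subst hk hl; simp
    · simp [hl]
  · simp [hk, Ne.symm hk]

/-! ### Positivity of the image of a Gram matrix. -/

section GramPositive

variable {A B X : Type*} [NonUnitalCStarAlgebra A] [PartialOrder A] [StarOrderedRing A]
    [NonUnitalCStarAlgebra B] [PartialOrder B] [StarOrderedRing B]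
    [NormedAddCommGroup X] [NormedSpace ℂ X] [SMul Aᵐᵒᵖ X] [HilbertCMod A X]

/-- The image of a Gram matrix under a ⋆-homomorphism is a positive operator. -/
theorem exists_isPosContraction_gram (φ : A →⋆ₙₐ[ℂ] B) (ξ : ℕ → X)
    {P : StdModule B →L[ℂ] StdModule B} (hP : ‖P‖ ≤ 1)
    (h : HasSum (fun p : ℕ × ℕ => matrixUnit p.1 p.2 (φ (inner A (ξ p.1) (ξ p.2)))) P) :
    ∃ P' : AdjOp B (StdModule B), P'.1 = P ∧ P'.IsPosContraction := by
  have h1 := h.tendsto_sum_range_range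
  have h2 (x : StdModule B) := ((ContinuousLinearMap.apply ℂ (StdModule B) x).continuous.tendsto
    _).comp h1
  have h3 : IsAdjPair B P P := by
    refine IsAdjPair.tendsto (fun N => ?_) h2 h2
    have h4 := IsAdjPair.sum (Finset.range N) fun i _ => IsAdjPair.sum (Finset.range N) fun j _ =>
      isAdjPair_matrixUnit i j (φ (inner A (ξ i) (ξ j)))
    simp only [← map_star, HilbertCMod.star_inner] at h4
    -- Taking adjoints interchanges the two indices, so a square partial sum is its own adjoint.
    exact Eq.subst (motive := IsAdjPair B _) Finset.sum_comm h4
  refine ⟨⟨P, P, h3⟩, rfl, AdjOp.isSelfAdjoint_iff.2 h3, fun x => ?_, hP⟩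
  have h5 := ((HilbertCMod.continuous_inner_right (A := B) x).tendsto _).comp (h2 x)
  refine ge_of_tendsto h5 (Eventually.of_forall fun N => ?_)
  -- On a finite corner the form at `x` is a Gram form with coefficients `x i`.
  refine (gram_form_nonneg φ (fun i : Fin N => ξ i) fun i => x i).trans_eq ?_
  change _ = inner B x ((∑ i ∈ Finset.range N, ∑ j ∈ Finset.range N,
    matrixUnit i j (φ (inner A (ξ i) (ξ j)))) x)
  simp only [_root_.sum_apply, HilbertCMod.inner_sum_right, matrixUnit_apply,
    StdModule.inner_single_right, Finset.sum_range, mul_assoc]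

end GramPositive

namespace ClosedStarDerivation

variable {A B X : Type*} [NonUnitalCStarAlgebra A] [PartialOrder A] [StarOrderedRing A]
    [NonUnitalCStarAlgebra B] [PartialOrder B] [StarOrderedRing B]
    [NormedAddCommGroup X] [NormedSpace ℂ X] [SMul Aᵐᵒᵖ X] [HilbertCMod A X] [CompleteSpace X]
    {ρ : A →⋆ₙₐ[ℂ] B} (D : ClosedStarDerivation ρ)

/-- The bounds make the sum of the one-entry triples converge absolutely with norm at most `1`. Its
entries are the Gram matrix, `ρ` of it, and its derivative `S`. Knowing `P` as a positive
contraction allows functional calculus on the `ρ` side. -/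
theorem exists_triple_gram {ξ : ℕ → X} (hξ : Summable fun n => ‖ξ n‖)
    (hdom : ∀ i j, (inner A (ξ i) (ξ j) : A) ∈ D.dom)
    (hle : ∀ i j, ‖(inner A (ξ i) (ξ j) : A)‖ + ‖D.δ ⟨inner A (ξ i) (ξ j), hdom i j⟩‖ ≤
      (1 : ℝ) / 2 / 2 ^ i * ((1 : ℝ) / 2 / 2 ^ j)) :
    ∃ (P : AdjOp B (StdModule B)) (S : StdModule B →L[ℂ] StdModule B), P.IsPosContraction ∧
      ((Adjointable.analysis (A := A) hξ).flip.gram.1, P.1, S) ∈ D.triples := by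
  set f : ℕ × ℕ → (StdModule A →L[ℂ] StdModule A) × (StdModule B →L[ℂ] StdModule B) ×
      (StdModule B →L[ℂ] StdModule B) := fun p =>
    D.tripleMap (Finsupp.single p ⟨inner A (ξ p.1) (ξ p.2), hdom p.1 p.2⟩) with hf
  have hfle (p : ℕ × ℕ) : ‖f p‖ ≤ (1 : ℝ) / 2 / 2 ^ p.1 * ((1 : ℝ) / 2 / 2 ^ p.2) := by
    refine le_trans ?_ (hle p.1 p.2)
    simp only [hf, tripleMap_single]
    have h1 := norm_nonneg (inner A (ξ p.1) (ξ p.2) : A)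
    have h2 := norm_nonneg (D.δ ⟨inner A (ξ p.1) (ξ p.2), hdom p.1 p.2⟩)
    refine norm_prod_le_iff.2 ⟨(norm_matrixUnit_le _ _ _).trans (by linarith),
      norm_prod_le_iff.2 ⟨(norm_matrixUnit_le _ _ _).trans ?_,
      (norm_matrixUnit_le _ _ _).trans (by linarith)⟩⟩
    have h3 := NonUnitalStarAlgHom.norm_apply_le ρ (inner A (ξ p.1) (ξ p.2) : A)
    linarith
  have hsum := (hasSum_geometric_mul.summable.of_norm_bounded hfle).hasSum
  set t := ∑' p, f p with ht
  have hmem : t ∈ D.triples := D.isClosed_triples.mem_of_tendsto hsum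
    (Eventually.of_forall fun s => Submodule.sum_mem _ fun p _ => D.tripleMap_mem _)
  have hnorm : ‖t‖ ≤ 1 := tsum_of_norm_bounded hasSum_geometric_mul hfle
  have h1 := hsum.map (ContinuousLinearMap.fst ℂ _ _) (ContinuousLinearMap.continuous _)
  have h2 := hsum.map (ContinuousLinearMap.fst ℂ _ _ ∘L ContinuousLinearMap.snd ℂ _ _)
    (ContinuousLinearMap.continuous _)
  have h3 : HasSum (fun p : ℕ × ℕ => matrixUnit p.1 p.2 (inner A (ξ p.1) (ξ p.2) : A)) t.1 := by
    refine h1.congr_fun fun p => ?_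
    simp only [hf, tripleMap_single, Function.comp_apply]
    rfl
  have h4 : HasSum (fun p : ℕ × ℕ => matrixUnit p.1 p.2 (ρ (inner A (ξ p.1) (ξ p.2)))) t.2.1 := by
    refine h2.congr_fun fun p => ?_
    simp only [hf, tripleMap_single, Function.comp_apply]
    rfl
  obtain ⟨P, hP, hP'⟩ := exists_isPosContraction_gram ρ ξ
    (((norm_fst_le t.2).trans (norm_snd_le t)).trans hnorm) h4
  refine ⟨P, t.2.2, hP', ?_⟩
  have h5 : (Adjointable.analysis (A := A) hξ).flip.gram.1 = t.1 :=
    StdModule.clm_ext_single fun j a => StdModule.ext fun i => by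
      rw [Adjointable.analysis_comp_adj_single, hasSum_matrixUnit_single_apply h3]
  rw [h5, hP]
  exact hmem

end ClosedStarDerivation

end

noncomputable section

/-! ### Existence of absorption triples -/

/-- The ideal property, from `W (x ⟪y, S z⟫) = (W x) ⟪S' y, z⟫` and continuity. -/
theorem comp_mem_compactOperators {A E F G H : Type*} [NonUnitalCStarAlgebra A] [PartialOrder A]
    [StarOrderedRing A]
    [NormedAddCommGroup E] [NormedSpace ℂ E] [SMul Aᵐᵒᵖ E] [HilbertCMod A E]
    [NormedAddCommGroup F] [NormedSpace ℂ F] [SMul Aᵐᵒᵖ F] [HilbertCMod A F]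
    [NormedAddCommGroup G] [NormedSpace ℂ G] [SMul Aᵐᵒᵖ G] [HilbertCMod A G]
    [NormedAddCommGroup H] [NormedSpace ℂ H] [SMul Aᵐᵒᵖ H] [HilbertCMod A H]
    (W : Adjointable A F G) {S : H →L[ℂ] E} {S' : E →L[ℂ] H} (hS : IsAdjPair A S S')
    {T : E →L[ℂ] F} (hT : T ∈ compactOperators A E F) :
    W.toCLM ∘L T ∘L S ∈ compactOperators A H G := by
  refine map_mem_closure (f := fun T : E →L[ℂ] F => W.toCLM ∘L T ∘L S) (by fun_prop) hT
    fun T hT => ?_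
  rw [SetLike.mem_coe] at hT ⊢
  induction hT using Submodule.span_induction with
  | mem T hT =>
    obtain ⟨x, y, rfl⟩ := hT
    refine Submodule.subset_span ⟨W.toCLM x, S' y, ContinuousLinearMap.ext fun z => ?_⟩
    rw [ContinuousLinearMap.comp_apply, ContinuousLinearMap.comp_apply, rankOne_apply,
      rankOne_apply, W.map_op_smul, hS.symm]
  | zero => simp
  | add T T' _ _ h h' =>
    beta_reduce
    rw [ContinuousLinearMap.add_comp, ContinuousLinearMap.comp_add]
    exact add_mem h h'
  | smul c T _ h =>
    beta_reduce
    rw [ContinuousLinearMap.smul_comp, ContinuousLinearMap.comp_smul]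
    exact Submodule.smul_mem _ c h

/-! ### The isometry with its frame, and the blocks of `W T²ⁿ W⋆`. -/

namespace Adjointable

open HilbertCMod

variable {A X : Type*} [NonUnitalCStarAlgebra A] [PartialOrder A] [StarOrderedRing A]
    [NormedAddCommGroup X] [NormedSpace ℂ X] [SMul Aᵐᵒᵖ X] [HilbertCMod A X] [CompleteSpace X]

section Isom

variable {ξ : ℕ → X} (hξ : Summable fun n => ‖ξ n‖) {R : AdjOp A X} (hR : IsSelfAdjoint R)
    (hRR : R * R = 2 - (analysis (A := A) hξ).gram) (hRc : Commute R (analysis (A := A) hξ).gram)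

include hR hRR hRc in
theorem exists_adjointable_isom (h : ‖(analysis (A := A) hξ).toCLM‖ ≤ 1)
    (hd : DenseRange (analysis (A := A) hξ).adj) :
    ∃ (W : Adjointable A X (StdModule A)) (ζ : ℕ → X),
      W.adj ∘L W.toCLM = ContinuousLinearMap.id ℂ X ∧
      (∀ η n, W.toCLM η n = inner A (ζ n) η) ∧
      ∀ η M, ‖W.toCLM η - (analysis (A := A) hξ).partialIsom R M η‖ ^ 2 =
        ‖(inner A η (((1 - (analysis (A := A) hξ).gram) ^ (2 * M)).1 η) : A)‖ := by
  set Φ := analysis (A := A) hξ with hΦ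
  obtain ⟨V, hV, hVin, hVn⟩ := Φ.exists_isom hR hRR hRc h hd
  -- The coordinate of `W η` at the pair `(m, n)` is `⟪ξₙ, (1 - T)ᵐ R η⟫` with `T = Φ⋆ Φ`, so the
  -- frame vector is `R (1 - T)ᵐ ξₙ`.
  set ζ : ℕ → X := fun p => (star (Φ.coef R p.unpair.1)).1 (ξ p.unpair.2) with hζ
  have h1 (η : X) (p : ℕ) : V η p = inner A (ζ p) η := by
    have h2 := ((StdModule.continuous_eval p).tendsto _).comp (hV η)
    refine tendsto_nhds_unique h2 (tendsto_const_nhds.congr' ?_)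
    filter_upwards [eventually_gt_atTop p.unpair.1] with M hM
    have h3 := Φ.partialIsom_apply_pair R M η p.unpair.1 p.unpair.2 hM
    rw [Nat.pair_unpair, hΦ, analysis_apply, ← hΦ] at h3
    rw [Function.comp_apply, h3, hζ]
    exact (Φ.coef R p.unpair.1).isAdjPair.symm _ _
  refine ⟨ofCoords V (fun p => (opSMulCLM (ζ p)).toLinearMap) fun n a z => ?_, ζ, ?_, h1, hVn⟩
  · rw [h1]
    exact HilbertCMod.inner_smul_left _ _ _
  · refine ContinuousLinearMap.ext fun η => ext_inner (A := A) fun z => ?_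
    rw [ContinuousLinearMap.comp_apply, ← inner_adj]
    exact hVin z η

end Isom

variable (Φ : Adjointable A X (StdModule A)) {R : AdjOp A X}

/-- The hypothesis controls the error only through the form of `(1 - T)²ᴹ`, where `T = Φ⋆ Φ`. After
composition with `Tⁿ` the bound becomes uniform, since `‖Tⁿ (1 - T)²ᴹ‖ → 0` for `n > 0`. -/
theorem tendsto_comp_gram_pow (h : ‖Φ.toCLM‖ ≤ 1) {V : X →L[ℂ] StdModule A}
    (hV : ∀ η M, ‖V η - Φ.partialIsom R M η‖ ^ 2 =
      ‖(inner A η (((1 - Φ.gram) ^ (2 * M)).1 η) : A)‖) {n : ℕ} (hn : 0 < n) :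
    Tendsto (fun M => Φ.partialIsom R M ∘L (Φ.gram ^ n).1) atTop (𝓝 (V ∘L (Φ.gram ^ n).1)) := by
  have hT := isPosContraction_gram h
  set c := ‖(Φ.gram ^ n).1‖ * (Real.exp 1 * n.factorial) with hc
  have h1 (M : ℕ) : ‖Φ.partialIsom R M ∘L (Φ.gram ^ n).1 - V ∘L (Φ.gram ^ n).1‖ ≤
      √(c * (1 / ((M : ℝ) + 1))) := by
    refine ContinuousLinearMap.opNorm_le_bound _ (Real.sqrt_nonneg _) fun y => ?_
    refine le_of_sq_le_sq ?_ (by positivity)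
    rw [mul_pow, Real.sq_sqrt (by positivity), _root_.sub_apply, norm_sub_rev]
    refine (hV ((Φ.gram ^ n).1 y) M).trans_le ((norm_inner_le _ _).trans ?_)
    have h2 : Commute ((1 - Φ.gram) ^ (2 * M)) (Φ.gram ^ n) :=
      ((Commute.one_left _).sub_left (Commute.refl _)).pow_pow _ _
    have h3 : ‖((1 - Φ.gram) ^ (2 * M)).1 ((Φ.gram ^ n).1 y)‖ ≤
        Real.exp 1 * n.factorial / ((2 * M : ℕ) + 1) ^ n * ‖y‖ := by
      rw [show ((1 - Φ.gram) ^ (2 * M)).1 ((Φ.gram ^ n).1 y) =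
        ((1 - Φ.gram) ^ (2 * M) * Φ.gram ^ n).1 y from rfl, h2.eq]
      exact ContinuousLinearMap.le_of_opNorm_le _ (hT.norm_pow_mul_le n (2 * M)) _
    -- A rate independent of `n` is enough here.
    have h4 : Real.exp 1 * n.factorial / (((2 * M : ℕ) : ℝ) + 1) ^ n ≤
        Real.exp 1 * n.factorial * (1 / ((M : ℝ) + 1)) := by
      rw [← mul_one_div]
      have h5 : (M : ℝ) + 1 ≤ (((2 * M : ℕ) : ℝ) + 1) ^ n := by
        refine le_trans ?_ (le_self_pow₀ (by push_cast; linarith [M.cast_nonneg (α := ℝ)]) hn.ne')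
        push_cast
        linarith [M.cast_nonneg (α := ℝ)]
      gcongr
    calc _ ≤ (‖(Φ.gram ^ n).1‖ * ‖y‖) * (Real.exp 1 * n.factorial * (1 / ((M : ℝ) + 1)) * ‖y‖) := by
          gcongr
          · exact ContinuousLinearMap.le_opNorm _ _
          · exact h3.trans (by gcongr)
      _ = _ := by rw [hc]; ring
  rw [tendsto_iff_norm_sub_tendsto_zero]
  refine squeeze_zero (fun _ => norm_nonneg _) h1 ?_
  have h2 := (Real.continuous_sqrt.tendsto _).comp
    ((tendsto_one_div_add_atTop_nhds_zero_nat (𝕜 := ℝ)).const_mul c)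
  rw [mul_zero, Real.sqrt_zero] at h2
  exact h2

theorem tendsto_gram_pow_comp_adj (h : ‖Φ.toCLM‖ ≤ 1) {W : Adjointable A X (StdModule A)}
    (hW : ∀ η M, ‖W.toCLM η - Φ.partialIsom R M η‖ ^ 2 =
      ‖(inner A η (((1 - Φ.gram) ^ (2 * M)).1 η) : A)‖) {n : ℕ} (hn : 0 < n) :
    Tendsto (fun M => (Φ.gram ^ n).1 ∘L Φ.partialIsomAdj R M) atTop
      (𝓝 ((Φ.gram ^ n).1 ∘L W.adj)) := by
  have h1 := Φ.tendsto_comp_gram_pow h hW hn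
  rw [tendsto_iff_norm_sub_tendsto_zero] at h1 ⊢
  refine h1.congr fun M => ?_
  have h2 := AdjOp.isSelfAdjoint_iff.1 (Φ.isSelfAdjoint_gram.pow n)
  exact (((Φ.isAdjPair_partialIsom R M).comp h2).sub
    ((IsAdjPair.of_adjointable W).comp h2)).norm_eq

/-- All factors commute and the two copies of `R` merge into `R² = 2 - T`, where `T = Φ⋆ Φ`. The
square root disappears, leaving a polynomial in `T`. -/
theorem coef_mul_gram_pow_mul_star_coef (hR : IsSelfAdjoint R) (hRR : R * R = 2 - Φ.gram)
    (hRc : Commute R Φ.gram) (m k n : ℕ) :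
    Φ.coef R m * Φ.gram ^ n * (Φ.gram ^ n * star (Φ.coef R k)) =
      Φ.gram ^ n * ((1 - Φ.gram) ^ (m + k) * Φ.gram ^ n) * (1 + 1 - Φ.gram) := by
  have hT : Commute (1 - Φ.gram) Φ.gram := (Commute.one_left _).sub_left (Commute.refl _)
  have hRT : Commute R (1 - Φ.gram) := (Commute.one_right R).sub_right hRc
  rw [Φ.star_coef hR, coef, one_add_one_eq_two, ← hRR, pow_add]
  set T := Φ.gram
  set Q := 1 - T
  have e1 : R * T ^ n = T ^ n * R := (hRc.pow_right n).eq
  have e2 : Q ^ m * T ^ n = T ^ n * Q ^ m := (hT.pow_pow m n).eq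
  have e3 : Q ^ k * T ^ n = T ^ n * Q ^ k := (hT.pow_pow k n).eq
  have e4 : R * Q ^ k = Q ^ k * R := (hRT.pow_right k).eq
  calc Q ^ m * R * T ^ n * (T ^ n * (R * Q ^ k)) = Q ^ m * (R * T ^ n) * T ^ n * (R * Q ^ k) := by
        simp only [mul_assoc]
    _ = (Q ^ m * T ^ n) * (R * T ^ n) * (R * Q ^ k) := by
        conv_lhs => rw [e1]
        simp only [mul_assoc]
    _ = T ^ n * Q ^ m * T ^ n * (R * (R * Q ^ k)) := by rw [e1, e2]; simp only [mul_assoc]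
    _ = T ^ n * Q ^ m * (T ^ n * Q ^ k) * (R * R) := by
        rw [e4, ← mul_assoc R, e4]; simp only [mul_assoc]
    _ = _ := by rw [← e3]; simp only [mul_assoc]

/-- By intertwining, `Φ p(Φ⋆ Φ) Φ⋆ = p(Φ Φ⋆) Φ Φ⋆`. The result is a polynomial in the Gram matrix
without constant term, hence accessible to the algebra of triples. -/
theorem comp_coef_comp_adj (hR : IsSelfAdjoint R) (hRR : R * R = 2 - Φ.gram)
    (hRc : Commute R Φ.gram) (m k n : ℕ) :
    Φ.toCLM ∘L (Φ.coef R m * Φ.gram ^ n * (Φ.gram ^ n * star (Φ.coef R k))).1 ∘L Φ.adj =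
      Φ.flip.gram.1 ^ n * ((1 - Φ.flip.gram.1) ^ (m + k) * Φ.flip.gram.1 ^ n) *
        (Φ.flip.gram.1 + Φ.flip.gram.1 - Φ.flip.gram.1 * Φ.flip.gram.1) := by
  rw [Φ.coef_mul_gram_pow_mul_star_coef hR hRR hRc]
  have h1 := Intertwines.gram Φ
  have h2 := ((h1.pow n).mul (((Intertwines.one.sub h1).pow (m + k)).mul (h1.pow n))).mul
    ((Intertwines.one.add Intertwines.one).sub h1)
  have h3 : Φ.flip.gram ^ n * ((1 - Φ.flip.gram) ^ (m + k) * Φ.flip.gram ^ n) *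
      (1 + 1 - Φ.flip.gram) * Φ.flip.gram =
      Φ.flip.gram ^ n * ((1 - Φ.flip.gram) ^ (m + k) * Φ.flip.gram ^ n) *
        (Φ.flip.gram + Φ.flip.gram - Φ.flip.gram * Φ.flip.gram) := by
    rw [mul_assoc, sub_mul, add_mul, one_mul]
  refine ContinuousLinearMap.ext fun x => (h2 (Φ.adj x)).trans ?_
  exact congrArg (fun S : AdjOp A (StdModule A) => S.1 x) h3

theorem partialIsom_comp_partialIsomAdj (hR : IsSelfAdjoint R) (hRR : R * R = 2 - Φ.gram)
    (hRc : Commute R Φ.gram) (M n : ℕ) :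
    (Φ.partialIsom R M ∘L (Φ.gram ^ n).1) ∘L ((Φ.gram ^ n).1 ∘L Φ.partialIsomAdj R M) =
      ∑ m ∈ Finset.range M, ∑ k ∈ Finset.range M, (StdModule.block A m).adj *
        (Φ.flip.gram.1 ^ n * ((1 - Φ.flip.gram.1) ^ (m + k) * Φ.flip.gram.1 ^ n) *
          (Φ.flip.gram.1 + Φ.flip.gram.1 - Φ.flip.gram.1 * Φ.flip.gram.1)) *
        (StdModule.block A k).toCLM := by
  refine ContinuousLinearMap.ext fun x => ?_
  simp only [← Φ.comp_coef_comp_adj hR hRR hRc, _root_.sum_apply]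
  rw [ContinuousLinearMap.comp_apply, ContinuousLinearMap.comp_apply,
    ContinuousLinearMap.comp_apply, partialIsom_apply]
  refine Finset.sum_congr rfl fun m _ => ?_
  rw [partialIsomAdj_apply]
  simp only [map_sum]
  rfl

end Adjointable

/-! ### Summation of the differentiated blocks and construction of the absorption triple. -/

namespace ClosedStarDerivation

variable {A B X : Type*} [NonUnitalCStarAlgebra A] [PartialOrder A] [StarOrderedRing A]
    [NonUnitalCStarAlgebra B] [PartialOrder B] [StarOrderedRing B]
    [NormedAddCommGroup X] [NormedSpace ℂ X] [SMul Aᵐᵒᵖ X] [HilbertCMod A X] [CompleteSpace X]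
    {ρ : A →⋆ₙₐ[ℂ] B} (D : ClosedStarDerivation ρ)

/-- Fourth-order decay in `m + k` splits as `(m + k + 1)⁴ ≥ (m + 1)² (k + 1)²`, which is summable in
both indices. -/
theorem norm_block_conj_le (U : ℕ → StdModule B →L[ℂ] StdModule B) {c : ℝ}
    (hU : ∀ N, ‖U N‖ ≤ c / ((N : ℝ) + 1) ^ 4) (p : ℕ × ℕ) :
    ‖(StdModule.block B p.1).adj * U (p.1 + p.2) * (StdModule.block B p.2).toCLM‖ ≤
      c * (1 / ((p.1 : ℝ) + 1) ^ 2 * (1 / ((p.2 : ℝ) + 1) ^ 2)) := by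
  have hc : 0 ≤ c := by simpa using (norm_nonneg _).trans (hU 0)
  have h1 : ‖(StdModule.block B p.1).adj * U (p.1 + p.2) * (StdModule.block B p.2).toCLM‖ ≤
      1 * ‖U (p.1 + p.2)‖ * 1 :=
    (norm_mul_le _ _).trans (mul_le_mul ((norm_mul_le _ _).trans
      (mul_le_mul_of_nonneg_right (StdModule.norm_block_adj_le _) (norm_nonneg _)))
      (StdModule.norm_block_le _) (norm_nonneg _) (by positivity))
  rw [one_mul, mul_one] at h1
  refine h1.trans ((hU _).trans ?_)
  rw [one_div_mul_one_div, mul_one_div]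
  refine div_le_div_of_nonneg_left hc (by positivity) ?_
  push_cast
  have h2 : (0 : ℝ) ≤ p.1 := p.1.cast_nonneg
  have h3 : (0 : ℝ) ≤ p.2 := p.2.cast_nonneg
  calc ((p.1 : ℝ) + 1) ^ 2 * ((p.2 : ℝ) + 1) ^ 2
      ≤ ((p.1 : ℝ) + p.2 + 1) ^ 2 * ((p.1 : ℝ) + p.2 + 1) ^ 2 := by gcongr <;> linarith
    _ = _ := by ring

theorem summable_one_div_sq_mul :
    Summable fun p : ℕ × ℕ => 1 / ((p.1 : ℝ) + 1) ^ 2 * (1 / ((p.2 : ℝ) + 1) ^ 2) := by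
  have h : Summable fun n : ℕ => 1 / ((n : ℝ) + 1) ^ 2 := by
    have := (summable_nat_add_iff 1).2 (Real.summable_one_div_nat_pow.2 one_lt_two)
    exact this.congr fun n => by push_cast; rfl
  exact h.mul_of_nonneg h (fun _ => by positivity) (fun _ => by positivity)

/-- The finite block sums are triples. Their first entries converge by assumption, the other two by
absolute summability, and the space of triples is closed. -/
theorem isDiffCompact_of_tendsto_block {Y : ℕ → StdModule A →L[ℂ] StdModule A}
    {U V : ℕ → StdModule B →L[ℂ] StdModule B} {c : ℝ}
    (h : ∀ N, (Y N, U N, V N) ∈ D.triples ∧ ‖U N‖ ≤ c / ((N : ℝ) + 1) ^ 4 ∧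
      ‖V N‖ ≤ c / ((N : ℝ) + 1) ^ 4) {Q : StdModule A →L[ℂ] StdModule A}
    (hQ : Tendsto (fun M => ∑ m ∈ Finset.range M, ∑ k ∈ Finset.range M,
      (StdModule.block A m).adj * Y (m + k) * (StdModule.block A k).toCLM) atTop (𝓝 Q)) :
    D.IsDiffCompact Q := by
  have hU := ((summable_one_div_sq_mul.mul_left c).of_norm_bounded
    (norm_block_conj_le U fun N => (h N).2.1)).hasSum.tendsto_sum_range_range
  have hV := ((summable_one_div_sq_mul.mul_left c).of_norm_bounded
    (norm_block_conj_le V fun N => (h N).2.2)).hasSum.tendsto_sum_range_range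
  have h1 := hQ.prodMk_nhds (hU.prodMk_nhds hV)
  refine D.isDiffCompact_of_mem_triples (D.isClosed_triples.mem_of_tendsto h1
    (Eventually.of_forall fun M => ?_))
  have h2 := Submodule.sum_mem D.triples (t := Finset.range M) fun m _ =>
    Submodule.sum_mem D.triples (t := Finset.range M) fun k _ =>
      D.block_mem_triples (h (m + k)).1 m k
  refine Set.mem_of_eq_of_mem ?_ h2
  simp only [Prod.ext_iff, Prod.fst_sum, Prod.snd_sum, and_self]

theorem exists_scaled_generators (g : ℕ → X) (hg : ∀ n m, (inner A (g n) (g m) : A) ∈ D.dom)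
    (hgen : Dense (Submodule.span ℂ {x : X | ∃ (n : ℕ) (a : A), x = g n <• a} : Set X)) :
    ∃ (ξ : ℕ → X) (hdom : ∀ i j, (inner A (ξ i) (ξ j) : A) ∈ D.dom),
      (∀ i j, ‖(inner A (ξ i) (ξ j) : A)‖ + ‖D.δ ⟨inner A (ξ i) (ξ j), hdom i j⟩‖ ≤
        (1 : ℝ) / 2 / 2 ^ i * ((1 : ℝ) / 2 / 2 ^ j)) ∧
      Dense (Submodule.span ℂ {x : X | ∃ (n : ℕ) (a : A), x = ξ n <• a} : Set X) := by
  obtain ⟨c, hc0, hc⟩ := exists_scaling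
    (fun i j => ‖(inner A (g i) (g j) : A)‖ + ‖D.δ ⟨inner A (g i) (g j), hg i j⟩‖)
    fun i j => by positivity
  have h1 (i j : ℕ) : (inner A ((c i : ℂ) • g i) ((c j : ℂ) • g j) : A) =
      ((c i * c j : ℝ) : ℂ) • inner A (g i) (g j) := by
    rw [HilbertCMod.inner_smul_complex, HilbertCMod.inner_smul_complex_left, smul_smul,
      RCLike.star_def, Complex.conj_ofReal, mul_comm, Complex.ofReal_mul]
  have hdom (i j : ℕ) : (inner A ((c i : ℂ) • g i) ((c j : ℂ) • g j) : A) ∈ D.dom := by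
    rw [h1]
    exact SMulMemClass.smul_mem _ (hg i j)
  refine ⟨fun i => (c i : ℂ) • g i, hdom, fun i j => ?_, ?_⟩
  · have h2 : (⟨inner A ((c i : ℂ) • g i) ((c j : ℂ) • g j), hdom i j⟩ : D.dom) =
        ((c i * c j : ℝ) : ℂ) • ⟨inner A (g i) (g j), hg i j⟩ := Subtype.ext (h1 i j)
    rw [h2, map_smul, h1, norm_smul, norm_smul, Complex.norm_real,
      Real.norm_of_nonneg (mul_nonneg (hc0 i).le (hc0 j).le), ← mul_add]
    exact hc i j
  · refine hgen.mono (Submodule.span_mono ?_)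
    rintro _ ⟨n, a, rfl⟩
    -- The scalar is absorbed into the coefficient, so rescaling does not shrink the span.
    refine ⟨n, ((c n)⁻¹ : ℂ) • a, ?_⟩
    rw [HilbertCMod.op_smul_smul, HilbertCMod.smul_op_smul, smul_smul, inv_mul_cancel₀, one_smul]
    exact_mod_cast (hc0 n).ne'

theorem exists_absorption (g : ℕ → X) (hg : ∀ n m, (inner A (g n) (g m) : A) ∈ D.dom)
    (hgen : Dense (Submodule.span ℂ {x : X | ∃ (n : ℕ) (a : A), x = g n <• a} : Set X)) :
    ∃ (W : Adjointable A X (StdModule A)) (K : Adjointable A (StdModule A) (StdModule A))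
      (ζ : ℕ → X), D.IsAbsorption W K ζ := by
  obtain ⟨ξ, hdom, hle, hξgen⟩ := D.exists_scaled_generators g hg hgen
  -- The diagonal case of `hle`; these bounds sum to `1`.
  have hb (n : ℕ) : ‖ξ n‖ ≤ (1 : ℝ) / 2 / 2 ^ n := by
    refine le_of_sq_le_sq ?_ (by positivity)
    rw [HilbertCMod.norm_sq_eq (A := A), sq]
    exact le_trans (le_add_of_nonneg_right (norm_nonneg _)) (hle n n)
  have hgeo := hasSum_geometric_two' 1
  have hξ : Summable fun n => ‖ξ n‖ :=
    Summable.of_nonneg_of_le (fun _ => norm_nonneg _) hb hgeo.summable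
  obtain ⟨P, S, hP, hmem⟩ := D.exists_triple_gram hξ hdom hle
  have hΦ : ‖(Adjointable.analysis (A := A) hξ).toCLM‖ ≤ 1 :=
    (Adjointable.norm_analysis_le hξ.hasSum).trans (hasSum_le hb hξ.hasSum hgeo)
  have hd := Adjointable.denseRange_analysis_adj hξ hξgen
  have hcomp := Adjointable.gram_analysis_mem_compactOperators (A := A) hξ
  have hT := Adjointable.isPosContraction_gram hΦ
  obtain ⟨R, hR, hRR, hRc⟩ := hT.exists_sqrt
  obtain ⟨W, ζ, hiso, hframe, hW⟩ := Adjointable.exists_adjointable_isom hξ hR hRR hRc hΦ hd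
  set Φ := Adjointable.analysis (A := A) hξ
  obtain ⟨U, V, c, hUV⟩ := D.exists_triple_bound hmem fun N => hP.norm_pow_mul_le 5 N
  have hiso' (x : X) : W.adj (W.toCLM x) = x := DFunLike.congr_fun hiso x
  have hpair : IsAdjPair A (W.toCLM ∘L (Φ.gram ^ 5).1 ∘L W.adj)
      (W.toCLM ∘L (Φ.gram ^ 5).1 ∘L W.adj) :=
    (IsAdjPair.of_adjointable W).comp
      ((AdjOp.isSelfAdjoint_iff.1 (hT.isSelfAdjoint.pow 5)).comp
        (IsAdjPair.of_adjointable W).symm)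
  -- With `T = Φ.gram` the choice is `K = W T⁵ W⋆`, so that `W⋆ K W = T⁵` and `P K² = W T¹⁰ W⋆`. The
  -- exponent `5` is that of the estimates behind `hUV`.
  refine ⟨W, ⟨_, _, hpair⟩, ζ, hiso, rfl, fun x => ?_, ?_, ?_, ?_, ?_, hframe⟩
  -- Splitting `T⁵ = T² T T²` reduces positivity of `K` to that of `T`.
  · have h1 : (inner A x (W.toCLM ((Φ.gram ^ 5).1 (W.adj x))) : A) =
        inner A ((Φ.gram ^ 2).1 (W.adj x)) (Φ.gram.1 ((Φ.gram ^ 2).1 (W.adj x))) := by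
      rw [← W.inner_adj_left, (AdjOp.isSelfAdjoint_iff.1 (hT.isSelfAdjoint.pow 2)) (W.adj x),
        show Φ.gram ^ 5 = Φ.gram ^ 2 * (Φ.gram * Φ.gram ^ 2) by
          rw [← pow_succ', ← pow_add]]
      rfl
    exact h1.symm ▸ hT.nonneg _
  · refine ContinuousLinearMap.ext fun x => ?_
    simp only [ContinuousLinearMap.comp_apply, hiso']
  · have h1 : W.adj ∘L (W.toCLM ∘L (Φ.gram ^ 5).1 ∘L W.adj) ∘L W.toCLM = (Φ.gram ^ 5).1 := by
      refine ContinuousLinearMap.ext fun x => ?_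
      simp only [ContinuousLinearMap.comp_apply, hiso']
    change DenseRange (W.adj ∘L (W.toCLM ∘L (Φ.gram ^ 5).1 ∘L W.adj) ∘L W.toCLM)
    rw [h1]
    exact Adjointable.denseRange_gram_pow hΦ hd 5
  -- One factor `T` supplies compactness; the remaining `T⁴ W⋆` is merely adjointable.
  · have h1 : (W.toCLM ∘L W.adj) ∘L (W.toCLM ∘L (Φ.gram ^ 5).1 ∘L W.adj) =
        W.toCLM ∘L Φ.gram.1 ∘L ((Φ.gram ^ 4).1 ∘L W.adj) := by
      refine ContinuousLinearMap.ext fun x => ?_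
      simp only [ContinuousLinearMap.comp_apply, hiso']
      rw [pow_succ' Φ.gram 4]
      rfl
    change (W.toCLM ∘L W.adj) ∘L (W.toCLM ∘L (Φ.gram ^ 5).1 ∘L W.adj) ∈ _
    rw [h1]
    exact comp_mem_compactOperators W ((AdjOp.isSelfAdjoint_iff.1
      (hT.isSelfAdjoint.pow 4)).comp (IsAdjPair.of_adjointable W).symm) hcomp
  · have h1 : (W.toCLM ∘L W.adj) ∘L (W.toCLM ∘L (Φ.gram ^ 5).1 ∘L W.adj) ∘L
        (W.toCLM ∘L (Φ.gram ^ 5).1 ∘L W.adj) =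
        (W.toCLM ∘L (Φ.gram ^ 5).1) ∘L ((Φ.gram ^ 5).1 ∘L W.adj) := by
      refine ContinuousLinearMap.ext fun x => ?_
      simp only [ContinuousLinearMap.comp_apply, hiso']
    change D.IsDiffCompact ((W.toCLM ∘L W.adj) ∘L (W.toCLM ∘L (Φ.gram ^ 5).1 ∘L W.adj) ∘L
        (W.toCLM ∘L (Φ.gram ^ 5).1 ∘L W.adj))
    rw [h1]
    refine D.isDiffCompact_of_tendsto_block hUV ?_
    -- Composition is jointly norm continuous, so giving each side of `T¹⁰` a factor `T⁵` turns the
    -- partial isometries into a norm convergent block sum.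
    have h2 := (isBoundedBilinearMap_comp (𝕜 := ℂ)).continuous.tendsto _ |>.comp
      ((Φ.tendsto_comp_gram_pow hΦ hW (n := 5) (by norm_num)).prodMk_nhds
        (Φ.tendsto_gram_pow_comp_adj hΦ hW (n := 5) (by norm_num)))
    exact h2.congr fun M => Φ.partialIsom_comp_partialIsomAdj hR hRR hRc M 5

end ClosedStarDerivation

end
theorem mainTheorem3 {A B X : Type*}
    [NonUnitalCStarAlgebra A] [PartialOrder A] [StarOrderedRing A]
    [NonUnitalCStarAlgebra B] [PartialOrder B] [StarOrderedRing B]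
    [NormedAddCommGroup X] [NormedSpace ℂ X] [CompleteSpace X] [SMul Aᵐᵒᵖ X] [HilbertCMod A X]
    (ρ : A →⋆ₙₐ[ℂ] B) (hρ : Function.Injective ρ) (D : ClosedStarDerivation ρ)
    (g : ℕ → X) (hg : ∀ n m, inner A (g n) (g m) ∈ D.dom)
    (hgen : Dense (Submodule.span ℂ {x : X | ∃ (n : ℕ) (a : A), x = g n <• a} : Set X)) :
    (∃ (W : Adjointable A X (StdModule A)) (K : Adjointable A (StdModule A) (StdModule A))
      (ζ : ℕ → X), D.IsAbsorption W K ζ) ∧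
    ∀ (W : Adjointable A X (StdModule A)) (K : Adjointable A (StdModule A) (StdModule A))
      (ζ : ℕ → X), D.IsAbsorption W K ζ →
      -- `𝒳` is dense in `X`
      Dense (D.grassmannDomain W K : Set X) ∧
      -- `𝒳` is an `A_δ`-submodule, `W` maps `𝒳` to `H_{A_δ}`, and the inner products of elements
      -- of `𝒳` are in `A_δ`
      ∃ (hmod : ∀ (η : D.grassmannDomain W K) (a : D.diffAlg),
          (η : X) <• (a : A) ∈ D.grassmannDomain W K)
        (hW : ∀ ξ : D.grassmannDomain W K, W.toCLM ξ ∈ D.diffStd)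
        (hin : ∀ ξ η : D.grassmannDomain W K, inner A (ξ : X) (η : X) ∈ D.diffAlg),
      -- the operator `W ⊗ 1 : X ⊗̂_A Ω_δ(A) → H_{Ω_δ(A)}`, `ξ ⊗ ω ↦ W(ξ) ω`, is adjointable
      ∃ W₁ : Adjointable D.Forms (InteriorTensor X D.rho) (StdModule D.Forms),
        (∀ (ξ : X) (ω : D.Forms) (n : ℕ),
          W₁.toCLM (InteriorTensor.tmul D.rho ξ ω) n = D.rho (W.toCLM ξ n) * ω) ∧
      -- the Graßmann connection `∇ = (W⋆ ⊗ 1) δ W`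
      ∃ nabla : D.grassmannDomain W K →ₗ[ℂ] InteriorTensor X D.rho,
        (∀ ξ, nabla ξ = W₁.adj (D.dStd ⟨W.toCLM ξ, hW ξ⟩)) ∧
        -- the Hermitian identity
        (∀ ξ η : D.grassmannDomain W K,
          D.d ⟨inner A (ξ : X) (η : X), hin ξ η⟩ =
            (InteriorTensor.creation D.rho (ξ : X)).adj (nabla η) -
              star ((InteriorTensor.creation D.rho (η : X)).adj (nabla ξ))) ∧
        -- the Leibniz rule
        (∀ (η : D.grassmannDomain W K) (a : D.diffAlg),
          nabla ⟨(η : X) <• (a : A), hmod η a⟩ =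
            nabla η <• D.rho a + InteriorTensor.tmul D.rho (η : X) (D.d a)) := by
  exact ⟨D.exists_absorption g hg hgen, fun W K ζ h => grassmann_connection D W K ζ h⟩
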